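/- **Setting.** Let $d\in\mathbb N$, let $|\cdot|$ be the Euclidean norm, and let $U\in\mathcal C^2(\mathbb R^d)$. Suppose that there are $L,m>0$ such that, for all $x,y\in\mathbb R^d$, $$|\nabla U(x)-\nabla U(y)|\le L|x-y|,\qquad (x-y)\cdot(\nabla U(x)-\nabla U(y))\ge m|x-y|^2 .$$ Let $\gamma\ge 2\sqrt L$, $0<\delta\le m/(33\gamma^3)$ and $\eta=e^{-\delta\gamma/2}$. The OBABO chain is the time-homogeneous Markov chain $(Z_k)_{k\in\mathbb N}=((x_k,v_k))_{k\in\mathbb N}$ on $\mathbb R^{2d}=\mathbb R^d\times\mathbb R^d$ whose transition $(x_0,v_0)\mapsto(x_1,v_1)$ is given by $$x_1=x_0+\delta\left(\eta v_0+\sqrt{1-\eta^2}\,G\right)-\tfrac{\delta^2}{2}\nabla U(x_0),$$ $$v_1=\eta^2v_0-\tfrac{\delta\eta}{2}\left(\nabla U(x_0)+\nabla U(x_1)\right)+\sqrt{1-\eta^2}\,(\eta G+G'),$$ where $G,G'$ are independent standard Gaussian vectors of $\mathbb R^d$. Put $$K_1=\sqrt3\,\max(L^{1/2},L^{-1/2}),\qquad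 \kappa=\frac{m}{3\gamma}.$$ A probability measure $\nu$ on $\mathbb R^{2d}$ satisfies a log-Sobolev inequality with constant $C$ if, for all bounded Lipschitz $\varphi:\mathbb R^{2d}\to\mathbb R$, $$\int\varphi^2\ln(\varphi^2)\,d\nu-\left(\int\varphi^2\,d\nu\right)\ln\left(\int\varphi^2\,d\nu\right)\le C\int|\nabla\varphi|^2\,d\nu ,$$ where $|\nabla\varphi|(z)=\limsup_{z'\to z,\,z'\neq z}|\varphi(z')-\varphi(z)|/|z'-z|$ (the length of the gradient wherever $\varphi$ is differentiable). $\mathcal W_1$ denotes the $L^1$-Wasserstein distance for the Euclidean distance on $\mathbb R^{2d}$. **Theorem.** The OBABO chain has a unique invariant probability measure $\pi_\delta$. It satisfies a log-Sobolev inequality with constant $$C_{lS}=\frac6m K_1^2\gamma^2\left(1+\delta+\frac{\delta^2L}{2}\right)^2 ,$$ and it integrates every $1$-Lipschitz function. Moreover, if a probability measure $\mu_0$ on $\mathbb R^{2d}$ satisfies a log-Sobolev inequality with constant $C'>0$, then $\mathcal W_1(\mu_0,\pi_\delta)<\infty$, and if $(Z_k)_{k\in\mathbb N}$ is an OBABO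 chain with $Z_0\sim\mu_0$, then for all $1$-Lipschitz $\varphi:\mathbb R^{2d}\to\mathbb R$, all integers $n\ge1$ and all $u\ge0$, $$\mathbb P\left(\left|\frac1n\sum_{k=1}^n\varphi(Z_k)-\pi_\delta(\varphi)\right|\ge u+\frac{2K_1}{n\kappa\delta}\mathcal W_1(\mu_0,\pi_\delta)\right)\le 2\exp\left(-\frac{nu^2\kappa\delta}{4C_{lS}+4K_1^2C'/(n\kappa\delta)}\right).$$ -/

import Mathlib

open MeasureTheory ProbabilityTheory Filter Topology
open scoped ENNReal NNReal

/-- The phase space `ℝ^d × ℝ^d` of pairs (position, velocity), with the Euclidean norm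
`‖(x, v)‖ ^ 2 = ‖x‖ ^ 2 + ‖v‖ ^ 2` of `ℝ^{2d}`. -/
abbrev PhaseSpace (d : ℕ) : Type :=
  WithLp 2 (EuclideanSpace ℝ (Fin d) × EuclideanSpace ℝ (Fin d))

noncomputable section

/-- The map `Θ`: one step of the OBABO scheme with potential `U`, friction `γ` and time step `δ`,
from the state `z = (x₀, v₀)` with noises `w = (g, g')`, where `η = exp (- δ γ / 2)`:
half damping (O), half kick (B), free transport (A), half kick (B), half damping (O). -/
def obaboStep {d : ℕ} (U : EuclideanSpace ℝ (Fin d) → ℝ) (γ δ : ℝ) (z : PhaseSpace d)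
    (w : EuclideanSpace ℝ (Fin d) × EuclideanSpace ℝ (Fin d)) : PhaseSpace d :=
  let η : ℝ := Real.exp (-(δ * γ / 2))
  let x₁ := z.fst + δ • (η • z.snd + √(1 - η ^ 2) • w.1) - (δ ^ 2 / 2) • gradient U z.fst
  let v₁ := η ^ 2 • z.snd - (δ * η / 2) • (gradient U z.fst + gradient U x₁)
    + √(1 - η ^ 2) • (η • w.1 + w.2)
  WithLp.toLp 2 (x₁, v₁)

/-- The Markov kernel `P` of the OBABO chain: `P (z, ·)` is the law of `Θ (z, G, G')`, with
`G` and `G'` independent standard Gaussian vectors of `ℝ^d`. (`Kernel.map` is the image kernel as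
soon as `Θ` is measurable, see `obaboKernel_apply`.) -/
def obaboKernel {d : ℕ} (U : EuclideanSpace ℝ (Fin d) → ℝ) (γ δ : ℝ) :
    Kernel (PhaseSpace d) (PhaseSpace d) :=
  Kernel.map
    (Kernel.id ×ₖ Kernel.const (PhaseSpace d)
      ((stdGaussian (EuclideanSpace ℝ (Fin d))).prod (stdGaussian (EuclideanSpace ℝ (Fin d)))))
    (fun p => obaboStep U γ δ p.1 p.2)

theorem measurable_obaboStep {d : ℕ} {U : EuclideanSpace ℝ (Fin d) → ℝ}
    (hU : Measurable (gradient U)) (γ δ : ℝ) :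
    Measurable (fun p : PhaseSpace d × (EuclideanSpace ℝ (Fin d) × EuclideanSpace ℝ (Fin d)) =>
      obaboStep U γ δ p.1 p.2) := by
  have h1 : Measurable (fun z : PhaseSpace d => z.fst) :=
    measurable_fst.comp (WithLp.measurable_ofLp 2 _)
  have h2 : Measurable (fun z : PhaseSpace d => z.snd) :=
    measurable_snd.comp (WithLp.measurable_ofLp 2 _)
  unfold obaboStep
  refine (WithLp.measurable_toLp 2 _).comp (Measurable.prodMk ?_ ?_) <;> fun_prop

theorem obaboKernel_apply {d : ℕ} {U : EuclideanSpace ℝ (Fin d) → ℝ}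
    (hU : Measurable (gradient U)) (γ δ : ℝ) (z : PhaseSpace d) :
    obaboKernel U γ δ z =
      ((stdGaussian (EuclideanSpace ℝ (Fin d))).prod
        (stdGaussian (EuclideanSpace ℝ (Fin d)))).map (obaboStep U γ δ z) := by
  have h := measurable_obaboStep hU γ δ
  rw [obaboKernel, Kernel.map_apply _ h, Kernel.prod_apply, Kernel.id_apply, Kernel.const_apply,
    Measure.dirac_prod, Measure.map_map h (by fun_prop)]
  rfl

/-- `Z` is a time-homogeneous Markov chain with transition kernel `κ` and initial law `μ₀`, on the
probability space `(Ω, Pr)`: conditionally on `Z 0, …, Z k`, the law of `Z (k + 1)` is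
`κ (Z k)`. -/
structure IsMarkovChain {S Ω : Type*} [MeasurableSpace S] [MeasurableSpace Ω]
    (κ : Kernel S S) (μ₀ : Measure S) (Pr : Measure Ω) (Z : ℕ → Ω → S) : Prop where
  measurable : ∀ k, Measurable (Z k)
  initial : Pr.map (Z 0) = μ₀
  transition : ∀ (k : ℕ) (B : Set S), MeasurableSet B →
    Pr[(Z (k + 1) ⁻¹' B).indicator (fun _ => (1 : ℝ)) |
        ⨆ j ≤ k, MeasurableSpace.comap (Z j) inferInstance]
      =ᵐ[Pr] fun ω => (κ (Z k ω)).real B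

/-- The Wasserstein distance `𝓦₁`: the infimum over the couplings of `μ` and `ν` of the
transport cost `∫ dist x y`. -/
def wasserstein1 {E : Type*} [PseudoEMetricSpace E] [MeasurableSpace E] (μ ν : Measure E) :
    ℝ≥0∞ :=
  ⨅ ξ ∈ {ξ : Measure (E × E) | ξ.map Prod.fst = μ ∧ ξ.map Prod.snd = ν},
    ∫⁻ p, edist p.1 p.2 ∂ξ

/-- The length `|∇ f| (x)` of the gradient of a Lipschitz function at every point, as the local
Lipschitz constant `limsup_{y → x} |f y - f x| / |y - x|`. It is the norm of the derivative
wherever `f` is differentiable, see `gradLength_eq_norm_fderiv`; unlike the derivative it makes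
sense at every point, hence for measures that are singular. -/
def gradLength {E : Type*} [PseudoMetricSpace E] (f : E → ℝ) (x : E) : ℝ :=
  limsup (fun y => |f y - f x| / dist y x) (𝓝[≠] x)

/-- `ν` satisfies a log-Sobolev inequality with constant `C`. -/
def LogSobolev {E : Type*} [PseudoMetricSpace E] [MeasurableSpace E] (ν : Measure E) (C : ℝ) :
    Prop :=
  ∀ φ : E → ℝ, (∃ K : ℝ≥0, LipschitzWith K φ) → (∃ B : ℝ, ∀ z, |φ z| ≤ B) →
    ∫ z, φ z ^ 2 * Real.log (φ z ^ 2) ∂ν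
        - (∫ z, φ z ^ 2 ∂ν) * Real.log (∫ z, φ z ^ 2 ∂ν)
      ≤ C * ∫ z, gradLength φ z ^ 2 ∂ν

theorem gradLength_eq_norm_fderiv {E : Type*} [NormedAddCommGroup E] [NormedSpace ℝ E]
    {f : E → ℝ} {x : E} (hf : DifferentiableAt ℝ f x) :
    gradLength f x = ‖fderiv ℝ f x‖ := by
  set A := fderiv ℝ f x with hA
  have hup : ∀ ε > 0, ∀ᶠ y in 𝓝[≠] x, |f y - f x| / dist y x ≤ ‖A‖ + ε := by
    intro ε hε
    have h := (hf.hasFDerivAt.isLittleO).def hε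
    filter_upwards [nhdsWithin_le_nhds h, self_mem_nhdsWithin] with y hy hne
    have hpos : 0 < ‖y - x‖ := norm_pos_iff.2 (sub_ne_zero.2 hne)
    rw [dist_eq_norm, div_le_iff₀ hpos, ← Real.norm_eq_abs]
    calc ‖f y - f x‖ ≤ ‖f y - f x - A (y - x)‖ + ‖A (y - x)‖ := norm_le_norm_sub_add _ _
      _ ≤ ε * ‖y - x‖ + ‖A‖ * ‖y - x‖ := add_le_add hy (A.le_opNorm _)
      _ = (‖A‖ + ε) * ‖y - x‖ := by ring
  rcases subsingleton_or_nontrivial E with hE | hE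
  · have h0 : ‖A‖ = 0 := by
      rw [Subsingleton.elim A 0, norm_zero]
    have hb : 𝓝[≠] x = ⊥ := by
      have : ({x}ᶜ : Set E) = ∅ := by
        ext y; simp [Subsingleton.elim y x]
      rw [this, nhdsWithin_empty]
    rw [h0, gradLength, hb, limsup_eq]
    simp
  have hne : (𝓝[≠] x).NeBot := Module.punctured_nhds_neBot ℝ E x
  have hbdd : IsBoundedUnder (· ≤ ·) (𝓝[≠] x) (fun y => |f y - f x| / dist y x) :=
    ⟨‖A‖ + 1, by simpa using hup 1 one_pos⟩
  have hnn : ∀ y, 0 ≤ |f y - f x| / dist y x := fun y => by positivity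
  have hcob : IsCoboundedUnder (· ≤ ·) (𝓝[≠] x) (fun y => |f y - f x| / dist y x) :=
    isCoboundedUnder_le_of_le _ (x := 0) hnn
  have hlim0 : 0 ≤ gradLength f x :=
    le_limsup_of_frequently_le (Eventually.of_forall hnn).frequently hbdd
  refine le_antisymm ?_ ?_
  · refine le_of_forall_pos_le_add fun ε hε => ?_
    exact limsup_le_of_le hcob (hup ε hε)
  · refine A.opNorm_le_bound hlim0 fun v => ?_
    rcases eq_or_ne v 0 with rfl | hv
    · simp
    have hv' : 0 < ‖v‖ := norm_pos_iff.2 hv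
    rw [← div_le_iff₀ hv']
    have hline : HasDerivAt (fun t : ℝ => f (x + t • v)) (A v) 0 :=
      hf.hasFDerivAt.hasLineDerivAt v
    have hten := (hasDerivAt_iff_tendsto_slope.1 hline).norm.div_const ‖v‖
    have hmap : Tendsto (fun t : ℝ => x + t • v) (𝓝[≠] 0) (𝓝[≠] x) := by
      refine tendsto_nhdsWithin_iff.2 ⟨?_, ?_⟩
      · have : Continuous (fun t : ℝ => x + t • v) := by fun_prop
        have h := (this.tendsto 0).mono_left (nhdsWithin_le_nhds (s := {0}ᶜ))
        simpa using h
      · filter_upwards [self_mem_nhdsWithin] with t ht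
        have ht' : t ≠ 0 := ht
        simp [ht', hv]
    refine le_of_forall_pos_le_add fun ε hε => ?_
    have h1 : ∀ᶠ y in 𝓝[≠] x, |f y - f x| / dist y x < gradLength f x + ε :=
      eventually_lt_of_limsup_lt (lt_add_of_pos_right _ hε) hbdd
    refine le_of_tendsto hten ?_
    filter_upwards [hmap.eventually h1, self_mem_nhdsWithin] with t ht ht0
    have ht' : t ≠ 0 := ht0
    refine le_trans (le_of_eq ?_) ht.le
    simp only [slope_def_field, sub_zero, zero_smul, add_zero, dist_eq_norm, add_sub_cancel_left,
      norm_smul, Real.norm_eq_abs, abs_div, div_div]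

end

/-!
The theorem rests on one geometric fact: two OBABO chains driven by the same Gaussian noises approach
each other at every step, not for the Euclidean norm of the phase space, but for the norm whose
square is `L ‖x‖ ^ 2 + 2 (L / γ) ⟪x, v⟫ + ‖v‖ ^ 2` (`obaboNormSq`). One step multiplies this square
by at most `ρ ^ 2 = 1 - m δ / (2 γ)` (`obaboNormSq_obaboStep_sub_le`). In units where the friction is
`1` this is a quadratic inequality between the differences of positions, velocities and forces; it
uses strong convexity and the cocoercivity of `∇ U` (`norm_sq_gradient_sub_le_mul_inner`). The
modified norm is Euclidean, so a linear change of variables turns it into the usual norm, with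
Lipschitz constants whose product is `K₁`. In the new variables the OBABO kernel is contractive
(`isContractiveKernel_obabo`): a random map that is a `ρ`-contraction for each value of the noise,
with transition laws that are Lipschitz images of a Gaussian measure, and hence satisfy a
log-Sobolev inequality with constant `C = 9 δ γ / 2`.

The Gaussian log-Sobolev inequality (`logSobolev_stdGaussian`) comes from a discrete
Ornstein–Uhlenbeck chain: in a step `x ↦ ρ x + σ y` the entropy decreases by at most `σ ^ 2 / 2` times
the Fisher information, up to an error `O(σ ^ 3)`, and the Fisher information contracts by `ρ ^ 2`.
Summing a geometric series and letting `σ → 0` proves it for smooth positive functions;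
mollification and Rademacher's theorem extend it to Lipschitz functions.

The same telescoping gives the log-Sobolev inequality for the invariant measure of any contractive
kernel. With `P` the Markov operator, the slopes satisfy `|∇ √(P (f ^ 2))| ^ 2 ≤ ρ ^ 2 P |∇ f| ^ 2`
(`gradLength_sqOp_le`), each step loses at most `C ∫ |∇ f| ^ 2` of entropy, and the sum is
`C / (1 - ρ ^ 2)` times `∫ |∇ f| ^ 2` (`logSobolev_of_invariant`). Existence of the invariant measure
is a compactness argument (`exists_invariant`), uniqueness follows from the contraction
(`invariant_unique`).

Concentration is Herbst's argument along the chain (`lintegral_exp_sum_le`). Conditionally on the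
past, the last step is integrated by Herbst's bound for the transition law, which replaces a
function of the last state by its image under `P`, whose Lipschitz constant has contracted by `ρ`;
the accumulated Lipschitz constants stay below `‖φ‖_Lip / (1 - ρ)`. At time `0` one is left with
Herbst's bound for `μ₀` and with a difference of means under `μ₀` and the invariant measure, bounded
by `𝓦₁` (`integral_sub_le_wasserstein1`). Chernoff's bound concludes
(`measure_ge_abs_average_le`).
-/

/-! ### The length of the gradient of a Lipschitz function -/

section GradLength

variable {E F : Type*} [PseudoMetricSpace E] [PseudoMetricSpace F]

theorem gradLength_le_of_eventually {f : E → ℝ} {x : E} {c : ℝ} (hc : 0 ≤ c)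
    (h : ∀ᶠ y in 𝓝[≠] x, |f y - f x| ≤ c * dist y x) : gradLength f x ≤ c := by
  rcases eq_or_neBot (𝓝[≠] x) with hb | hb
  · rw [gradLength, hb, limsup_eq]
    simpa using hc
  · refine limsup_le_of_le (isCoboundedUnder_le_of_le _ (x := 0) fun y => by positivity) ?_
    filter_upwards [h] with y hy
    exact div_le_of_le_mul₀ dist_nonneg hc hy

theorem isBoundedUnder_slope {f : E → ℝ} {K : ℝ≥0} (hf : LipschitzWith K f) (x : E) :
    IsBoundedUnder (· ≤ ·) (𝓝[≠] x) (fun y => |f y - f x| / dist y x) :=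
  ⟨K, by
    rw [eventually_map]
    refine Eventually.of_forall fun y => div_le_of_le_mul₀ dist_nonneg K.2 ?_
    simpa [Real.dist_eq] using hf.dist_le_mul y x⟩

theorem gradLength_nonneg {f : E → ℝ} {K : ℝ≥0} (hf : LipschitzWith K f) (x : E) :
    0 ≤ gradLength f x := by
  rcases eq_or_neBot (𝓝[≠] x) with hb | hb
  · rw [gradLength, hb, limsup_eq]
    simp
  · exact le_limsup_of_frequently_le
      (Eventually.of_forall fun y => by positivity).frequently (isBoundedUnder_slope hf x)

theorem gradLength_le {f : E → ℝ} {K : ℝ≥0} (hf : LipschitzWith K f) (x : E) :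
    gradLength f x ≤ K :=
  gradLength_le_of_eventually K.2 <| Eventually.of_forall fun y => by
    simpa [Real.dist_eq] using hf.dist_le_mul y x

/-- The local Lipschitz estimate that characterises `gradLength` for a Lipschitz function. -/
theorem eventually_abs_sub_le_gradLength {f : E → ℝ} {K : ℝ≥0} (hf : LipschitzWith K f) (x : E)
    {ε : ℝ} (hε : 0 < ε) :
    ∀ᶠ y in 𝓝 x, |f y - f x| ≤ (gradLength f x + ε) * dist y x := by
  have h1 : ∀ᶠ y in 𝓝[≠] x, |f y - f x| / dist y x < gradLength f x + ε :=
    eventually_lt_of_limsup_lt (lt_add_of_pos_right _ hε) (isBoundedUnder_slope hf x)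
  rw [eventually_nhdsWithin_iff] at h1
  filter_upwards [h1] with y hy
  have h2 := hf.dist_le_mul y x
  rw [Real.dist_eq] at h2
  rcases (dist_nonneg (x := y) (y := x)).eq_or_lt with h0 | h0
  · rw [← h0] at h2 ⊢
    simpa using h2
  · have hne : y ∈ ({x}ᶜ : Set E) := fun h => by
      rw [Set.mem_singleton_iff.1 h, dist_self] at h0
      exact h0.false
    exact ((div_lt_iff₀ h0).1 (hy hne)).le

theorem gradLength_comp_le {f : E → ℝ} {K : ℝ≥0} (hf : LipschitzWith K f) {T : F → E} {ℓ : ℝ≥0}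
    (hT : LipschitzWith ℓ T) (x : F) :
    gradLength (f ∘ T) x ≤ ℓ * gradLength f (T x) := by
  refine le_of_forall_pos_le_add fun ε hε => ?_
  have hg := gradLength_nonneg hf (T x)
  have hε' : 0 < ε / (ℓ + 1) := by positivity
  have hle : ℓ * (gradLength f (T x) + ε / (ℓ + 1)) ≤ ℓ * gradLength f (T x) + ε := by
    have : (ℓ : ℝ) * (ε / (ℓ + 1)) ≤ ε := by
      rw [mul_div_assoc', div_le_iff₀ (by positivity)]
      nlinarith [ℓ.2]
    linarith
  refine le_trans (gradLength_le_of_eventually (by positivity) ?_) hle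
  refine nhdsWithin_le_nhds ?_
  have := (hT.continuous.tendsto x).eventually (eventually_abs_sub_le_gradLength hf (T x) hε')
  filter_upwards [this] with y hy
  calc |f (T y) - f (T x)| ≤ (gradLength f (T x) + ε / (ℓ + 1)) * dist (T y) (T x) := hy
    _ ≤ (gradLength f (T x) + ε / (ℓ + 1)) * (ℓ * dist y x) := by
        gcongr
        exact hT.dist_le_mul y x
    _ = _ := by ring

/-- The sublevel sets of `gradLength f` are countable unions of closed sets. -/
theorem measurable_gradLength [MeasurableSpace E] [OpensMeasurableSpace E] {f : E → ℝ} {K : ℝ≥0}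
    (hf : LipschitzWith K f) : Measurable (gradLength f) := by
  refine measurable_of_Iio fun c => ?_
  have hset : gradLength f ⁻¹' Set.Iio c = ⋃ q ∈ {q : ℚ | 0 ≤ q ∧ (q : ℝ) < c}, ⋃ n : ℕ,
      {x | ∀ y, dist y x < 1 / ((n : ℝ) + 1) → |f y - f x| ≤ q * dist y x} := by
    ext x
    simp only [Set.mem_preimage, Set.mem_Iio, Set.mem_ofPred_eq, Set.mem_iUnion, exists_prop]
    constructor
    · intro h
      obtain ⟨q, hq1, hq2⟩ := exists_rat_btwn h
      have hq0 : (0 : ℝ) ≤ q := (gradLength_nonneg hf x).trans hq1.le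
      have := eventually_abs_sub_le_gradLength hf x (sub_pos.2 hq1)
      obtain ⟨ε, hε, hball⟩ := Metric.eventually_nhds_iff.1 this
      obtain ⟨n, hn⟩ := exists_nat_one_div_lt hε
      refine ⟨q, ⟨by exact_mod_cast hq0, hq2⟩, n, fun y hy => ?_⟩
      simpa using hball (hy.trans hn)
    · rintro ⟨q, ⟨hq0, hq⟩, n, h⟩
      refine lt_of_le_of_lt (gradLength_le_of_eventually (by exact_mod_cast hq0) ?_) hq
      refine nhdsWithin_le_nhds (Metric.eventually_nhds_iff.2 ⟨1 / ((n : ℝ) + 1), by positivity, ?_⟩)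
      exact fun y hy => h y hy
  rw [hset]
  refine MeasurableSet.biUnion (Set.to_countable _) fun q _ => MeasurableSet.iUnion fun n => ?_
  rw [← MeasurableSet.compl_iff]
  refine IsOpen.measurableSet ?_
  have : {x | ∀ y, dist y x < 1 / ((n : ℝ) + 1) → |f y - f x| ≤ q * dist y x}ᶜ
      = ⋃ y, ({x | dist y x < 1 / ((n : ℝ) + 1)} ∩ {x | q * dist y x < |f y - f x|}) := by
    ext x; simp
  rw [this]
  have hc := hf.continuous
  exact isOpen_iUnion fun y => (isOpen_lt (by fun_prop) (by fun_prop)).inter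
    (isOpen_lt (by fun_prop) (by fun_prop))

theorem integrable_gradLength_sq [MeasurableSpace E] [OpensMeasurableSpace E] {f : E → ℝ} {K : ℝ≥0}
    (hf : LipschitzWith K f) (ν : Measure E) [IsFiniteMeasure ν] :
    Integrable (fun x => gradLength f x ^ 2) ν :=
  Integrable.of_bound ((measurable_gradLength hf).pow_const 2).aestronglyMeasurable ((K : ℝ) ^ 2)
    (Eventually.of_forall fun x => by
      rw [Real.norm_of_nonneg (sq_nonneg _)]
      exact pow_le_pow_left₀ (gradLength_nonneg hf x) (gradLength_le hf x) 2)

end GradLength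

/-! ### Log-Sobolev inequalities under Lipschitz maps -/

section LogSobolevBasics

variable {E F : Type*} [PseudoMetricSpace E] [MeasurableSpace E] [PseudoMetricSpace F]
  [MeasurableSpace F]

theorem LogSobolev.mono {ν : Measure E} {C C' : ℝ} (h : LogSobolev ν C) (hC : C ≤ C') :
    LogSobolev ν C' := fun φ hφ hB =>
  (h φ hφ hB).trans (mul_le_mul_of_nonneg_right hC (integral_nonneg fun _ => sq_nonneg _))

/-- The gradient of `φ ∘ T` is at most `ℓ` times that of `φ`, whence the factor `ℓ ^ 2`. -/
theorem LogSobolev.map [BorelSpace E] [BorelSpace F] {ν : Measure E} [IsFiniteMeasure ν] {C : ℝ} (h : LogSobolev ν C)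
    (hC : 0 ≤ C) {T : E → F} {ℓ : ℝ≥0} (hT : LipschitzWith ℓ T) :
    LogSobolev (ν.map T) (C * ℓ ^ 2) := by
  rintro φ ⟨K, hK⟩ ⟨B, hB⟩
  have hTm : AEMeasurable T ν := hT.continuous.measurable.aemeasurable
  have hm := measurable_gradLength hK
  have hφ : Measurable φ := hK.continuous.measurable
  have hlog : Measurable fun z => φ z ^ 2 * Real.log (φ z ^ 2) := by fun_prop
  rw [integral_map hTm hlog.aestronglyMeasurable,
    integral_map hTm (hφ.pow_const 2).aestronglyMeasurable,
    integral_map hTm (hm.pow_const 2).aestronglyMeasurable]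
  refine (h (φ ∘ T) ⟨_, hK.comp hT⟩ ⟨B, fun z => hB _⟩).trans ?_
  rw [mul_assoc, ← integral_const_mul ((ℓ : ℝ) ^ 2)]
  refine mul_le_mul_of_nonneg_left (integral_mono (integrable_gradLength_sq (hK.comp hT) ν) ?_ ?_) hC
  · have := ((integrable_gradLength_sq hK (ν.map T)).comp_aemeasurable hTm).const_mul ((ℓ : ℝ) ^ 2)
    exact this
  · intro x
    simp only
    rw [← mul_pow]
    exact pow_le_pow_left₀ (gradLength_nonneg (hK.comp hT) x) (gradLength_comp_le hK hT x) 2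

end LogSobolevBasics

/-! ### Herbst's argument -/

section Herbst

theorem abs_exp_sub_exp_le (a b : ℝ) :
    |Real.exp a - Real.exp b| ≤ max (Real.exp a) (Real.exp b) * |a - b| := by
  wlog hab : b ≤ a generalizing a b
  · rw [abs_sub_comm, abs_sub_comm a, max_comm]
    exact this b a (le_of_not_ge hab)
  rw [abs_of_nonneg (sub_nonneg.2 (Real.exp_le_exp.2 hab)), abs_of_nonneg (sub_nonneg.2 hab),
    max_eq_left (Real.exp_le_exp.2 hab)]
  have h1 : Real.exp b = Real.exp a * Real.exp (b - a) := by rw [← Real.exp_add]; ring_nf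
  have h2 := Real.add_one_le_exp (b - a)
  nlinarith [Real.exp_pos a]

variable {E : Type*} [PseudoMetricSpace E]

theorem lipschitzWith_exp_comp {φ : E → ℝ} {ℓ : ℝ≥0} (hφ : LipschitzWith ℓ φ) {B : ℝ}
    (hB : ∀ z, |φ z| ≤ B) : LipschitzWith (Real.toNNReal (Real.exp B) * ℓ) (fun z => Real.exp (φ z)) := by
  refine LipschitzWith.of_dist_le_mul fun x y => ?_
  rw [Real.dist_eq, NNReal.coe_mul, Real.coe_toNNReal _ (Real.exp_pos B).le, mul_assoc]
  refine (abs_exp_sub_exp_le _ _).trans ?_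
  have h := hφ.dist_le_mul x y
  rw [Real.dist_eq] at h
  gcongr
  exact max_le (Real.exp_le_exp.2 ((le_abs_self _).trans (hB x)))
    (Real.exp_le_exp.2 ((le_abs_self _).trans (hB y)))

theorem gradLength_exp_le {φ : E → ℝ} {ℓ : ℝ≥0} (hφ : LipschitzWith ℓ φ) (x : E) :
    gradLength (fun z => Real.exp (φ z)) x ≤ ℓ * Real.exp (φ x) := by
  have hcont : Continuous fun y => ℓ * max (Real.exp (φ y)) (Real.exp (φ x)) := by
    have := hφ.continuous
    fun_prop
  refine le_of_forall_pos_le_add fun ε hε => ?_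
  refine gradLength_le_of_eventually (by positivity) (nhdsWithin_le_nhds ?_)
  have h1 : ∀ᶠ y in 𝓝 x, ℓ * max (Real.exp (φ y)) (Real.exp (φ x)) < ℓ * Real.exp (φ x) + ε := by
    refine (hcont.tendsto x).eventually_lt_const ?_
    simpa using hε
  filter_upwards [h1] with y hy
  have h := hφ.dist_le_mul y x
  rw [Real.dist_eq] at h
  calc |Real.exp (φ y) - Real.exp (φ x)| ≤ max (Real.exp (φ y)) (Real.exp (φ x)) * |φ y - φ x| :=
        abs_exp_sub_exp_le _ _
    _ ≤ max (Real.exp (φ y)) (Real.exp (φ x)) * (ℓ * dist y x) := by gcongr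
    _ = (ℓ * max (Real.exp (φ y)) (Real.exp (φ x))) * dist y x := by ring
    _ ≤ _ := by gcongr

variable [MeasurableSpace E] [BorelSpace E]

/-- Herbst's argument for bounded functions: along `t ↦ t⁻¹ log ∫ exp (t φ)` the log-Sobolev
inequality, applied to `exp (t φ / 2)`, is a differential inequality. -/
theorem LogSobolev.integral_exp_le_of_bounded {ν : Measure E} [IsProbabilityMeasure ν] {C : ℝ}
    (hC : 0 ≤ C) (h : LogSobolev ν C) {φ : E → ℝ} {ℓ : ℝ≥0} (hφ : LipschitzWith ℓ φ) {B : ℝ}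
    (hB : ∀ z, |φ z| ≤ B) :
    ∫ z, Real.exp (φ z) ∂ν ≤ Real.exp (∫ z, φ z ∂ν + C * ℓ ^ 2 / 4) := by
  have hm : Measurable φ := hφ.continuous.measurable
  have hset : integrableExpSet φ ν = Set.univ := by
    refine Set.eq_univ_of_forall fun t => ?_
    refine Integrable.of_bound (by fun_prop) (Real.exp (|t| * B)) (Eventually.of_forall fun z => ?_)
    rw [Real.norm_of_nonneg (Real.exp_pos _).le]
    refine Real.exp_le_exp.2 ((le_abs_self _).trans ?_)
    rw [abs_mul]
    gcongr
    exact hB z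
  have hint : ∀ t, t ∈ interior (integrableExpSet φ ν) := by simp [hset]
  have hexpi : ∀ t, Integrable (fun z => Real.exp (t * φ z)) ν := fun t => by
    have : t ∈ integrableExpSet φ ν := by simp [hset]
    exact this
  have hMpos : ∀ t, 0 < mgf φ ν t := fun t => mgf_pos (hexpi t)
  have hderiv : ∀ t, HasDerivAt (fun s => Real.log (mgf φ ν s))
      ((∫ z, φ z * Real.exp (t * φ z) ∂ν) / mgf φ ν t) t := fun t =>
    (hasDerivAt_mgf (hint t)).log (hMpos t).ne'
  have hkey : ∀ t : ℝ, 0 < t → t * (∫ z, φ z * Real.exp (t * φ z) ∂ν)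
      - mgf φ ν t * Real.log (mgf φ ν t) ≤ C * (t ^ 2 * ℓ ^ 2 / 4) * mgf φ ν t := by
    intro t ht
    have hlip : LipschitzWith (Real.toNNReal (t / 2) * ℓ) (fun z => t / 2 * φ z) := by
      refine LipschitzWith.of_dist_le_mul fun x y => ?_
      have := hφ.dist_le_mul x y
      rw [Real.dist_eq] at this ⊢
      rw [← mul_sub, abs_mul, NNReal.coe_mul, Real.coe_toNNReal _ (by positivity),
        abs_of_pos (by positivity : 0 < t / 2), mul_assoc]
      gcongr
    have hb : ∀ z, |t / 2 * φ z| ≤ t / 2 * B := fun z => by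
      rw [abs_mul, abs_of_pos (by positivity : 0 < t / 2)]
      have := hB z
      gcongr
    have hlip2 := lipschitzWith_exp_comp hlip hb
    have hLS := h _ ⟨_, hlip2⟩ ⟨Real.exp (t / 2 * B), fun z => by
      rw [abs_of_pos (Real.exp_pos _)]
      exact Real.exp_le_exp.2 ((le_abs_self _).trans (hb z))⟩
    have hsq : ∀ z, Real.exp (t / 2 * φ z) ^ 2 = Real.exp (t * φ z) := fun z => by
      rw [← Real.exp_nat_mul]; push_cast; ring_nf
    simp only [hsq, Real.log_exp] at hLS
    have e1 : ∫ z, Real.exp (t * φ z) * (t * φ z) ∂ν = t * ∫ z, φ z * Real.exp (t * φ z) ∂ν := by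
      rw [← integral_const_mul]
      exact integral_congr_ae (Eventually.of_forall fun z => by simp only; ring)
    have e2 : ∫ z, Real.exp (t * φ z) ∂ν = mgf φ ν t := rfl
    rw [e1, e2] at hLS
    refine hLS.trans ?_
    rw [mul_assoc]
    refine mul_le_mul_of_nonneg_left ?_ hC
    rw [← e2, ← integral_const_mul]
    refine integral_mono (integrable_gradLength_sq hlip2 ν) ((hexpi t).const_mul _) fun z => ?_
    simp only
    have := gradLength_exp_le hlip z
    calc gradLength (fun z => Real.exp (t / 2 * φ z)) z ^ 2
        ≤ ((Real.toNNReal (t / 2) * ℓ : ℝ≥0) * Real.exp (t / 2 * φ z)) ^ 2 :=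
          pow_le_pow_left₀ (gradLength_nonneg hlip2 z) this 2
      _ = t ^ 2 * ℓ ^ 2 / 4 * Real.exp (t * φ z) := by
          rw [mul_pow, hsq, NNReal.coe_mul, Real.coe_toNNReal _ (by positivity)]
          ring
  set G : ℝ → ℝ := fun t => Real.log (mgf φ ν t) / t - C * ℓ ^ 2 / 4 * t with hG
  have hGd : ∀ t : ℝ, 0 < t → HasDerivAt G
      (((∫ z, φ z * Real.exp (t * φ z) ∂ν) / mgf φ ν t * t - Real.log (mgf φ ν t) * 1) / t ^ 2
        - C * ℓ ^ 2 / 4 * 1) t := fun t ht =>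
    ((hderiv t).div (hasDerivAt_id t) ht.ne').sub ((hasDerivAt_id t).const_mul _)
  have hanti : AntitoneOn G (Set.Ioi 0) := by
    refine antitoneOn_of_deriv_nonpos (convex_Ioi 0)
      (fun t ht => (hGd t ht).continuousAt.continuousWithinAt) ?_ ?_
    · rw [interior_Ioi]
      exact fun t ht => (hGd t ht).differentiableAt.differentiableWithinAt
    · rw [interior_Ioi]
      intro t ht
      have ht' : 0 < t := ht
      rw [(hGd t ht).deriv, sub_nonpos, mul_one, mul_one, div_le_iff₀ (by positivity),
        sub_le_iff_le_add, div_mul_eq_mul_div, div_le_iff₀ (hMpos t)]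
      nlinarith [hkey t ht]
  have hlim : Tendsto G (𝓝[>] 0) (𝓝 (∫ z, φ z ∂ν)) := by
    have h0 := hasDerivAt_iff_tendsto_slope_zero.1 (hderiv 0)
    have h1 : Tendsto (fun t : ℝ => t⁻¹ • (Real.log (mgf φ ν (0 + t)) - Real.log (mgf φ ν 0)))
        (𝓝[>] 0) (𝓝 (∫ z, φ z ∂ν)) := by
      refine (h0.mono_left (nhdsWithin_mono 0 fun t ht => (Set.mem_Ioi.1 ht).ne')).trans ?_
      simp
    have h2 : Tendsto (fun t : ℝ => C * ℓ ^ 2 / 4 * t) (𝓝[>] 0) (𝓝 0) := by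
      have : Continuous fun t : ℝ => C * ℓ ^ 2 / 4 * t := by fun_prop
      simpa using (this.tendsto 0).mono_left nhdsWithin_le_nhds
    have h3 := h1.sub h2
    rw [sub_zero] at h3
    refine h3.congr' (Eventually.of_forall fun t => ?_)
    simp [hG, div_eq_inv_mul]
  have hfin : G 1 ≤ ∫ z, φ z ∂ν := by
    refine ge_of_tendsto hlim ?_
    filter_upwards [Ioo_mem_nhdsGT (one_pos : (0 : ℝ) < 1)] with t ht
    exact hanti ht.1 (Set.mem_Ioi.2 one_pos) ht.2.le
  simp only [hG, div_one, mul_one] at hfin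
  have : mgf φ ν 1 = ∫ z, Real.exp (φ z) ∂ν := by simp [mgf]
  rw [← this, ← Real.log_le_iff_le_exp (hMpos 1)]
  linarith

/-- Fatou's lemma, as a way to pass integrability and a bound of the integral to a pointwise limit. -/
theorem integrable_and_integral_le_of_tendsto {α : Type*} [MeasurableSpace α] {ν : Measure α}
    {f : ℕ → α → ℝ} {g : α → ℝ} {b : ℕ → ℝ} {b₀ : ℝ} (hf : ∀ n, Integrable (f n) ν)
    (hf0 : ∀ n x, 0 ≤ f n x) (hg : ∀ x, Tendsto (fun n => f n x) atTop (𝓝 (g x)))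
    (hgm : Measurable g) (hb : ∀ n, ∫ x, f n x ∂ν ≤ b n) (hlim : Tendsto b atTop (𝓝 b₀)) :
    Integrable g ν ∧ ∫ x, g x ∂ν ≤ b₀ := by
  have hg0 : ∀ x, 0 ≤ g x := fun x => ge_of_tendsto' (hg x) fun n => hf0 n x
  have h1 : ∫⁻ x, ENNReal.ofReal (g x) ∂ν ≤ ENNReal.ofReal b₀ := by
    calc ∫⁻ x, ENNReal.ofReal (g x) ∂ν
        = ∫⁻ x, liminf (fun n => ENNReal.ofReal (f n x)) atTop ∂ν := by
          refine lintegral_congr fun x => ?_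
          exact ((ENNReal.continuous_ofReal.tendsto _).comp (hg x)).liminf_eq.symm
      _ ≤ liminf (fun n => ∫⁻ x, ENNReal.ofReal (f n x) ∂ν) atTop :=
          lintegral_liminf_le' fun n => (hf n).1.aemeasurable.ennreal_ofReal
      _ ≤ liminf (fun n => ENNReal.ofReal (b n)) atTop := by
          refine liminf_le_liminf (Eventually.of_forall fun n => ?_)
          rw [← ofReal_integral_eq_lintegral_ofReal (hf n) (Eventually.of_forall (hf0 n))]
          exact ENNReal.ofReal_le_ofReal (hb n)
      _ = ENNReal.ofReal b₀ := ((ENNReal.continuous_ofReal.tendsto _).comp hlim).liminf_eq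
  have hb0 : 0 ≤ b₀ := ge_of_tendsto' hlim fun n => (integral_nonneg (hf0 n)).trans (hb n)
  have hint : Integrable g ν := by
    refine ⟨hgm.aestronglyMeasurable, ?_⟩
    rw [hasFiniteIntegral_iff_ofReal (Eventually.of_forall hg0)]
    exact h1.trans_lt ENNReal.ofReal_lt_top
  refine ⟨hint, ?_⟩
  rw [← ofReal_integral_eq_lintegral_ofReal hint (Eventually.of_forall hg0)] at h1
  exact (ENNReal.ofReal_le_ofReal_iff hb0).1 h1

theorem tendsto_truncation (a : ℝ) : Tendsto (fun n : ℕ => max (-(n : ℝ)) (min a n)) atTop (𝓝 a) := by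
  obtain ⟨N, hN⟩ := exists_nat_ge |a|
  refine tendsto_const_nhds.congr' ?_
  filter_upwards [eventually_ge_atTop N] with n hn
  have h1 : |a| ≤ n := hN.trans (by exact_mod_cast hn)
  rw [min_eq_left ((le_abs_self a).trans h1), max_eq_right (neg_le_of_abs_le h1)]

/-- A log-Sobolev inequality forces first moments: Herbst's bound for `-min |φ| n` controls the mean
of `min |φ| n` uniformly in `n`. -/
theorem LogSobolev.integrable_of_lipschitz {ν : Measure E} [IsProbabilityMeasure ν] {C : ℝ}
    (hC : 0 ≤ C) (h : LogSobolev ν C) {φ : E → ℝ} {ℓ : ℝ≥0} (hφ : LipschitzWith ℓ φ) :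
    Integrable φ ν := by
  have hm : Measurable φ := hφ.continuous.measurable
  have habs : LipschitzWith ℓ fun z => |φ z| := by
    have := lipschitzWith_one_norm.comp hφ
    rw [one_mul] at this
    exact this
  set a : ℕ → E → ℝ := fun n z => min |φ z| n with ha
  have hlip : ∀ n, LipschitzWith ℓ (a n) := fun n => by
    simpa using habs.min_const (n : ℝ)
  have hnn : ∀ n z, 0 ≤ a n z := fun n z => le_min (abs_nonneg _) n.cast_nonneg
  have hbd : ∀ n z, |a n z| ≤ n := fun n z => by
    rw [abs_of_nonneg (hnn n z)]; exact min_le_right _ _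
  have hint : ∀ n, Integrable (a n) ν := fun n =>
    Integrable.of_bound (hlip n).continuous.measurable.aestronglyMeasurable (n : ℝ)
      (Eventually.of_forall (hbd n))
  have hei : Integrable (fun z => Real.exp (-|φ z|)) ν :=
    Integrable.of_bound (by fun_prop) 1 (Eventually.of_forall fun z => by
      rw [Real.norm_of_nonneg (Real.exp_pos _).le]
      exact Real.exp_le_one_iff.2 (by simp))
  have hpos : 0 < ∫ z, Real.exp (-|φ z|) ∂ν := integral_exp_pos hei
  -- a truncation with a large mean would make `exp (-|φ|)` small in mean
  have hbound : ∀ n, ∫ z, a n z ∂ν ≤ C * ℓ ^ 2 / 4 - Real.log (∫ z, Real.exp (-|φ z|) ∂ν) := by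
    intro n
    have h1 := h.integral_exp_le_of_bounded hC (hlip n).neg (B := n) fun z => by
      simpa using hbd n z
    have h2 : ∫ z, Real.exp (-|φ z|) ∂ν ≤ ∫ z, Real.exp ((-a n) z) ∂ν := by
      refine integral_mono hei ?_ fun z => ?_
      · refine Integrable.of_bound ?_ 1 (Eventually.of_forall fun z => ?_)
        · exact (Real.continuous_exp.comp (hlip n).neg.continuous).measurable.aestronglyMeasurable
        · rw [Real.norm_of_nonneg (Real.exp_pos _).le]
          exact Real.exp_le_one_iff.2 (by simpa using hnn n z)
      · exact Real.exp_le_exp.2 (neg_le_neg (min_le_left _ _))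
    have h3 := (Real.log_le_iff_le_exp hpos).2 (h2.trans h1)
    simp only [Pi.neg_apply, integral_neg] at h3
    linarith
  have := (integrable_and_integral_le_of_tendsto hint hnn (g := fun z => |φ z|) (fun z => ?_)
    (by fun_prop) hbound tendsto_const_nhds).1
  · exact (integrable_norm_iff hm.aestronglyMeasurable).1 this
  · obtain ⟨N, hN⟩ := exists_nat_ge |φ z|
    refine tendsto_const_nhds.congr' ?_
    filter_upwards [eventually_ge_atTop N] with n hn
    exact (min_eq_left (hN.trans (by exact_mod_cast hn))).symm

/-- Herbst's argument: under a log-Sobolev inequality Lipschitz functions have Gaussian Laplace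
transforms. -/
theorem LogSobolev.integrable_exp_and_integral_exp_le {ν : Measure E} [IsProbabilityMeasure ν]
    {C : ℝ} (hC : 0 ≤ C) (h : LogSobolev ν C) {φ : E → ℝ} {ℓ : ℝ≥0} (hφ : LipschitzWith ℓ φ) :
    Integrable (fun z => Real.exp (φ z)) ν ∧
      ∫ z, Real.exp (φ z) ∂ν ≤ Real.exp (∫ z, φ z ∂ν + C * ℓ ^ 2 / 4) := by
  have hm : Measurable φ := hφ.continuous.measurable
  set a : ℕ → E → ℝ := fun n z => max (-(n : ℝ)) (min (φ z) n) with ha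
  have hlip : ∀ n, LipschitzWith ℓ (a n) := fun n => by
    simpa using (hφ.min_const (n : ℝ)).const_max (-(n : ℝ))
  have hbd : ∀ n z, |a n z| ≤ n := fun n z =>
    abs_le.2 ⟨le_max_left _ _, max_le (by simp) (min_le_right _ _)⟩
  have hle : ∀ n z, |a n z| ≤ |φ z| := fun n z => by
    have h1 := neg_abs_le (φ z)
    have h2 := le_abs_self (φ z)
    have h3 : (0 : ℝ) ≤ n := n.cast_nonneg
    refine abs_le.2 ⟨?_, ?_⟩
    · rcases le_total (φ z) n with h | h
      · exact le_max_of_le_right (by rw [min_eq_left h]; exact h1)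
      · exact le_max_of_le_right (by rw [min_eq_right h]; linarith [abs_nonneg (φ z)])
    · exact max_le (by linarith [abs_nonneg (φ z)]) ((min_le_left _ _).trans h2)
  refine integrable_and_integral_le_of_tendsto (f := fun n z => Real.exp (a n z))
    (b := fun n => Real.exp (∫ z, a n z ∂ν + C * ℓ ^ 2 / 4)) (fun n => ?_)
    (fun n z => (Real.exp_pos _).le)
    (fun z => (Real.continuous_exp.tendsto _).comp (tendsto_truncation (φ z))) (by fun_prop)
    (fun n => h.integral_exp_le_of_bounded hC (hlip n) (hbd n)) ?_
  · refine Integrable.of_bound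
      (Real.continuous_exp.comp (hlip n).continuous).measurable.aestronglyMeasurable
      (Real.exp n) (Eventually.of_forall fun z => ?_)
    rw [Real.norm_of_nonneg (Real.exp_pos _).le]
    exact Real.exp_le_exp.2 ((le_abs_self _).trans (hbd n z))
  · refine (Real.continuous_exp.tendsto _).comp (Tendsto.add_const _ ?_)
    exact tendsto_integral_of_dominated_convergence (fun z => |φ z|)
      (fun n => (hlip n).continuous.measurable.aestronglyMeasurable)
      (h.integrable_of_lipschitz hC hφ).abs (fun n => Eventually.of_forall (hle n))
      (Eventually.of_forall fun z => tendsto_truncation (φ z))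

end Herbst

/-! ### The standard Gaussian measure -/

section StdGaussian

variable {E F : Type*} [NormedAddCommGroup E] [InnerProductSpace ℝ E] [FiniteDimensional ℝ E]
  [MeasurableSpace E] [BorelSpace E] [NormedAddCommGroup F] [InnerProductSpace ℝ F]
  [FiniteDimensional ℝ F] [MeasurableSpace F] [BorelSpace F]

theorem integrable_norm_pow_stdGaussian (k : ℕ) :
    Integrable (fun x => ‖x‖ ^ k) (stdGaussian E) := by
  have := (IsGaussian.memLp_id (stdGaussian E) k (by simp)).integrable_norm_pow'
  simpa using this

theorem integral_sq_dual_stdGaussian (L : StrongDual ℝ E) :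
    ∫ x, (L x) ^ 2 ∂(stdGaussian E) = ‖L‖ ^ 2 := by
  rw [← variance_dual_stdGaussian, variance_of_integral_eq_zero (by fun_prop)
    (integral_strongDual_stdGaussian L)]

/-- The standard Gaussian measure is invariant under the Ornstein–Uhlenbeck step. -/
theorem stdGaussian_map_ornsteinUhlenbeck {ρ σ : ℝ} (h : ρ ^ 2 + σ ^ 2 = 1) :
    ((stdGaussian E).prod (stdGaussian E)).map (fun p => ρ • p.1 + σ • p.2) = stdGaussian E := by
  have h1 : ((stdGaussian E).prod (stdGaussian E)).map (fun p => ρ • p.1 + σ • p.2)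
      = ((stdGaussian E).map (ρ • ·)) ∗ ((stdGaussian E).map (σ • ·)) := by
    rw [Measure.conv, Measure.map_prod_map _ _ (by fun_prop) (by fun_prop),
      Measure.map_map (by fun_prop) (by fun_prop)]
    rfl
  have : IsProbabilityMeasure ((stdGaussian E).map (ρ • ·)) :=
    Measure.isProbabilityMeasure_map (by fun_prop)
  have : IsProbabilityMeasure ((stdGaussian E).map (σ • ·)) :=
    Measure.isProbabilityMeasure_map (by fun_prop)
  refine h1.trans (Measure.ext_of_charFun ?_)
  ext t
  rw [charFun_conv, charFun_map_smul, charFun_map_smul, charFun_stdGaussian, charFun_stdGaussian,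
    charFun_stdGaussian, ← Complex.exp_add]
  congr 1
  have hn : ∀ a : ℝ, (‖a • t‖ : ℂ) ^ 2 = (a : ℂ) ^ 2 * (‖t‖ : ℂ) ^ 2 := fun a => by
    rw [← Complex.ofReal_pow, norm_smul, mul_pow, Real.norm_eq_abs, sq_abs]
    push_cast
    rfl
  have : (ρ : ℂ) ^ 2 + (σ : ℂ) ^ 2 = 1 := by exact_mod_cast h
  rw [hn, hn]
  linear_combination (-(‖t‖ : ℂ) ^ 2 / 2) * this

/-- A pair of independent standard Gaussian vectors is a standard Gaussian vector of the Euclidean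
product. -/
theorem stdGaussian_prod_map_toLp :
    ((stdGaussian E).prod (stdGaussian F)).map (WithLp.toLp 2) = stdGaussian (WithLp 2 (E × F)) := by
  have : IsProbabilityMeasure (((stdGaussian E).prod (stdGaussian F)).map (WithLp.toLp 2)) :=
    Measure.isProbabilityMeasure_map (by fun_prop)
  refine Measure.ext_of_charFun ?_
  ext t
  rw [charFun_prod, charFun_stdGaussian, charFun_stdGaussian, charFun_stdGaussian,
    ← Complex.exp_add]
  congr 1
  have h : ‖t‖ ^ 2 = ‖t.ofLp.1‖ ^ 2 + ‖t.ofLp.2‖ ^ 2 := WithLp.prod_norm_sq_eq_of_L2 t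
  have h' : (‖t‖ : ℂ) ^ 2 = (‖t.ofLp.1‖ : ℂ) ^ 2 + (‖t.ofLp.2‖ : ℂ) ^ 2 := by exact_mod_cast h
  rw [h']
  ring

theorem Measure.pi_fin_absolutelyContinuous (μ ν : Measure ℝ) [IsProbabilityMeasure μ]
    [SigmaFinite ν] (h : μ ≪ ν) : ∀ n : ℕ,
    (Measure.pi fun _ : Fin n => μ) ≪ (Measure.pi fun _ : Fin n => ν)
  | 0 => by
    rw [Measure.pi_of_empty, Measure.pi_of_empty]
  | n + 1 => by
    have h1 := (measurePreserving_piFinSuccAbove (fun _ : Fin (n + 1) => μ) 0).symm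
    have h2 := (measurePreserving_piFinSuccAbove (fun _ : Fin (n + 1) => ν) 0).symm
    rw [← h1.map_eq, ← h2.map_eq]
    exact (h.prod (Measure.pi_fin_absolutelyContinuous μ ν h n)).map (MeasurableEquiv.measurable _)

theorem stdGaussian_absolutelyContinuous : stdGaussian E ≪ volume := by
  have h1 := Measure.pi_fin_absolutelyContinuous (gaussianReal 0 1) volume
    (gaussianReal_absolutelyContinuous 0 one_ne_zero) (Module.finrank ℝ E)
  have h2 := h1.map (f := fun x => ∑ i, x i • stdOrthonormalBasis ℝ E i) (by fun_prop)
  refine h2.trans (le_of_eq ?_).absolutelyContinuous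
  have h3 := (stdOrthonormalBasis ℝ E).measurePreserving_measurableEquiv.symm
  have h4 := h3.comp (PiLp.volume_preserving_toLp (Fin (Module.finrank ℝ E)))
  rw [← h4.map_eq]
  congr 1
  ext x
  simp [OrthonormalBasis.measurableEquiv, ← OrthonormalBasis.sum_repr_symm]

end StdGaussian

/-! ### Scalar inequalities for the entropy -/

section EntropyScalar

/-- Second order Taylor bound of `(1 + u) log (1 + u)` at `u = 0`, with a cubic error that is uniform
on `u > -1`. -/
theorem one_add_mul_log_le {u : ℝ} (hu : 0 < 1 + u) :
    (1 + u) * Real.log (1 + u) - u ≤ u ^ 2 / 2 + |u| ^ 3 / 2 := by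
  rcases le_total 0 u with h | h
  · have h1 : Real.log (1 + u) ≤ ((1 + u) - (1 + u)⁻¹) / 2 := by
      rw [← Real.sinh_log hu]
      exact Real.self_le_sinh_iff.2 (Real.log_nonneg (by linarith))
    have h2 : (1 + u) * Real.log (1 + u) ≤ (1 + u) * (((1 + u) - (1 + u)⁻¹) / 2) := by gcongr
    have h3 : (1 + u) * (((1 + u) - (1 + u)⁻¹) / 2) = u + u ^ 2 / 2 := by
      field_simp
      ring
    have h4 : 0 ≤ |u| ^ 3 := by positivity
    linarith
  · have h1 : Real.log (1 + u) ≤ u - u ^ 2 / 2 + u ^ 3 / 3 := by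
      have hd : ∀ x ∈ Set.Ioc (-1 : ℝ) 0, HasDerivAt
          (fun x : ℝ => x - x ^ 2 / 2 + x ^ 3 / 3 - Real.log (1 + x))
          (1 - x + x ^ 2 - 1 / (1 + x)) x := fun x hx => by
        have h1 : (1 : ℝ) + x ≠ 0 := by linarith [hx.1]
        have h2 := (((hasDerivAt_id x).sub ((hasDerivAt_pow 2 x).div_const 2)).add
          ((hasDerivAt_pow 3 x).div_const 3)).sub (((hasDerivAt_id x).const_add 1).log h1)
        refine h2.congr_deriv ?_
        simp
      have hanti : AntitoneOn (fun x : ℝ => x - x ^ 2 / 2 + x ^ 3 / 3 - Real.log (1 + x))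
          (Set.Ioc (-1) 0) := by
        refine antitoneOn_of_deriv_nonpos (convex_Ioc _ _)
          (fun x hx => (hd x hx).continuousAt.continuousWithinAt)
          (fun x hx => (hd x (interior_subset hx)).differentiableAt.differentiableWithinAt)
          fun x hx => ?_
        have hx' := interior_subset hx
        rw [(hd x hx').deriv]
        have h1 : 0 < 1 + x := by linarith [hx'.1]
        rw [sub_nonpos, le_div_iff₀ h1]
        nlinarith [hx'.2, sq_nonneg x, mul_nonneg (sq_nonneg x) (neg_nonneg.2 hx'.2)]
      have := hanti ⟨by linarith, h⟩ (Set.right_mem_Ioc.2 (by norm_num)) h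
      simp at this
      linarith
    have h2 : (1 + u) * Real.log (1 + u) ≤ (1 + u) * (u - u ^ 2 / 2 + u ^ 3 / 3) := by gcongr
    rw [abs_of_nonpos h]
    nlinarith [mul_nonneg (mul_nonneg (mul_nonneg (neg_nonneg.2 h) (neg_nonneg.2 h))
      (neg_nonneg.2 h)) hu.le]

/-- The gap between `y log y` and its tangent at `b`, to second order in `y - b`. -/
theorem mul_log_sub_le {y b : ℝ} (hy : 0 < y) (hb : 0 < b) :
    y * Real.log y - (y * Real.log b + y - b) ≤ (y - b) ^ 2 / (2 * b) + |y - b| ^ 3 / (2 * b ^ 2) := by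
  have h := one_add_mul_log_le (u := (y - b) / b) (by
    have : 1 + (y - b) / b = y / b := by field_simp; ring
    rw [this]; positivity)
  have e1 : 1 + (y - b) / b = y / b := by field_simp; ring
  rw [e1, Real.log_div hy.ne' hb.ne', abs_div, abs_of_pos hb] at h
  have h2 := mul_le_mul_of_nonneg_left h hb.le
  have e2 : b * (y / b * (Real.log y - Real.log b) - (y - b) / b)
      = y * Real.log y - (y * Real.log b + y - b) := by field_simp; ring
  have e3 : b * (((y - b) / b) ^ 2 / 2 + (|y - b| / b) ^ 3 / 2)
      = (y - b) ^ 2 / (2 * b) + |y - b| ^ 3 / (2 * b ^ 2) := by field_simp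
  rwa [e2, e3] at h2

theorem mul_log_tangent_le {y b : ℝ} (hy : 0 < y) (hb : 0 < b) :
    y * Real.log b + y - b ≤ y * Real.log y := by
  have h := Real.add_one_le_exp (Real.log b - Real.log y)
  rw [Real.exp_sub, Real.exp_log hy, Real.exp_log hb, le_div_iff₀ hy] at h
  linarith

/-- The Cauchy–Schwarz inequality in the form of joint convexity of `(x, y) ↦ x ^ 2 / y`. -/
theorem sq_integral_div_le {α : Type*} [MeasurableSpace α] {ν : Measure α} {X Y : α → ℝ}
    (hX : Integrable X ν) (hY : Integrable Y ν) (hXY : Integrable (fun a => X a ^ 2 / Y a) ν)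
    (hpos : ∀ a, 0 < Y a) (hI : 0 < ∫ a, Y a ∂ν) :
    (∫ a, X a ∂ν) ^ 2 / ∫ a, Y a ∂ν ≤ ∫ a, X a ^ 2 / Y a ∂ν := by
  set t := (∫ a, X a ∂ν) / ∫ a, Y a ∂ν with ht
  have h1 : ∫ a, (2 * t * X a - t ^ 2 * Y a) ∂ν ≤ ∫ a, X a ^ 2 / Y a ∂ν := by
    refine integral_mono ((hX.const_mul _).sub (hY.const_mul _)) hXY fun a => ?_
    simp only
    rw [le_div_iff₀ (hpos a)]
    nlinarith [sq_nonneg (X a - t * Y a)]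
  rw [integral_sub (hX.const_mul _) (hY.const_mul _), integral_const_mul, integral_const_mul] at h1
  refine le_trans (le_of_eq ?_) h1
  rw [ht]
  field_simp
  ring

end EntropyScalar

/-! ### The discrete Ornstein–Uhlenbeck chain -/

section OrnsteinUhlenbeck

theorem integrable_of_continuous_bounded {E G : Type*} [NormedAddCommGroup E] [MeasurableSpace E]
    [BorelSpace E] [NormedAddCommGroup G] [SecondCountableTopology G] {ν : Measure E}
    [IsFiniteMeasure ν] {f : E → G} (hf : Continuous f) {D : ℝ} (hD : ∀ x, ‖f x‖ ≤ D) :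
    Integrable f ν :=
  Integrable.of_bound hf.aestronglyMeasurable D (Eventually.of_forall hD)

variable {E : Type*} [NormedAddCommGroup E] [InnerProductSpace ℝ E]

/-- `F` has values in `[c, B]`, and its derivative `F'` is bounded by `K` and `K`-Lipschitz. -/
structure IsSmoothBounded (F : E → ℝ) (F' : E → StrongDual ℝ E) (c B K : ℝ) : Prop where
  hasFDerivAt : ∀ x, HasFDerivAt F (F' x) x
  lower : ∀ x, c ≤ F x
  upper : ∀ x, F x ≤ B
  norm_le : ∀ x, ‖F' x‖ ≤ K
  norm_sub_le : ∀ x y, ‖F' x - F' y‖ ≤ K * ‖x - y‖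

namespace IsSmoothBounded

variable {F : E → ℝ} {F' : E → StrongDual ℝ E} {c B K : ℝ}

theorem nonneg (h : IsSmoothBounded F F' c B K) : 0 ≤ K := (norm_nonneg _).trans (h.norm_le 0)

theorem continuous (h : IsSmoothBounded F F' c B K) : Continuous F :=
  continuous_iff_continuousAt.2 fun x => (h.hasFDerivAt x).continuousAt

theorem continuous_deriv (h : IsSmoothBounded F F' c B K) : Continuous F' :=
  (LipschitzWith.of_dist_le_mul (K := K.toNNReal) fun x y => by
    rw [dist_eq_norm, dist_eq_norm, Real.coe_toNNReal _ h.nonneg]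
    exact h.norm_sub_le x y).continuous

theorem abs_sub_le (h : IsSmoothBounded F F' c B K) (x y : E) : |F y - F x| ≤ K * ‖y - x‖ :=
  Convex.norm_image_sub_le_of_norm_hasFDerivWithin_le
    (fun z _ => (h.hasFDerivAt z).hasFDerivWithinAt) (fun z _ => h.norm_le z) convex_univ
    (Set.mem_univ x) (Set.mem_univ y)

theorem taylor (h : IsSmoothBounded F F' c B K) (x v : E) :
    |F (x + v) - F x - F' x v| ≤ K * ‖v‖ ^ 2 := by
  have := Convex.norm_image_sub_le_of_norm_hasFDerivWithin_le' (f := F) (f' := F') (φ := F' x)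
    (s := Metric.closedBall x ‖v‖) (C := K * ‖v‖) (x := x) (y := x + v)
    (fun z _ => (h.hasFDerivAt z).hasFDerivWithinAt)
    (fun z hz => (h.norm_sub_le z x).trans (by
      have := mem_closedBall_iff_norm.1 hz
      have := h.nonneg
      gcongr))
    (convex_closedBall _ _) (by simp) (by simp)
  simpa [pow_two, mul_assoc] using this

theorem sq_sub_le (h : IsSmoothBounded F F' c B K) (x v : E) :
    (F (x + v) - F x) ^ 2 ≤ (F' x v) ^ 2 + K ^ 2 * (2 * ‖v‖ ^ 3 + ‖v‖ ^ 4) := by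
  have h1 := abs_le.1 (h.taylor x v)
  have h2 : |F' x v| ≤ K * ‖v‖ := ((F' x).le_opNorm v).trans (by gcongr; exact h.norm_le x)
  have h3 := abs_le.1 h2
  set r := F (x + v) - F x - F' x v with hr
  have e : F (x + v) - F x = F' x v + r := by rw [hr]; ring
  have h4 : F' x v * r ≤ K * ‖v‖ * (K * ‖v‖ ^ 2) := by
    refine (le_abs_self _).trans ?_
    rw [abs_mul]
    exact mul_le_mul h2 (h.taylor x v) (abs_nonneg _) (mul_nonneg h.nonneg (norm_nonneg _))
  have h5 : r ^ 2 ≤ (K * ‖v‖ ^ 2) ^ 2 := sq_le_sq' h1.1 h1.2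
  rw [e]
  nlinarith

/-- The Fisher information density `‖F'‖ ^ 2 / F` is Lipschitz. -/
theorem fisher_sub_le (h : IsSmoothBounded F F' c B K) (hc : 0 < c) (x y : E) :
    ‖F' x‖ ^ 2 / F x - ‖F' y‖ ^ 2 / F y ≤ (2 * K ^ 2 / c + K ^ 3 / c ^ 2) * ‖x - y‖ := by
  have hx := h.lower x
  have hy := h.lower y
  have hK := h.nonneg
  have hFx : 0 < F x := hc.trans_le hx
  have hFy : 0 < F y := hc.trans_le hy
  have e : ‖F' x‖ ^ 2 / F x - ‖F' y‖ ^ 2 / F y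
      = (‖F' x‖ - ‖F' y‖) * (‖F' x‖ + ‖F' y‖) / F x + ‖F' y‖ ^ 2 * (F y - F x) / (F x * F y) := by
    field_simp
    ring
  have h1 : (‖F' x‖ - ‖F' y‖) * (‖F' x‖ + ‖F' y‖) / F x ≤ (K * ‖x - y‖) * (K + K) / c := by
    have h0 := (norm_sub_norm_le (F' x) (F' y)).trans (h.norm_sub_le x y)
    have ha := h.norm_le x
    have hb := h.norm_le y
    gcongr
  have h2 : ‖F' y‖ ^ 2 * (F y - F x) / (F x * F y) ≤ K ^ 2 * (K * ‖x - y‖) / (c * c) := by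
    have h0 := (le_abs_self _).trans (h.abs_sub_le x y)
    rw [norm_sub_rev] at h0
    have hb := h.norm_le y
    have : ‖F' y‖ ^ 2 * (F y - F x) ≤ K ^ 2 * (K * ‖x - y‖) :=
      (mul_le_mul_of_nonneg_left h0 (sq_nonneg _)).trans (by gcongr)
    gcongr
  rw [e]
  refine (add_le_add h1 h2).trans (le_of_eq ?_)
  field_simp
  ring

theorem norm_le_max (h : IsSmoothBounded F F' c B K) (x : E) : ‖F x‖ ≤ max |c| |B| := by
  exact abs_le_max_abs_abs (h.lower x) (h.upper x)

theorem continuous_fisher (h : IsSmoothBounded F F' c B K) (hc : 0 < c) :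
    Continuous fun x => ‖F' x‖ ^ 2 / F x :=
  (h.continuous_deriv.norm.pow 2).div h.continuous fun x => (hc.trans_le (h.lower x)).ne'

theorem fisher_le (h : IsSmoothBounded F F' c B K) (hc : 0 < c) (x : E) :
    ‖‖F' x‖ ^ 2 / F x‖ ≤ K ^ 2 / c := by
  have hx := h.lower x
  have hFx : 0 < F x := hc.trans_le hx
  have := h.norm_le x
  rw [Real.norm_of_nonneg (by positivity)]
  gcongr

theorem exists_abs_mul_log_le (h : IsSmoothBounded F F' c B K) :
    ∃ D, ∀ x, ‖F x * Real.log (F x)‖ ≤ D := by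
  obtain ⟨D, hD⟩ := (isCompact_Icc (a := c) (b := B)).exists_bound_of_continuousOn
    (Real.continuous_mul_log.continuousOn)
  exact ⟨D, fun x => hD _ ⟨h.lower x, h.upper x⟩⟩

end IsSmoothBounded

variable [FiniteDimensional ℝ E] [MeasurableSpace E] [BorelSpace E]

/-- One step of the Ornstein–Uhlenbeck chain (Mehler's formula). -/
noncomputable def ouStep (ρ σ : ℝ) (F : E → ℝ) (x : E) : ℝ :=
  ∫ y, F (ρ • x + σ • y) ∂(stdGaussian E)

/-- Invariance of the standard Gaussian measure under the Ornstein–Uhlenbeck chain. -/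
theorem integral_ouStep {ρ σ : ℝ} (hρσ : ρ ^ 2 + σ ^ 2 = 1) {F : E → ℝ} (hF : Continuous F) {D : ℝ}
    (hD : ∀ x, ‖F x‖ ≤ D) :
    ∫ x, ouStep ρ σ F x ∂(stdGaussian E) = ∫ x, F x ∂(stdGaussian E) := by
  have hint : Integrable (fun p : E × E => F (ρ • p.1 + σ • p.2))
      ((stdGaussian E).prod (stdGaussian E)) :=
    Integrable.of_bound (by fun_prop) D (Eventually.of_forall fun p => hD _)
  conv_rhs => rw [← stdGaussian_map_ornsteinUhlenbeck (E := E) hρσ]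
  rw [integral_map (by fun_prop) hF.aestronglyMeasurable, integral_prod _ hint]
  rfl

namespace IsSmoothBounded

variable {F : E → ℝ} {F' : E → StrongDual ℝ E} {c B K ρ σ : ℝ}

/-- The derivative commutes with the Ornstein–Uhlenbeck step up to the factor `ρ`. -/
theorem ouStep (h : IsSmoothBounded F F' c B K) (hρ : 0 ≤ ρ) (hρ1 : ρ ≤ 1) :
    IsSmoothBounded (ouStep ρ σ F)
      (fun x => ∫ y, ρ • F' (ρ • x + σ • y) ∂(stdGaussian E)) c B (ρ * K) := by
  have hF := h.continuous
  have hF' := h.continuous_deriv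
  have hi : ∀ x, Integrable (fun y => F (ρ • x + σ • y)) (stdGaussian E) := fun x =>
    integrable_of_continuous_bounded (by fun_prop) fun y => h.norm_le_max _
  have hb : ∀ x, ‖ρ • F' x‖ ≤ ρ * K := fun x => by
    rw [norm_smul, Real.norm_of_nonneg hρ]
    exact mul_le_mul_of_nonneg_left (h.norm_le x) hρ
  have hi' : ∀ x, Integrable (fun y => ρ • F' (ρ • x + σ • y)) (stdGaussian E) := fun x =>
    integrable_of_continuous_bounded (by fun_prop) fun y => hb _
  refine ⟨fun x => ?_, fun x => ?_, fun x => ?_, fun x => ?_, fun x y => ?_⟩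
  · refine hasFDerivAt_integral_of_dominated_of_fderiv_le (s := Set.univ)
      (F' := fun x y => ρ • F' (ρ • x + σ • y)) univ_mem
      (Eventually.of_forall fun x => (hi x).1) (hi x) (hi' x).1
      (Eventually.of_forall fun y x _ => hb _) (integrable_const (ρ * K))
      (Eventually.of_forall fun y x _ => ?_)
    have h1 : HasFDerivAt (fun x : E => ρ • x + σ • y) (ρ • ContinuousLinearMap.id ℝ E) x :=
      ((hasFDerivAt_id x).const_smul ρ).add_const _
    refine ((h.hasFDerivAt _).comp x h1).congr_fderiv ?_
    ext v
    simp
  · calc c = ∫ _, c ∂(stdGaussian E) := by simp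
      _ ≤ _ := integral_mono (integrable_const _) (hi x) fun y => h.lower _
  · calc _ ≤ ∫ _, B ∂(stdGaussian E) := integral_mono (hi x) (integrable_const _) fun y => h.upper _
      _ = B := by simp
  · refine (norm_integral_le_of_norm_le_const (Eventually.of_forall fun y => hb _)).trans ?_
    simp
  · rw [← integral_sub (hi' x) (hi' y)]
    refine (norm_integral_le_of_norm_le_const (C := ρ * K * ‖x - y‖)
      (Eventually.of_forall fun z => ?_)).trans (by simp)
    have e : ρ • F' (ρ • x + σ • z) - ρ • F' (ρ • y + σ • z)
        = ρ • (F' (ρ • x + σ • z) - F' (ρ • y + σ • z)) := by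
      ext v
      simp [mul_sub]
    rw [e, norm_smul, Real.norm_of_nonneg hρ, mul_assoc]
    refine mul_le_mul_of_nonneg_left ((h.norm_sub_le _ _).trans ?_) hρ
    refine mul_le_mul_of_nonneg_left ?_ h.nonneg
    rw [add_sub_add_right_eq_sub, ← smul_sub, norm_smul, Real.norm_of_nonneg hρ]
    exact mul_le_of_le_one_left (norm_nonneg _) hρ1

/-- Pointwise contraction of the Fisher information density, from joint convexity of
`(x, y) ↦ x ^ 2 / y`. -/
theorem fisher_ouStep_le (h : IsSmoothBounded F F' c B K) (hc : 0 < c) (hρ : 0 ≤ ρ) (x : E) :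
    ‖∫ y, ρ • F' (ρ • x + σ • y) ∂(stdGaussian E)‖ ^ 2 / _root_.ouStep ρ σ F x
      ≤ ρ ^ 2 * _root_.ouStep ρ σ (fun x => ‖F' x‖ ^ 2 / F x) x := by
  have hF := h.continuous
  have hF' := h.continuous_deriv
  have hfi := h.continuous_fisher hc
  have hi : Integrable (fun y => F (ρ • x + σ • y)) (stdGaussian E) :=
    integrable_of_continuous_bounded (by fun_prop) fun y => h.norm_le_max _
  have hi' : Integrable (fun y => ‖F' (ρ • x + σ • y)‖) (stdGaussian E) :=
    integrable_of_continuous_bounded (D := K) (by fun_prop) fun y => by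
      rw [norm_norm]; exact h.norm_le _
  have hif : Integrable (fun y => ‖F' (ρ • x + σ • y)‖ ^ 2 / F (ρ • x + σ • y)) (stdGaussian E) :=
    integrable_of_continuous_bounded (hfi.comp (by fun_prop : Continuous fun y : E => ρ • x + σ • y))
      fun y => h.fisher_le hc _
  have hpos : 0 < ∫ y, F (ρ • x + σ • y) ∂(stdGaussian E) := by
    refine hc.trans_le ?_
    calc c = ∫ _, c ∂(stdGaussian E) := by simp
      _ ≤ _ := integral_mono (integrable_const _) hi fun y => h.lower _
  have hCS := sq_integral_div_le hi' hi hif (fun y => hc.trans_le (h.lower _)) hpos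
  rw [integral_smul, norm_smul, Real.norm_of_nonneg hρ, mul_pow, mul_div_assoc]
  refine mul_le_mul_of_nonneg_left (le_trans ?_ hCS) (sq_nonneg _)
  have := norm_integral_le_integral_norm (μ := stdGaussian E) fun y => F' (ρ • x + σ • y)
  have hpos' : 0 < _root_.ouStep ρ σ F x := hpos
  change _ / _root_.ouStep ρ σ F x ≤ _ / _root_.ouStep ρ σ F x
  gcongr

end IsSmoothBounded

end OrnsteinUhlenbeck

/-! ### Entropy along the Ornstein–Uhlenbeck chain -/

section GaussianEntropy

variable {E : Type*} [NormedAddCommGroup E] [InnerProductSpace ℝ E]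
  [FiniteDimensional ℝ E] [MeasurableSpace E]

variable (E) in
/-- The coefficient of `σ ^ 3` in the error of the second order expansion of the entropy over one
Ornstein–Uhlenbeck step, for functions bounded below by `c` with first and second derivatives
bounded by `K`. -/
noncomputable def ouError (c K : ℝ) : ℝ :=
  K ^ 2 * (2 * ∫ x, ‖x‖ ^ 3 ∂(stdGaussian E) + ∫ x, ‖x‖ ^ 4 ∂(stdGaussian E)) / (2 * c)
    + K ^ 3 * (∫ x, ‖x‖ ^ 3 ∂(stdGaussian E)) / (2 * c ^ 2)
    + (2 * K ^ 2 / c + K ^ 3 / c ^ 2) * (∫ x, ‖x‖ ^ 1 ∂(stdGaussian E)) / 2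

theorem ouError_mul_le {c K ρ : ℝ} (hc : 0 < c) (hK : 0 ≤ K) (hρ : 0 ≤ ρ) (hρ1 : ρ ≤ 1) :
    ouError E c (ρ * K) ≤ ρ * ouError E c K := by
  have hm : ∀ k : ℕ, 0 ≤ ∫ x, ‖x‖ ^ k ∂(stdGaussian E) := fun k =>
    integral_nonneg fun x => by positivity
  have h2 : (ρ * K) ^ 2 ≤ ρ * K ^ 2 := by
    rw [mul_pow]
    exact mul_le_mul_of_nonneg_right (pow_le_of_le_one hρ hρ1 two_ne_zero) (sq_nonneg K)
  have h3 : (ρ * K) ^ 3 ≤ ρ * K ^ 3 := by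
    rw [mul_pow]
    exact mul_le_mul_of_nonneg_right (pow_le_of_le_one hρ hρ1 three_ne_zero) (pow_nonneg hK 3)
  have m1 := hm 1
  have m3 := hm 3
  have m4 := hm 4
  unfold ouError
  calc _ ≤ (ρ * K ^ 2) * (2 * ∫ x, ‖x‖ ^ 3 ∂(stdGaussian E) + ∫ x, ‖x‖ ^ 4 ∂(stdGaussian E))
        / (2 * c)
      + (ρ * K ^ 3) * (∫ x, ‖x‖ ^ 3 ∂(stdGaussian E)) / (2 * c ^ 2)
      + (2 * (ρ * K ^ 2) / c + (ρ * K ^ 3) / c ^ 2) * (∫ x, ‖x‖ ^ 1 ∂(stdGaussian E)) / 2 := by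
        gcongr
    _ = _ := by ring

variable [BorelSpace E]

namespace IsSmoothBounded

variable {F : E → ℝ} {F' : E → StrongDual ℝ E} {c B K ρ σ : ℝ}

/-- Entropy of one Ornstein–Uhlenbeck step started from a point, to second order in `σ`. -/
theorem ouStep_mul_log_sub_le (h : IsSmoothBounded F F' c B K) (hc : 0 < c) (hσ : 0 ≤ σ)
    (hσ1 : σ ≤ 1) (x : E) :
    _root_.ouStep ρ σ (fun x => F x * Real.log (F x)) x
        - _root_.ouStep ρ σ F x * Real.log (_root_.ouStep ρ σ F x)
      ≤ σ ^ 2 / 2 * _root_.ouStep ρ σ (fun x => ‖F' x‖ ^ 2 / F x) x + σ ^ 3 * ouError E c K := by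
  set γ := stdGaussian E with hγ
  have hF := h.continuous
  have hF' := h.continuous_deriv
  have hfi := h.continuous_fisher hc
  have hK := h.nonneg
  set a := ρ • x with ha
  have hline : Continuous fun y : E => a + σ • y := by fun_prop
  set b := F a with hb
  have hcb : c ≤ b := h.lower a
  have hb0 : 0 < b := hc.trans_le hcb
  have hpos : ∀ z, 0 < F z := fun z => hc.trans_le (h.lower z)
  have hi : Integrable (fun y => F (a + σ • y)) γ :=
    integrable_of_continuous_bounded (by fun_prop) fun y => h.norm_le_max _
  obtain ⟨D, hD⟩ := h.exists_abs_mul_log_le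
  have hcl : Continuous fun z => F z * Real.log (F z) :=
    hF.mul (hF.log fun z => (hpos z).ne')
  have hil : Integrable (fun y => F (a + σ • y) * Real.log (F (a + σ • y))) γ :=
    integrable_of_continuous_bounded (hcl.comp hline) fun y => hD _
  have hif : Integrable (fun y => ‖F' (a + σ • y)‖ ^ 2 / F (a + σ • y)) γ :=
    integrable_of_continuous_bounded (hfi.comp hline) fun y => h.fisher_le hc _
  have hm : ∀ k : ℕ, Integrable (fun y : E => ‖y‖ ^ k) γ := integrable_norm_pow_stdGaussian
  have hL2 : Integrable (fun y => (F' a y) ^ 2) γ := by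
    refine ((hm 2).const_mul (K ^ 2)).mono' (by fun_prop) (Eventually.of_forall fun y => ?_)
    rw [Real.norm_of_nonneg (sq_nonneg _), ← mul_pow, ← sq_abs]
    refine pow_le_pow_left₀ (abs_nonneg _) (((F' a).le_opNorm y).trans ?_) 2
    gcongr
    exact h.norm_le a
  have hmean : c ≤ ∫ y, F (a + σ • y) ∂γ := by
    calc c = ∫ _, c ∂γ := by simp
      _ ≤ _ := integral_mono (integrable_const _) hi fun y => h.lower _
  -- the entropy is bounded by its linearisation at the value `b` of `F` at the centre
  have h1 : _root_.ouStep ρ σ (fun x => F x * Real.log (F x)) x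
      - _root_.ouStep ρ σ F x * Real.log (_root_.ouStep ρ σ F x)
      ≤ ∫ y, (F (a + σ • y) * Real.log (F (a + σ • y))
        - (F (a + σ • y) * Real.log b + F (a + σ • y) - b)) ∂γ := by
    have hi1 : Integrable (fun y => F (a + σ • y) * Real.log b + F (a + σ • y)) γ :=
      (hi.mul_const _).add hi
    have hi2 : Integrable (fun y => F (a + σ • y) * Real.log b + F (a + σ • y) - b) γ :=
      hi1.sub (integrable_const _)
    rw [integral_sub hil hi2, integral_sub hi1 (integrable_const _),
      integral_add (hi.mul_const _) hi, integral_mul_const]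
    have := mul_log_tangent_le (hc.trans_le hmean) hb0
    simp only [integral_const, probReal_univ, smul_eq_mul, one_mul]
    exact sub_le_sub_left this _
  have hcube : ∀ y, (F (a + σ • y) * Real.log (F (a + σ • y))
      - (F (a + σ • y) * Real.log b + F (a + σ • y) - b))
      ≤ σ ^ 2 / (2 * b) * (F' a y) ^ 2
        + σ ^ 3 * (K ^ 2 * (2 * ‖y‖ ^ 3 + ‖y‖ ^ 4) / (2 * c) + K ^ 3 * ‖y‖ ^ 3 / (2 * c ^ 2)) := by
    intro y
    refine (mul_log_sub_le (hpos _) hb0).trans ?_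
    have h2 := h.sq_sub_le a (σ • y)
    have h3 := h.abs_sub_le a (a + σ • y)
    rw [add_sub_cancel_left, norm_smul, Real.norm_of_nonneg hσ] at h3
    rw [norm_smul, Real.norm_of_nonneg hσ, map_smul, smul_eq_mul] at h2
    have h4 : (F (a + σ • y) - b) ^ 2 ≤ σ ^ 2 * (F' a y) ^ 2
        + σ ^ 3 * (K ^ 2 * (2 * ‖y‖ ^ 3 + ‖y‖ ^ 4)) := by
      refine h2.trans ?_
      have : σ ^ 4 ≤ σ ^ 3 := pow_le_pow_of_le_one hσ hσ1 (by norm_num)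
      have h5 : σ ^ 4 * (K ^ 2 * ‖y‖ ^ 4) ≤ σ ^ 3 * (K ^ 2 * ‖y‖ ^ 4) := by gcongr
      nlinarith
    calc (F (a + σ • y) - b) ^ 2 / (2 * b) + |F (a + σ • y) - b| ^ 3 / (2 * b ^ 2)
        ≤ (σ ^ 2 * (F' a y) ^ 2 + σ ^ 3 * (K ^ 2 * (2 * ‖y‖ ^ 3 + ‖y‖ ^ 4))) / (2 * b)
          + (K * (σ * ‖y‖)) ^ 3 / (2 * b ^ 2) := by gcongr
      _ = σ ^ 2 / (2 * b) * (F' a y) ^ 2 + (σ ^ 3 * (K ^ 2 * (2 * ‖y‖ ^ 3 + ‖y‖ ^ 4))) / (2 * b)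
          + (K * (σ * ‖y‖)) ^ 3 / (2 * b ^ 2) := by ring
      _ ≤ σ ^ 2 / (2 * b) * (F' a y) ^ 2 + (σ ^ 3 * (K ^ 2 * (2 * ‖y‖ ^ 3 + ‖y‖ ^ 4))) / (2 * c)
          + (K * (σ * ‖y‖)) ^ 3 / (2 * c ^ 2) := by gcongr
      _ = _ := by ring
  have hi34 : Integrable (fun y : E => K ^ 2 * (2 * ‖y‖ ^ 3 + ‖y‖ ^ 4) / (2 * c)) γ :=
    ((((hm 3).const_mul 2).add (hm 4)).const_mul _).div_const _
  have hi3 : Integrable (fun y : E => K ^ 3 * ‖y‖ ^ 3 / (2 * c ^ 2)) γ :=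
    ((hm 3).const_mul _).div_const _
  have hi343 : Integrable (fun y : E => K ^ 2 * (2 * ‖y‖ ^ 3 + ‖y‖ ^ 4) / (2 * c)
      + K ^ 3 * ‖y‖ ^ 3 / (2 * c ^ 2)) γ := hi34.add hi3
  have h2 := h1.trans (integral_mono (hil.sub (((hi.mul_const _).add hi).sub (integrable_const _)))
    ((hL2.const_mul _).add (hi343.const_mul _)) hcube)
  rw [integral_add' (hL2.const_mul _) (hi343.const_mul _), integral_const_mul,
    integral_const_mul, integral_sq_dual_stdGaussian, integral_add hi34 hi3, integral_div,
    integral_div, integral_const_mul, integral_const_mul,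
    integral_add ((hm 3).const_mul 2) (hm 4), integral_const_mul] at h2
  -- replace the Fisher information at the centre by its mean
  have h3 : ‖F' a‖ ^ 2 / F a ≤ _root_.ouStep ρ σ (fun x => ‖F' x‖ ^ 2 / F x) x
      + σ * ((2 * K ^ 2 / c + K ^ 3 / c ^ 2) * ∫ y, ‖y‖ ^ 1 ∂γ) := by
    have h4 : ∫ _, ‖F' a‖ ^ 2 / F a ∂γ ≤ ∫ y, (‖F' (a + σ • y)‖ ^ 2 / F (a + σ • y)
        + σ * ((2 * K ^ 2 / c + K ^ 3 / c ^ 2) * ‖y‖ ^ 1)) ∂γ := by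
      refine integral_mono (integrable_const _) (hif.add (((hm 1).const_mul _).const_mul _))
        fun y => ?_
      have := h.fisher_sub_le hc a (a + σ • y)
      rw [sub_add_cancel_left, norm_neg, norm_smul, Real.norm_of_nonneg hσ] at this
      simp only [pow_one]
      linarith
    rw [integral_add hif (((hm 1).const_mul _).const_mul _), integral_const_mul,
      integral_const_mul, integral_const, probReal_univ, one_smul] at h4
    exact h4
  refine h2.trans ?_
  have h5 := mul_le_mul_of_nonneg_left h3 (by positivity : 0 ≤ σ ^ 2 / 2)
  have e1 : σ ^ 2 / (2 * b) * ‖F' a‖ ^ 2 = σ ^ 2 / 2 * (‖F' a‖ ^ 2 / F a) := by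
    rw [hb]; field_simp
  rw [e1]
  refine (add_le_add_left h5 _).trans (le_of_eq ?_)
  unfold ouError
  ring

/-- The entropy lost in one stationary step of the Ornstein–Uhlenbeck chain, to second order in `σ`. -/
theorem entropy_sub_ouStep_le (h : IsSmoothBounded F F' c B K) (hc : 0 < c) (hρ : 0 ≤ ρ)
    (hρ1 : ρ ≤ 1) (hσ : 0 ≤ σ) (hσ1 : σ ≤ 1) (hρσ : ρ ^ 2 + σ ^ 2 = 1) :
    ∫ x, F x * Real.log (F x) ∂(stdGaussian E)
        - ∫ x, _root_.ouStep ρ σ F x * Real.log (_root_.ouStep ρ σ F x) ∂(stdGaussian E)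
      ≤ σ ^ 2 / 2 * ∫ x, ‖F' x‖ ^ 2 / F x ∂(stdGaussian E) + σ ^ 3 * ouError E c K := by
  have hF := h.continuous
  have hpos : ∀ z, 0 < F z := fun z => hc.trans_le (h.lower z)
  have hcl : Continuous fun z => F z * Real.log (F z) := hF.mul (hF.log fun z => (hpos z).ne')
  obtain ⟨D, hD⟩ := h.exists_abs_mul_log_le
  have hP := h.ouStep (σ := σ) hρ hρ1
  obtain ⟨D', hD'⟩ := hP.exists_abs_mul_log_le
  have hPpos : ∀ z, 0 < _root_.ouStep ρ σ F z := fun z => hc.trans_le (hP.lower z)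
  have hclP : Continuous fun z => _root_.ouStep ρ σ F z * Real.log (_root_.ouStep ρ σ F z) :=
    hP.continuous.mul (hP.continuous.log fun z => (hPpos z).ne')
  have hPi : Integrable (fun z => _root_.ouStep ρ σ F z * Real.log (_root_.ouStep ρ σ F z))
      (stdGaussian E) := integrable_of_continuous_bounded hclP hD'
  have hint : ∀ {G : E → ℝ}, Continuous G → ∀ {D : ℝ}, (∀ x, ‖G x‖ ≤ D) →
      Integrable (_root_.ouStep ρ σ G) (stdGaussian E) := by
    intro G hG D hD
    have : Integrable (fun p : E × E => G (ρ • p.1 + σ • p.2))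
        ((stdGaussian E).prod (stdGaussian E)) :=
      Integrable.of_bound (by fun_prop) D (Eventually.of_forall fun p => hD _)
    exact this.integral_prod_left
  have hi1 := hint hcl hD
  have hi2 := hint (h.continuous_fisher hc) (h.fisher_le hc)
  rw [← integral_ouStep hρσ hcl hD, ← integral_ouStep hρσ (h.continuous_fisher hc) (h.fisher_le hc),
    ← integral_sub hi1 hPi]
  have hi3 : Integrable (fun x => σ ^ 2 / 2 * _root_.ouStep ρ σ (fun x => ‖F' x‖ ^ 2 / F x) x
      + σ ^ 3 * ouError E c K) (stdGaussian E) := (hi2.const_mul _).add (integrable_const _)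
  refine (integral_mono (hi1.sub hPi) hi3
    fun x => h.ouStep_mul_log_sub_le hc hσ hσ1 x).trans (le_of_eq ?_)
  rw [integral_add (hi2.const_mul _) (integrable_const _), integral_const_mul]
  simp

theorem integral_fisher_ouStep_le (h : IsSmoothBounded F F' c B K) (hc : 0 < c) (hρ : 0 ≤ ρ)
    (hρ1 : ρ ≤ 1) (hρσ : ρ ^ 2 + σ ^ 2 = 1) :
    ∫ x, ‖∫ y, ρ • F' (ρ • x + σ • y) ∂(stdGaussian E)‖ ^ 2 / _root_.ouStep ρ σ F x
        ∂(stdGaussian E) ≤ ρ ^ 2 * ∫ x, ‖F' x‖ ^ 2 / F x ∂(stdGaussian E) := by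
  have hP := h.ouStep (σ := σ) hρ hρ1
  rw [← integral_ouStep hρσ (h.continuous_fisher hc) (h.fisher_le hc), ← integral_const_mul]
  refine integral_mono
    (integrable_of_continuous_bounded (hP.continuous_fisher hc) (hP.fisher_le hc)) ?_
    fun x => h.fisher_ouStep_le hc hρ x
  have : Integrable (fun p : E × E => ‖F' (ρ • p.1 + σ • p.2)‖ ^ 2 / F (ρ • p.1 + σ • p.2))
      ((stdGaussian E).prod (stdGaussian E)) := by
    refine Integrable.of_bound ?_ (K ^ 2 / c) (Eventually.of_forall fun p => h.fisher_le hc _)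
    exact ((h.continuous_fisher hc).comp
      (by fun_prop : Continuous fun p : E × E => ρ • p.1 + σ • p.2)).aestronglyMeasurable
  exact this.integral_prod_left.const_mul _

/-- The entropy lost along the Ornstein–Uhlenbeck chain: the Fisher information decays
geometrically with ratio `ρ ^ 2`, the error with ratio `ρ`. -/
theorem entropy_sub_iterate_le (hc : 0 < c) (hρ : 0 ≤ ρ) (hρ1 : ρ < 1) (hσ : 0 ≤ σ) (hσ1 : σ ≤ 1)
    (hρσ : ρ ^ 2 + σ ^ 2 = 1) (n : ℕ) {F : E → ℝ} {F' : E → StrongDual ℝ E} {K : ℝ}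
    (h : IsSmoothBounded F F' c B K) :
    ∫ x, F x * Real.log (F x) ∂(stdGaussian E)
        - ∫ x, (_root_.ouStep ρ σ)^[n] F x * Real.log ((_root_.ouStep ρ σ)^[n] F x) ∂(stdGaussian E)
      ≤ 1 / 2 * ∫ x, ‖F' x‖ ^ 2 / F x ∂(stdGaussian E)
        + σ ^ 3 * ouError E c K / (1 - ρ) := by
  have hρ' : 0 < 1 - ρ := by linarith
  induction n generalizing F F' K with
  | zero =>
    have hm : ∀ k : ℕ, 0 ≤ ∫ x, ‖x‖ ^ k ∂(stdGaussian E) := fun k =>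
      integral_nonneg fun x => by positivity
    have h1 := hm 1
    have h3 := hm 3
    have h4 := hm 4
    have hK := h.nonneg
    have hI : 0 ≤ ∫ x, ‖F' x‖ ^ 2 / F x ∂(stdGaussian E) := integral_nonneg fun x => by
      have := hc.trans_le (h.lower x)
      positivity
    have hR : 0 ≤ ouError E c K := by unfold ouError; positivity
    simp only [Function.iterate_zero, id_eq, sub_self]
    positivity
  | succ n ih =>
    have hP := h.ouStep (σ := σ) hρ hρ1.le
    have h1 := ih hP
    have h2 := h.entropy_sub_ouStep_le hc hρ hρ1.le hσ hσ1 hρσ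
    have h3 := h.integral_fisher_ouStep_le hc hρ hρ1.le hρσ
    have h4 : σ ^ 3 * ouError E c (ρ * K) / (1 - ρ) ≤ σ ^ 3 * (ρ * ouError E c K) / (1 - ρ) := by
      have := ouError_mul_le (E := E) hc h.nonneg hρ hρ1.le
      gcongr
    have e : σ ^ 3 * (ρ * ouError E c K) / (1 - ρ) + σ ^ 3 * ouError E c K
        = σ ^ 3 * ouError E c K / (1 - ρ) := by
      field_simp
      ring
    have e2 : 1 / 2 * (ρ ^ 2 * ∫ x, ‖F' x‖ ^ 2 / F x ∂(stdGaussian E))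
        + σ ^ 2 / 2 * ∫ x, ‖F' x‖ ^ 2 / F x ∂(stdGaussian E)
        = 1 / 2 * ∫ x, ‖F' x‖ ^ 2 / F x ∂(stdGaussian E) := by
      linear_combination (1 / 2 * ∫ x, ‖F' x‖ ^ 2 / F x ∂(stdGaussian E)) * hρσ
    rw [Function.iterate_succ, Function.comp_apply]
    linarith

theorem iterate_ouStep (hρ : 0 ≤ ρ) (hρ1 : ρ ≤ 1) (n : ℕ) {F : E → ℝ} {F' : E → StrongDual ℝ E}
    {K : ℝ} (h : IsSmoothBounded F F' c B K) :
    ∃ G', IsSmoothBounded ((_root_.ouStep ρ σ)^[n] F) G' c B (ρ ^ n * K) := by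
  induction n generalizing F F' K with
  | zero => exact ⟨F', by simpa using h⟩
  | succ n ih =>
    obtain ⟨G', hG⟩ := ih (h.ouStep (σ := σ) hρ hρ1)
    refine ⟨G', ?_⟩
    rw [Function.iterate_succ, Function.comp_apply, pow_succ, mul_assoc]
    exact hG

theorem integral_iterate_ouStep (hρ : 0 ≤ ρ) (hρ1 : ρ ≤ 1) (hρσ : ρ ^ 2 + σ ^ 2 = 1) (n : ℕ)
    {F : E → ℝ} {F' : E → StrongDual ℝ E} {K : ℝ} (h : IsSmoothBounded F F' c B K) :
    ∫ x, (_root_.ouStep ρ σ)^[n] F x ∂(stdGaussian E) = ∫ x, F x ∂(stdGaussian E) := by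
  induction n generalizing F F' K with
  | zero => rfl
  | succ n ih =>
    rw [Function.iterate_succ, Function.comp_apply, ih (h.ouStep (σ := σ) hρ hρ1),
      integral_ouStep hρσ h.continuous h.norm_le_max]

/-- The Ornstein–Uhlenbeck chain forgets its starting point. -/
theorem tendsto_iterate_ouStep (h : IsSmoothBounded F F' c B K) (hρ : 0 ≤ ρ) (hρ1 : ρ < 1)
    (hρσ : ρ ^ 2 + σ ^ 2 = 1) (x : E) :
    Tendsto (fun n => (_root_.ouStep ρ σ)^[n] F x) atTop (𝓝 (∫ y, F y ∂(stdGaussian E))) := by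
  have hm : Integrable (fun y : E => ‖x - y‖) (stdGaussian E) := by
    have h1 := integrable_norm_pow_stdGaussian (E := E) 1
    simp only [pow_one] at h1
    refine ((integrable_const ‖x‖).add h1).mono' (by fun_prop) (Eventually.of_forall fun y => ?_)
    rw [norm_norm]
    exact _root_.norm_sub_le x y
  rw [tendsto_iff_norm_sub_tendsto_zero]
  have hlim : Tendsto (fun n => ρ ^ n * (K * ∫ y, ‖x - y‖ ∂(stdGaussian E))) atTop (𝓝 0) := by
    simpa using (tendsto_pow_atTop_nhds_zero_of_lt_one hρ hρ1).mul_const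
      (K * ∫ y, ‖x - y‖ ∂(stdGaussian E))
  refine squeeze_zero (fun n => norm_nonneg _) (fun n => ?_) hlim
  obtain ⟨G', hG⟩ := iterate_ouStep (σ := σ) hρ hρ1.le n h
  have hi : Integrable ((_root_.ouStep ρ σ)^[n] F) (stdGaussian E) :=
    integrable_of_continuous_bounded hG.continuous hG.norm_le_max
  rw [← integral_iterate_ouStep hρ hρ1.le hρσ n h]
  have e : (_root_.ouStep ρ σ)^[n] F x - ∫ y, (_root_.ouStep ρ σ)^[n] F y ∂(stdGaussian E)
      = ∫ y, ((_root_.ouStep ρ σ)^[n] F x - (_root_.ouStep ρ σ)^[n] F y) ∂(stdGaussian E) := by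
    rw [integral_sub (integrable_const _) hi]
    simp
  rw [e, ← mul_assoc, ← integral_const_mul]
  exact norm_integral_le_of_norm_le (hm.const_mul _)
    (Eventually.of_forall fun y => hG.abs_sub_le y x)

/-- The Gaussian log-Sobolev inequality in entropy form: let the step of the Ornstein–Uhlenbeck
chain tend to zero. -/
theorem entropy_stdGaussian_le (h : IsSmoothBounded F F' c B K) (hc : 0 < c) :
    ∫ x, F x * Real.log (F x) ∂(stdGaussian E)
        - (∫ x, F x ∂(stdGaussian E)) * Real.log (∫ x, F x ∂(stdGaussian E))
      ≤ 1 / 2 * ∫ x, ‖F' x‖ ^ 2 / F x ∂(stdGaussian E) := by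
  have key : ∀ σ ∈ Set.Ioo (0 : ℝ) 1, ∫ x, F x * Real.log (F x) ∂(stdGaussian E)
        - (∫ x, F x ∂(stdGaussian E)) * Real.log (∫ x, F x ∂(stdGaussian E))
      ≤ 1 / 2 * ∫ x, ‖F' x‖ ^ 2 / F x ∂(stdGaussian E)
        + σ ^ 3 * ouError E c K / (1 - √(1 - σ ^ 2)) := by
    rintro σ ⟨hσ0, hσ1⟩
    have h01 : 0 < 1 - σ ^ 2 := by nlinarith
    have hρ0 : 0 ≤ √(1 - σ ^ 2) := Real.sqrt_nonneg _
    have hρ1 : √(1 - σ ^ 2) < 1 := by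
      rw [Real.sqrt_lt' one_pos]; nlinarith
    have hρσ : √(1 - σ ^ 2) ^ 2 + σ ^ 2 = 1 := by rw [Real.sq_sqrt h01.le]; ring
    set ρ := √(1 - σ ^ 2)
    obtain ⟨D, hD⟩ := (isCompact_Icc (a := c) (b := B)).exists_bound_of_continuousOn
      (Real.continuous_mul_log.continuousOn)
    have hlim : Tendsto (fun n => ∫ x, (_root_.ouStep ρ σ)^[n] F x
        * Real.log ((_root_.ouStep ρ σ)^[n] F x) ∂(stdGaussian E)) atTop
        (𝓝 (∫ _, (∫ x, F x ∂(stdGaussian E)) * Real.log (∫ x, F x ∂(stdGaussian E))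
          ∂(stdGaussian E))) := by
      refine tendsto_integral_of_dominated_convergence (fun _ => D) (fun n => ?_)
        (integrable_const _) (fun n => Eventually.of_forall fun x => ?_)
        (Eventually.of_forall fun x => ?_)
      · obtain ⟨G', hG⟩ := iterate_ouStep (σ := σ) hρ0 hρ1.le n h
        exact (Real.continuous_mul_log.comp hG.continuous).aestronglyMeasurable
      · obtain ⟨G', hG⟩ := iterate_ouStep (σ := σ) hρ0 hρ1.le n h
        exact hD _ ⟨hG.lower x, hG.upper x⟩
      · exact (Real.continuous_mul_log.tendsto _).comp (h.tendsto_iterate_ouStep hρ0 hρ1 hρσ x)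
    simp only [integral_const, probReal_univ, smul_eq_mul, one_mul] at hlim
    exact le_of_tendsto (tendsto_const_nhds.sub hlim) (Eventually.of_forall fun n =>
      entropy_sub_iterate_le hc hρ0 hρ1 hσ0.le hσ1.le hρσ n h)
  have hR : Tendsto (fun σ : ℝ => 1 / 2 * ∫ x, ‖F' x‖ ^ 2 / F x ∂(stdGaussian E)
      + σ * (1 + √(1 - σ ^ 2)) * ouError E c K) (𝓝[>] 0)
      (𝓝 (1 / 2 * ∫ x, ‖F' x‖ ^ 2 / F x ∂(stdGaussian E))) := by
    have : Continuous fun σ : ℝ => 1 / 2 * ∫ x, ‖F' x‖ ^ 2 / F x ∂(stdGaussian E)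
      + σ * (1 + √(1 - σ ^ 2)) * ouError E c K := by fun_prop
    simpa using (this.tendsto 0).mono_left nhdsWithin_le_nhds
  refine ge_of_tendsto hR ?_
  filter_upwards [Ioo_mem_nhdsGT (one_pos : (0 : ℝ) < 1)] with σ hσ
  refine (key σ hσ).trans (le_of_eq ?_)
  have h01 : 0 < 1 - σ ^ 2 := by nlinarith [hσ.1, hσ.2]
  have hρ1 : √(1 - σ ^ 2) < 1 := by
    rw [Real.sqrt_lt' one_pos]; nlinarith [hσ.1]
  have hsq := Real.sq_sqrt h01.le
  have hne : 1 - √(1 - σ ^ 2) ≠ 0 := by linarith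
  rw [add_right_inj, div_eq_iff hne]
  linear_combination (σ * ouError E c K) * hsq

end IsSmoothBounded

end GaussianEntropy

/-! ### Mollification of Lipschitz functions -/

section Mollification

variable {E : Type*} [NormedAddCommGroup E] [InnerProductSpace ℝ E]
  [FiniteDimensional ℝ E] [MeasurableSpace E] [BorelSpace E]

/-- By Rademacher's theorem, averaging a Lipschitz function over the translates by an absolutely
continuous random vector averages its almost everywhere defined derivative. -/
theorem hasFDerivAt_integral_translate {f : E → ℝ} {K : ℝ≥0} (hf : LipschitzWith K f) {B : ℝ}
    (hB : ∀ z, |f z| ≤ B) {μ : Measure E} [IsProbabilityMeasure μ] (hμ : μ ≪ volume) (x : E) :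
    HasFDerivAt (fun x => ∫ t, f (x - t) ∂μ) (∫ t, fderiv ℝ f (x - t) ∂μ) x := by
  have hfc := hf.continuous
  have hm : Measurable (fderiv ℝ f) := measurable_fderiv ℝ f
  have hi : ∀ x, Integrable (fun t => f (x - t)) μ := fun x =>
    integrable_of_continuous_bounded (by fun_prop) fun t => hB _
  refine (hasFDerivAt_integral_of_dominated_loc_of_lip (s := Set.univ) (bound := fun _ => (K : ℝ))
    univ_mem (Eventually.of_forall fun x => (hi x).1) (hi x) ?_ ?_ (integrable_const _) ?_).2
  · exact (hm.comp (by fun_prop : Measurable fun t => x - t)).aestronglyMeasurable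
  · refine Eventually.of_forall fun t => LipschitzOnWith.of_dist_le_mul fun y _ z _ => ?_
    simpa using hf.dist_le_mul (y - t) (z - t)
  · have h1 : ∀ᵐ t, DifferentiableAt ℝ f (x - t) :=
      (Measure.measurePreserving_sub_left volume x).quasiMeasurePreserving.ae
        hf.ae_differentiableAt
    filter_upwards [hμ.ae_le h1] with t ht
    have h2 : HasFDerivAt (fun y : E => y - t) (ContinuousLinearMap.id ℝ E) x :=
      (hasFDerivAt_id x).sub_const t
    exact ht.hasFDerivAt.comp x h2

theorem norm_integral_sq_le {α G : Type*} [MeasurableSpace α] [NormedAddCommGroup G]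
    [NormedSpace ℝ G] {μ : Measure α} [IsProbabilityMeasure μ] {g : α → G}
    (hg : AEStronglyMeasurable g μ) {K : ℝ} (hK : ∀ a, ‖g a‖ ≤ K) :
    ‖∫ a, g a ∂μ‖ ^ 2 ≤ ∫ a, ‖g a‖ ^ 2 ∂μ := by
  have hi : Integrable (fun a => ‖g a‖) μ := Integrable.of_bound hg.norm K
    (Eventually.of_forall fun a => by rw [norm_norm]; exact hK a)
  have hi2 : Integrable (fun a => ‖g a‖ ^ 2) μ := Integrable.of_bound (hg.norm.pow 2) (K ^ 2)
    (Eventually.of_forall fun a => by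
      rw [norm_pow, norm_norm]
      exact pow_le_pow_left₀ (norm_nonneg _) (hK a) 2)
  have h1 := sq_integral_div_le (ν := μ) (X := fun a => ‖g a‖) (Y := fun _ => 1) hi
    (integrable_const 1) (by simpa using hi2) (fun _ => one_pos) (by simp)
  simp only [integral_const, probReal_univ, smul_eq_mul, mul_one, div_one] at h1
  exact (pow_le_pow_left₀ (norm_nonneg _) (norm_integral_le_integral_norm _) 2).trans h1

/-- Smoothing a bounded Lipschitz function by convolution with a bump function: the result has a
Lipschitz derivative, whose square is at most the mollification of `‖fderiv ℝ f‖ ^ 2`. -/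
theorem exists_mollification {f : E → ℝ} {K : ℝ≥0} (hf : LipschitzWith K f) {B : ℝ}
    (hB : ∀ z, |f z| ≤ B) (φ : ContDiffBump (0 : E)) :
    ∃ (g : E → ℝ) (g' : E → StrongDual ℝ E) (M : ℝ), (∀ x, HasFDerivAt g (g' x) x) ∧
      (∀ x, |g x - f x| ≤ K * φ.rOut) ∧ (∀ x, ‖g' x‖ ≤ K) ∧
      (∀ x y, ‖g' x - g' y‖ ≤ M * ‖x - y‖) ∧
      ∀ x, ‖g' x‖ ^ 2 ≤ convolution (φ.normed volume) (fun z => ‖fderiv ℝ f z‖ ^ 2)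
        (ContinuousLinearMap.lsmul ℝ ℝ) volume x := by
  have hfc := hf.continuous
  set w : E → ℝ := φ.normed volume with hw
  have hwc : Continuous w := φ.continuous_normed
  have hw0 : ∀ t, 0 ≤ w t := fun t => φ.nonneg_normed t
  set μ : Measure E := volume.withDensity fun t => ENNReal.ofReal (w t) with hμ
  have hμint : ∀ {G : Type _} [NormedAddCommGroup G] [NormedSpace ℝ G] (h : E → G),
      ∫ t, h t ∂μ = ∫ t, w t • h t := by
    intro G _ _ h
    rw [hμ, integral_withDensity_eq_integral_toReal_smul (by fun_prop) (by simp)]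
    exact integral_congr_ae (Eventually.of_forall fun t => by
      simp only [ENNReal.toReal_ofReal (hw0 t)])
  have hprob : IsProbabilityMeasure μ := by
    refine ⟨?_⟩
    rw [hμ, withDensity_apply _ MeasurableSet.univ, setLIntegral_univ,
      ← ofReal_integral_eq_lintegral_ofReal φ.integrable_normed (Eventually.of_forall hw0),
      φ.integral_normed, ENNReal.ofReal_one]
  have hac : μ ≪ volume := withDensity_absolutelyContinuous _ _
  have hg : ∀ x, convolution w f (ContinuousLinearMap.lsmul ℝ ℝ) volume x = ∫ t, f (x - t) ∂μ :=
    fun x => by rw [hμint]; rfl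
  have hfd : ∀ z, ‖fderiv ℝ f z‖ ≤ K := fun z => norm_fderiv_le_of_lipschitz ℝ hf
  have hm : Measurable (fderiv ℝ f) := measurable_fderiv ℝ f
  have hfl : LocallyIntegrable f volume := hfc.locallyIntegrable
  have hder := fun x => hasFDerivAt_integral_translate hf hB hac x
  have hw' : HasCompactSupport (fderiv ℝ w) := φ.hasCompactSupport_normed.fderiv ℝ
  have hwd : ContDiff ℝ 1 w := φ.contDiff_normed
  have hw'c : Continuous (fderiv ℝ w) := hwd.continuous_fderiv (by norm_num)
  have hw'i : Integrable (fderiv ℝ w) volume := hw'c.integrable_of_hasCompactSupport hw'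
  -- the derivative falls on the bump as well as on `f`
  have hconv : ∀ x, ∫ t, fderiv ℝ f (x - t) ∂μ = convolution (fderiv ℝ w) f
      (ContinuousLinearMap.precompL E (ContinuousLinearMap.lsmul ℝ ℝ)) volume x := by
    intro x
    have h1 := φ.hasCompactSupport_normed.hasFDerivAt_convolution_left (𝕜 := ℝ)
      (ContinuousLinearMap.lsmul ℝ ℝ) hwd hfl x
    refine (hder x).unique (h1.congr_of_eventuallyEq ?_)
    exact Eventually.of_forall fun y => (hg y).symm
  refine ⟨fun x => ∫ t, f (x - t) ∂μ, fun x => ∫ t, fderiv ℝ f (x - t) ∂μ,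
    K * ∫ t, ‖fderiv ℝ w t‖, hder, fun x => ?_, fun x => ?_, fun x y => ?_, fun x => ?_⟩
  · change |(∫ t, f (x - t) ∂μ) - f x| ≤ _
    rw [← hg x, ← Real.dist_eq]
    refine φ.dist_normed_convolution_le hfc.aestronglyMeasurable fun z hz => ?_
    exact (hf.dist_le_mul z x).trans
      (mul_le_mul_of_nonneg_left (Metric.mem_ball.1 hz).le K.2)
  · exact (norm_integral_le_of_norm_le_const (Eventually.of_forall fun t => hfd _)).trans (by simp)
  · simp only [hconv]
    have hci : ∀ x, Integrable (fun t => (ContinuousLinearMap.precompL E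
        (ContinuousLinearMap.lsmul ℝ ℝ)) (fderiv ℝ w t) (f (x - t))) volume := fun x =>
      (hw'.convolutionExists_left _ hw'c hfl x)
    unfold convolution
    rw [← integral_sub (hci x) (hci y), mul_right_comm, ← integral_const_mul]
    refine norm_integral_le_of_norm_le (hw'i.norm.const_mul _) (Eventually.of_forall fun t => ?_)
    rw [← map_sub]
    have e : (ContinuousLinearMap.precompL E (ContinuousLinearMap.lsmul ℝ ℝ)) (fderiv ℝ w t)
        (f (x - t) - f (y - t)) = (f (x - t) - f (y - t)) • fderiv ℝ w t := by
      ext v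
      simp [ContinuousLinearMap.precompL_apply]
      ring
    rw [e, norm_smul]
    refine mul_le_mul_of_nonneg_right ?_ (norm_nonneg _)
    have := hf.dist_le_mul (x - t) (y - t)
    rwa [dist_sub_right, dist_eq_norm, dist_eq_norm] at this
  · have h1 := norm_integral_sq_le (μ := μ) (g := fun t => fderiv ℝ f (x - t))
      (hm.comp (by fun_prop : Measurable fun t => x - t)).aestronglyMeasurable fun t => hfd _
    refine h1.trans (le_of_eq ?_)
    rw [hμint]
    rfl

end Mollification

/-! ### The Gaussian log-Sobolev inequality -/

section GaussianLogSobolev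

variable {E : Type*} [NormedAddCommGroup E] [InnerProductSpace ℝ E]

theorem isSmoothBounded_sq_add {g : E → ℝ} {g' : E → StrongDual ℝ E} {B K M ε : ℝ} (hK : 0 ≤ K)
    (hg : ∀ x, HasFDerivAt g (g' x) x) (hB : ∀ x, |g x| ≤ B) (hg' : ∀ x, ‖g' x‖ ≤ K)
    (hM : ∀ x y, ‖g' x - g' y‖ ≤ M * ‖x - y‖) (hε : ε ≤ 1) :
    ∃ R, IsSmoothBounded (fun x => g x ^ 2 + ε) (fun x => (2 * g x) • g' x) ε (B ^ 2 + 1) R := by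
  have hB0 : 0 ≤ B := (abs_nonneg _).trans (hB 0)
  refine ⟨max (2 * B * K) (2 * K * K + 2 * B * M), fun x => ?_, fun x => ?_, fun x => ?_,
    fun x => ?_, fun x y => ?_⟩
  · refine (((hg x).pow 2).add_const ε).congr_fderiv ?_
    ext v
    simp
  · linarith [sq_nonneg (g x)]
  · have := sq_le_sq' (neg_le_of_abs_le (hB x)) (le_of_abs_le (hB x))
    linarith
  · refine le_trans ?_ (le_max_left _ _)
    rw [norm_smul, Real.norm_eq_abs, abs_mul, abs_two]
    have h1 := hB x
    have h2 := hg' x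
    gcongr
  · refine le_trans ?_ (mul_le_mul_of_nonneg_right (le_max_right _ _) (norm_nonneg _))
    have hlip : |g x - g y| ≤ K * ‖x - y‖ :=
      Convex.norm_image_sub_le_of_norm_hasFDerivWithin_le
        (fun z _ => (hg z).hasFDerivWithinAt) (fun z _ => hg' z) convex_univ
        (Set.mem_univ y) (Set.mem_univ x)
    have e : (2 * g x) • g' x - (2 * g y) • g' y
        = (2 * (g x - g y)) • g' x + (2 * g y) • (g' x - g' y) := by
      ext v
      simp
      ring
    rw [e]
    refine (norm_add_le _ _).trans ?_
    rw [norm_smul, norm_smul, Real.norm_eq_abs, Real.norm_eq_abs, abs_mul, abs_mul, abs_two]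
    have h1 := hB y
    have h2 := hg' x
    have h3 := hM x y
    calc 2 * |g x - g y| * ‖g' x‖ + 2 * |g y| * ‖g' x - g' y‖
        ≤ 2 * (K * ‖x - y‖) * K + 2 * B * (M * ‖x - y‖) := by gcongr
      _ = _ := by ring

variable [FiniteDimensional ℝ E] [MeasurableSpace E] [BorelSpace E]

/-- Entropy of `g ^ 2 + ε`: its Fisher information density is `4 g ^ 2 ‖g'‖ ^ 2 / (g ^ 2 + ε)`, which is at
most `4 ‖g'‖ ^ 2`. -/
theorem entropy_sq_add_stdGaussian_le {g : E → ℝ} {g' : E → StrongDual ℝ E} {B K M ε : ℝ}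
    (hK : 0 ≤ K) (hg : ∀ x, HasFDerivAt g (g' x) x) (hB : ∀ x, |g x| ≤ B) (hg' : ∀ x, ‖g' x‖ ≤ K)
    (hM : ∀ x y, ‖g' x - g' y‖ ≤ M * ‖x - y‖) (hε : 0 < ε) (hε1 : ε ≤ 1) :
    ∫ x, (g x ^ 2 + ε) * Real.log (g x ^ 2 + ε) ∂(stdGaussian E)
        - (∫ x, (g x ^ 2 + ε) ∂(stdGaussian E)) * Real.log (∫ x, (g x ^ 2 + ε) ∂(stdGaussian E))
      ≤ 2 * ∫ x, ‖g' x‖ ^ 2 ∂(stdGaussian E) := by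
  obtain ⟨R, hR⟩ := isSmoothBounded_sq_add hK hg hB hg' hM hε1
  refine (hR.entropy_stdGaussian_le hε).trans ?_
  have hg'c : Continuous g' :=
    (LipschitzWith.of_dist_le_mul (K := (max M 0).toNNReal) fun x y => by
      rw [dist_eq_norm, dist_eq_norm, Real.coe_toNNReal _ (le_max_right _ _)]
      exact (hM x y).trans (by gcongr; exact le_max_left _ _)).continuous
  have hi : Integrable (fun x => ‖g' x‖ ^ 2) (stdGaussian E) :=
    integrable_of_continuous_bounded (D := K ^ 2) (by fun_prop) fun x => by
      rw [norm_pow, norm_norm]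
      exact pow_le_pow_left₀ (norm_nonneg _) (hg' x) 2
  rw [← integral_const_mul, ← integral_const_mul]
  refine integral_mono
    ((integrable_of_continuous_bounded (hR.continuous_fisher hε) (hR.fisher_le hε)).const_mul _)
    (hi.const_mul _) fun x => ?_
  simp only
  rw [norm_smul, Real.norm_eq_abs, mul_pow, sq_abs]
  have h1 : (2 * g x) ^ 2 * ‖g' x‖ ^ 2 / (g x ^ 2 + ε) ≤ 4 * ‖g' x‖ ^ 2 := by
    rw [div_le_iff₀ (by positivity)]
    nlinarith [sq_nonneg ‖g' x‖]
  linarith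

/-- **Gross's inequality**: the standard Gaussian measure satisfies a log-Sobolev inequality with
constant `2`. -/
theorem logSobolev_stdGaussian : LogSobolev (stdGaussian E) 2 := by
  rintro f ⟨K, hf⟩ ⟨B, hB⟩
  have hfc := hf.continuous
  have hB0 : 0 ≤ B := (abs_nonneg _).trans (hB 0)
  have hfd : ∀ z, ‖fderiv ℝ f z‖ ≤ K := fun z => norm_fderiv_le_of_lipschitz ℝ hf
  have hm : Measurable (fderiv ℝ f) := measurable_fderiv ℝ f
  have hgrad : ∫ z, gradLength f z ^ 2 ∂(stdGaussian E)
      = ∫ z, ‖fderiv ℝ f z‖ ^ 2 ∂(stdGaussian E) := by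
    refine integral_congr_ae ?_
    filter_upwards [stdGaussian_absolutelyContinuous.ae_le
      (hf.ae_differentiableAt (μ := (volume : Measure E)))] with z hz
    rw [gradLength_eq_norm_fderiv hz]
  rw [hgrad]
  -- mollify `f` at scale `u n`, and add `u n` to the square to keep it away from zero
  set u : ℕ → ℝ := fun n => 1 / ((n : ℝ) + 1) with hu
  have hu0 : ∀ n, 0 < u n := fun n => by positivity
  have hu1 : ∀ n, u n ≤ 1 := fun n => by
    rw [hu, div_le_one (by positivity)]
    simp
  have hulim : Tendsto u atTop (𝓝 0) := tendsto_one_div_add_atTop_nhds_zero_nat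
  set φ : ℕ → ContDiffBump (0 : E) := fun n =>
    ⟨u n / 2, u n, by have := hu0 n; positivity, by linarith [hu0 n]⟩ with hφ
  choose g g' M hg hgf hg' hgM hgsq using fun n => exists_mollification hf hB (φ n)
  have hgf' : ∀ n x, |g n x - f x| ≤ K * u n := hgf
  have hgB : ∀ n x, |g n x| ≤ B + K := fun n x => by
    have h1 := hgf' n x
    have h2 : (K : ℝ) * u n ≤ K := mul_le_of_le_one_right K.2 (hu1 n)
    have h3 := hB x
    have h4 := abs_add_le (g n x - f x) (f x)
    rw [sub_add_cancel] at h4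
    linarith
  have hglim : ∀ x, Tendsto (fun n => g n x) atTop (𝓝 (f x)) := fun x => by
    rw [tendsto_iff_norm_sub_tendsto_zero]
    refine squeeze_zero (fun n => norm_nonneg _) (fun n => hgf' n x) ?_
    simpa using hulim.const_mul (K : ℝ)
  have hgc : ∀ n, Continuous (g n) := fun n =>
    continuous_iff_continuousAt.2 fun x => (hg n x).continuousAt
  set F : ℕ → E → ℝ := fun n x => g n x ^ 2 + u n with hF
  have hFlim : ∀ x, Tendsto (fun n => F n x) atTop (𝓝 (f x ^ 2)) := fun x => by
    simpa using ((hglim x).pow 2).add hulim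
  have hFc : ∀ n, Continuous (F n) := fun n => ((hgc n).pow 2).add continuous_const
  have hFmem : ∀ n x, F n x ∈ Set.Icc 0 ((B + K) ^ 2 + 1) := fun n x => by
    have h1 := sq_le_sq' (neg_le_of_abs_le (hgB n x)) (le_of_abs_le (hgB n x))
    have h2 := (hu0 n).le
    have h3 := hu1 n
    exact ⟨by positivity, by simp only [hF]; linarith⟩
  obtain ⟨D, hD⟩ := (isCompact_Icc (a := 0) (b := (B + K) ^ 2 + 1)).exists_bound_of_continuousOn
    (Real.continuous_mul_log.continuousOn)
  have hl1 : Tendsto (fun n => ∫ x, F n x * Real.log (F n x) ∂(stdGaussian E)) atTop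
      (𝓝 (∫ x, f x ^ 2 * Real.log (f x ^ 2) ∂(stdGaussian E))) :=
    tendsto_integral_of_dominated_convergence (fun _ => D)
      (fun n => (Real.continuous_mul_log.comp (hFc n)).aestronglyMeasurable) (integrable_const _)
      (fun n => Eventually.of_forall fun x => hD _ (hFmem n x))
      (Eventually.of_forall fun x => (Real.continuous_mul_log.tendsto _).comp (hFlim x))
  have hl2 : Tendsto (fun n => ∫ x, F n x ∂(stdGaussian E)) atTop
      (𝓝 (∫ x, f x ^ 2 ∂(stdGaussian E))) :=
    tendsto_integral_of_dominated_convergence (fun _ => (B + K) ^ 2 + 1)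
      (fun n => (hFc n).aestronglyMeasurable) (integrable_const _)
      (fun n => Eventually.of_forall fun x => by
        rw [Real.norm_of_nonneg (hFmem n x).1]; exact (hFmem n x).2)
      (Eventually.of_forall hFlim)
  -- the bound for the squared derivative of the mollification; it converges almost everywhere
  set G : ℕ → E → ℝ := fun n => convolution ((φ n).normed volume) (fun z => ‖fderiv ℝ f z‖ ^ 2)
        (ContinuousLinearMap.lsmul ℝ ℝ) volume with hG
  have hmsq : Measurable fun z => ‖fderiv ℝ f z‖ ^ 2 := hm.norm.pow_const 2
  have hsqb : ∀ z, ‖‖fderiv ℝ f z‖ ^ 2‖ ≤ (K : ℝ) ^ 2 := fun z => by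
    rw [norm_pow, norm_norm]
    exact pow_le_pow_left₀ (norm_nonneg _) (hfd z) 2
  have hloc : LocallyIntegrable (fun z => ‖fderiv ℝ f z‖ ^ 2) (volume : Measure E) :=
    ((continuous_const (y := (K : ℝ) ^ 2)).locallyIntegrable (μ := (volume : Measure E))).mono
      hmsq.aestronglyMeasurable (Eventually.of_forall fun z => (hsqb z).trans (le_abs_self _))
  have hGc : ∀ n, Continuous (G n) := fun n =>
    (φ n).hasCompactSupport_normed.continuous_convolution_left _ (φ n).continuous_normed hloc
  have hGb : ∀ n x, ‖G n x‖ ≤ (K : ℝ) ^ 2 := fun n x => by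
    have h1 : ∫ t, (φ n).normed volume t * (K : ℝ) ^ 2 = (K : ℝ) ^ 2 := by
      rw [integral_mul_const, (φ n).integral_normed, one_mul]
    rw [← h1]
    refine norm_integral_le_of_norm_le ((φ n).integrable_normed.mul_const _)
      (Eventually.of_forall fun t => ?_)
    rw [ContinuousLinearMap.lsmul_apply, norm_smul,
      Real.norm_of_nonneg ((φ n).nonneg_normed t)]
    exact mul_le_mul_of_nonneg_left (hsqb _) ((φ n).nonneg_normed t)
  have hGlim : ∀ᵐ x ∂(stdGaussian E), Tendsto (fun n => G n x) atTop (𝓝 (‖fderiv ℝ f x‖ ^ 2)) := by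
    refine stdGaussian_absolutelyContinuous.ae_le ?_
    refine ContDiffBump.ae_convolution_tendsto_right_of_locallyIntegrable (K := 2) hulim
      (Eventually.of_forall fun n => ?_) hloc
    simp only [hφ]
    linarith
  have hl3 : Tendsto (fun n => ∫ x, G n x ∂(stdGaussian E)) atTop
      (𝓝 (∫ x, ‖fderiv ℝ f x‖ ^ 2 ∂(stdGaussian E))) :=
    tendsto_integral_of_dominated_convergence (fun _ => (K : ℝ) ^ 2)
      (fun n => (hGc n).aestronglyMeasurable) (integrable_const _)
      (fun n => Eventually.of_forall (hGb n)) hGlim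
  refine le_of_tendsto_of_tendsto' (hl1.sub ((Real.continuous_mul_log.tendsto _).comp hl2))
    (hl3.const_mul 2) fun n => ?_
  refine (entropy_sq_add_stdGaussian_le K.2 (hg n) (hgB n) (hg' n) (hgM n) (hu0 n) (hu1 n)).trans ?_
  refine mul_le_mul_of_nonneg_left ?_ zero_le_two
  refine integral_mono_of_nonneg (Eventually.of_forall fun x => sq_nonneg _)
    (integrable_of_continuous_bounded (hGc n) (hGb n)) (Eventually.of_forall (hgsq n))

end GaussianLogSobolev

/-! ### Contractive kernels and the gradient of their Markov operator -/

section ContractiveKernel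

/-- A Markov kernel `κ` given by a random map `z ↦ T z w`, with noise `w` of law `ν`, that is a
`ρ`-contraction for every value of the noise, and whose transition laws satisfy a log-Sobolev
inequality with constant `C`. -/
structure IsContractiveKernel {S W : Type*} [PseudoMetricSpace S] [MeasurableSpace S]
    [MeasurableSpace W] (κ : Kernel S S) (ν : Measure W) (T : S → W → S) (ρ C : ℝ) : Prop where
  measurable : ∀ z, Measurable (T z)
  apply_eq_map : ∀ z, κ z = ν.map (T z)
  nonneg : 0 ≤ ρ
  lt_one : ρ < 1
  dist_le : ∀ w z z', dist (T z w) (T z' w) ≤ ρ * dist z z'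
  const_nonneg : 0 ≤ C
  logSobolev : ∀ z, LogSobolev (κ z) C

/-- The Markov operator `φ ↦ (z ↦ ∫ φ dκ(z, ·))` of a kernel. -/
noncomputable def markovOp {S : Type*} [MeasurableSpace S] (κ : Kernel S S) (φ : S → ℝ) (z : S) : ℝ :=
  ∫ y, φ y ∂(κ z)

/-- The operator `f ↦ √(P (f ^ 2))`, for `P` the Markov operator of `κ`. -/
noncomputable def sqOp {S : Type*} [MeasurableSpace S] (κ : Kernel S S) (f : S → ℝ) (z : S) : ℝ :=
  √(markovOp κ (fun y => f y ^ 2) z)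

theorem sq_sqOp {S : Type*} [MeasurableSpace S] (κ : Kernel S S) (f : S → ℝ) (z : S) :
    sqOp κ f z ^ 2 = markovOp κ (fun y => f y ^ 2) z :=
  Real.sq_sqrt (integral_nonneg fun _ => sq_nonneg _)

/-- The triangle inequality in `L²`, for bounded functions. -/
theorem abs_sqrt_integral_sub_le {α : Type*} [MeasurableSpace α] {ν : Measure α}
    [IsFiniteMeasure ν] {X Y : α → ℝ} (hX : AEStronglyMeasurable X ν)
    (hY : AEStronglyMeasurable Y ν) {B : ℝ} (hXB : ∀ a, |X a| ≤ B) (hYB : ∀ a, |Y a| ≤ B) :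
    |√(∫ a, X a ^ 2 ∂ν) - √(∫ a, Y a ^ 2 ∂ν)| ≤ √(∫ a, (X a - Y a) ^ 2 ∂ν) := by
  have hsq : ∀ {Z : α → ℝ}, (∀ a, |Z a| ≤ B) → ∀ a, ‖Z a ^ 2‖ ≤ B ^ 2 := fun hZ a => by
    rw [norm_pow]
    exact pow_le_pow_left₀ (norm_nonneg _) (hZ a) 2
  have hXi : Integrable (fun a => X a ^ 2) ν :=
    Integrable.of_bound (hX.pow 2) (B ^ 2) (Eventually.of_forall (hsq hXB))
  have hYi : Integrable (fun a => Y a ^ 2) ν :=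
    Integrable.of_bound (hY.pow 2) (B ^ 2) (Eventually.of_forall (hsq hYB))
  have hXY : Integrable (fun a => X a * Y a) ν :=
    Integrable.of_bound (hX.mul hY) (B * B) (Eventually.of_forall fun a => by
      rw [norm_mul]
      exact mul_le_mul (hXB a) (hYB a) (norm_nonneg _) ((abs_nonneg _).trans (hXB a)))
  have hquad : ∀ s t : ℝ, ∫ a, (s * X a - t * Y a) ^ 2 ∂ν
      = s ^ 2 * ∫ a, X a ^ 2 ∂ν - 2 * s * t * ∫ a, X a * Y a ∂ν + t ^ 2 * ∫ a, Y a ^ 2 ∂ν := by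
    intro s t
    have e : ∀ a, (s * X a - t * Y a) ^ 2
        = s ^ 2 * X a ^ 2 - 2 * s * t * (X a * Y a) + t ^ 2 * Y a ^ 2 := fun a => by ring
    have h1 : Integrable (fun a => s ^ 2 * X a ^ 2 - 2 * s * t * (X a * Y a)) ν :=
      (hXi.const_mul _).sub (hXY.const_mul _)
    simp only [e]
    rw [integral_add h1 (hYi.const_mul _), integral_sub (hXi.const_mul _) (hXY.const_mul _),
      integral_const_mul, integral_const_mul, integral_const_mul]
  have hA : 0 ≤ ∫ a, X a ^ 2 ∂ν := integral_nonneg fun _ => sq_nonneg _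
  have hB : 0 ≤ ∫ a, Y a ^ 2 ∂ν := integral_nonneg fun _ => sq_nonneg _
  have hCS : ∫ a, X a * Y a ∂ν ≤ √(∫ a, X a ^ 2 ∂ν) * √(∫ a, Y a ^ 2 ∂ν) := by
    have h1 : ∀ x : ℝ, 0 ≤ (∫ a, X a ^ 2 ∂ν) * (x * x) + (-2 * ∫ a, X a * Y a ∂ν) * x
        + ∫ a, Y a ^ 2 ∂ν := fun x => by
      have h2 : 0 ≤ ∫ a, (x * X a - 1 * Y a) ^ 2 ∂ν := integral_nonneg fun _ => sq_nonneg _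
      rw [hquad] at h2
      linarith
    have h3 := discrim_le_zero h1
    rw [discrim] at h3
    rw [← Real.sqrt_mul hA]
    exact Real.le_sqrt_of_sq_le (by linarith)
  have e := hquad 1 1
  simp only [one_mul] at e
  refine Real.le_sqrt_of_sq_le ?_
  rw [sq_abs, e, sub_sq, Real.sq_sqrt hA, Real.sq_sqrt hB]
  linarith

variable {S W : Type*} [PseudoMetricSpace S] [MeasurableSpace S] [MeasurableSpace W]
  {κ : Kernel S S} {ν : Measure W} {T : S → W → S} {ρ C : ℝ}

namespace IsContractiveKernel

theorem markovOp_eq (h : IsContractiveKernel κ ν T ρ C) {φ : S → ℝ} (hφ : Measurable φ) (z : S) :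
    markovOp κ φ z = ∫ w, φ (T z w) ∂ν := by
  rw [markovOp, h.apply_eq_map, integral_map (h.measurable z).aemeasurable hφ.aestronglyMeasurable]

theorem toNNReal_lt_one (h : IsContractiveKernel κ ν T ρ C) : ρ.toNNReal < 1 := by
  rw [Real.toNNReal_lt_one]
  exact h.lt_one

variable [BorelSpace S]

theorem lipschitz_sqOp [IsProbabilityMeasure ν] (h : IsContractiveKernel κ ν T ρ C)
    {f : S → ℝ} {K : ℝ≥0} (hf : LipschitzWith K f) {B : ℝ} (hB : ∀ z, |f z| ≤ B) :
    LipschitzWith (ρ.toNNReal * K) (sqOp κ f) := by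
  have hm : Measurable f := hf.continuous.measurable
  refine LipschitzWith.of_dist_le_mul fun z z' => ?_
  simp only [sqOp, h.markovOp_eq (hm.pow_const 2)]
  refine (abs_sqrt_integral_sub_le (hm.comp (h.measurable z)).aestronglyMeasurable
    (hm.comp (h.measurable z')).aestronglyMeasurable (fun w => hB _) fun w => hB _).trans ?_
  rw [NNReal.coe_mul, Real.coe_toNNReal _ h.nonneg]
  have h0 := h.nonneg
  refine Real.sqrt_le_iff.2 ⟨by positivity, ?_⟩
  have hb : ∀ w, ‖(f (T z w) - f (T z' w)) ^ 2‖ ≤ (ρ * K * dist z z') ^ 2 := fun w => by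
    rw [norm_pow]
    refine pow_le_pow_left₀ (norm_nonneg _) ?_ 2
    have h1 := hf.dist_le_mul (T z w) (T z' w)
    rw [Real.dist_eq] at h1
    refine h1.trans ((mul_le_mul_of_nonneg_left (h.dist_le w z z') K.coe_nonneg).trans (le_of_eq ?_))
    ring
  refine (le_abs_self _).trans
    ((norm_integral_le_of_norm_le_const (Eventually.of_forall hb)).trans (by simp))

/-- Commutation of gradient and Markov operator: the slopes of `z ↦ √(∫ f (T z w) ^ 2 dν)` are
bounded by the `L²(ν)` norm of the slopes of `z ↦ f (T z w)`, pathwise. -/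
theorem gradLength_sqOp_le [IsProbabilityMeasure ν] (h : IsContractiveKernel κ ν T ρ C)
    {f : S → ℝ} {K : ℝ≥0} (hf : LipschitzWith K f) {B : ℝ} (hB : ∀ z, |f z| ≤ B) (z : S) :
    gradLength (sqOp κ f) z ^ 2
      ≤ ρ ^ 2 * markovOp κ (fun y => gradLength f y ^ 2) z := by
  have hm : Measurable f := hf.continuous.measurable
  have hgm := measurable_gradLength hf
  set g := sqOp κ f with hg
  have hlip := h.lipschitz_sqOp hf hB
  have h0 := h.nonneg
  rw [h.markovOp_eq (hgm.pow_const 2), ← integral_const_mul]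
  set I := ∫ w, ρ ^ 2 * gradLength f (T z w) ^ 2 ∂ν with hI
  have hI0 : 0 ≤ I := integral_nonneg fun w => by positivity
  suffices hs : gradLength g z ≤ √I by
    calc gradLength g z ^ 2 ≤ √I ^ 2 := pow_le_pow_left₀ (gradLength_nonneg hlip z) hs 2
      _ = I := Real.sq_sqrt hI0
  refine le_of_forall_lt fun c hc => ?_
  rcases lt_or_ge c 0 with hneg | hc0
  · exact hneg.trans_le (Real.sqrt_nonneg _)
  obtain ⟨c', hcc', hc'⟩ := exists_between hc
  refine hcc'.trans_le ?_
  have hc'0 : 0 ≤ c' := hc0.trans hcc'.le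
  have hcob : IsCoboundedUnder (· ≤ ·) (𝓝[≠] z) (fun y => |g y - g z| / dist y z) := by
    rcases eq_or_neBot (𝓝[≠] z) with hb | hb
    · exfalso
      have : gradLength g z = 0 := by
        rw [gradLength, hb, limsup_eq]
        simp
      linarith
    · exact isCoboundedUnder_le_of_le _ (x := 0) fun y => by positivity
  have hfreq : ∃ᶠ y in 𝓝[≠] z, c' < |g y - g z| / dist y z :=
    frequently_lt_of_lt_limsup hcob hc'
  obtain ⟨y, hy, hyc⟩ := exists_seq_forall_of_frequently hfreq
  have hyz : Tendsto y atTop (𝓝 z) := hy.mono_right nhdsWithin_le_nhds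
  set q : ℕ → W → ℝ := fun n w => ((f (T (y n) w) - f (T z w)) / dist (y n) z) ^ 2 with hq
  -- the slopes `q n` are only asymptotically below their bound; the maxima `r n` converge to it
  set r : ℕ → W → ℝ := fun n w => max (q n w) (ρ ^ 2 * gradLength f (T z w) ^ 2) with hr
  have hqe : ∀ n w, q n w = (|f (T (y n) w) - f (T z w)| / dist (y n) z) ^ 2 := fun n w => by
    simp only [hq, div_pow, sq_abs]
  have hqm : ∀ n, Measurable (q n) := fun n =>
    (((hm.comp (h.measurable _)).sub (hm.comp (h.measurable _))).div_const _).pow_const 2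
  have hgm' : Measurable fun w => ρ ^ 2 * gradLength f (T z w) ^ 2 :=
    ((hgm.comp (h.measurable z)).pow_const 2).const_mul _
  have hqb : ∀ n w, q n w ≤ (ρ * K) ^ 2 := fun n w => by
    rw [hqe]
    refine pow_le_pow_left₀ (by positivity) (div_le_of_le_mul₀ dist_nonneg (by positivity) ?_) 2
    have h1 := hf.dist_le_mul (T (y n) w) (T z w)
    rw [Real.dist_eq] at h1
    refine h1.trans ((mul_le_mul_of_nonneg_left (h.dist_le w _ _) K.coe_nonneg).trans (le_of_eq ?_))
    ring
  have hgb : ∀ w, ρ ^ 2 * gradLength f (T z w) ^ 2 ≤ (ρ * K) ^ 2 := fun w => by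
    rw [← mul_pow]
    refine pow_le_pow_left₀ (mul_nonneg h0 (gradLength_nonneg hf _)) ?_ 2
    exact mul_le_mul_of_nonneg_left (gradLength_le hf _) h0
  have hrb : ∀ n w, ‖r n w‖ ≤ (ρ * K) ^ 2 := fun n w => by
    rw [Real.norm_of_nonneg (le_max_of_le_right (by positivity))]
    exact max_le (hqb n w) (hgb w)
  have hrlim : ∀ w, Tendsto (fun n => r n w) atTop (𝓝 (ρ ^ 2 * gradLength f (T z w) ^ 2)) := by
    intro w
    refine tendsto_order.2 ⟨fun a ha => Eventually.of_forall fun n => lt_max_of_lt_right ha,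
      fun a ha => ?_⟩
    have hgl := gradLength_nonneg hf (T z w)
    have hcont : Tendsto (fun ε : ℝ => ρ ^ 2 * (gradLength f (T z w) + ε) ^ 2) (𝓝[>] 0)
        (𝓝 (ρ ^ 2 * gradLength f (T z w) ^ 2)) := by
      have : Continuous fun ε : ℝ => ρ ^ 2 * (gradLength f (T z w) + ε) ^ 2 := by fun_prop
      simpa using (this.tendsto 0).mono_left nhdsWithin_le_nhds
    obtain ⟨ε, hεa, hε⟩ := ((hcont.eventually_lt_const ha).and self_mem_nhdsWithin).exists
    have hε0 : 0 < ε := hε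
    have hT : Tendsto (fun n => T (y n) w) atTop (𝓝 (T z w)) := by
      rw [tendsto_iff_dist_tendsto_zero] at hyz ⊢
      refine squeeze_zero (fun n => dist_nonneg) (fun n => h.dist_le w _ _) ?_
      simpa using hyz.const_mul ρ
    filter_upwards [hT.eventually (eventually_abs_sub_le_gradLength hf (T z w) hε0)] with n hn
    refine max_lt (lt_of_le_of_lt ?_ hεa) ha
    rw [hqe, ← mul_pow]
    refine pow_le_pow_left₀ (by positivity) (div_le_of_le_mul₀ dist_nonneg (by positivity) ?_) 2
    refine hn.trans ((mul_le_mul_of_nonneg_left (h.dist_le w _ _) (by positivity)).trans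
      (le_of_eq ?_))
    ring
  have hlim : Tendsto (fun n => ∫ w, r n w ∂ν) atTop (𝓝 I) :=
    tendsto_integral_of_dominated_convergence (fun _ => (ρ * K) ^ 2)
      (fun n => ((hqm n).max hgm').aestronglyMeasurable) (integrable_const _)
      (fun n => Eventually.of_forall (hrb n)) (Eventually.of_forall hrlim)
  refine Real.le_sqrt_of_sq_le (ge_of_tendsto' hlim fun n => ?_)
  have hqi : Integrable (q n) ν := Integrable.of_bound (hqm n).aestronglyMeasurable ((ρ * K) ^ 2)
    (Eventually.of_forall fun w => by rw [Real.norm_of_nonneg (sq_nonneg _)]; exact hqb n w)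
  have hri : Integrable (r n) ν := Integrable.of_bound ((hqm n).max hgm').aestronglyMeasurable
    ((ρ * K) ^ 2) (Eventually.of_forall (hrb n))
  refine le_trans ?_ (integral_mono hqi hri fun w => le_max_left _ _)
  have hD : |g (y n) - g z| ≤ √(∫ w, (f (T (y n) w) - f (T z w)) ^ 2 ∂ν) := by
    simp only [hg, sqOp, h.markovOp_eq (hm.pow_const 2)]
    exact abs_sqrt_integral_sub_le (hm.comp (h.measurable _)).aestronglyMeasurable
      (hm.comp (h.measurable _)).aestronglyMeasurable (fun w => hB _) fun w => hB _
  have hD2 : |g (y n) - g z| ^ 2 ≤ ∫ w, (f (T (y n) w) - f (T z w)) ^ 2 ∂ν := by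
    calc _ ≤ √(∫ w, (f (T (y n) w) - f (T z w)) ^ 2 ∂ν) ^ 2 :=
          pow_le_pow_left₀ (abs_nonneg _) hD 2
      _ = _ := Real.sq_sqrt (integral_nonneg fun _ => sq_nonneg _)
  calc c' ^ 2 ≤ (|g (y n) - g z| / dist (y n) z) ^ 2 := pow_le_pow_left₀ hc'0 (hyc n).le 2
    _ = |g (y n) - g z| ^ 2 / dist (y n) z ^ 2 := div_pow _ _ _
    _ ≤ (∫ w, (f (T (y n) w) - f (T z w)) ^ 2 ∂ν) / dist (y n) z ^ 2 := by gcongr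
    _ = ∫ w, q n w ∂ν := by
      rw [← integral_div]
      exact integral_congr_ae (Eventually.of_forall fun w => by simp only [hq, div_pow])

end IsContractiveKernel

end ContractiveKernel

/-! ### Bounds for the Markov operator -/

section MarkovOp

variable {S : Type*} [MeasurableSpace S] {κ : Kernel S S}

theorem integral_bind_kernel {μ : Measure S} {f : S → ℝ} (hf : Integrable f (μ.bind κ)) :
    ∫ x, f x ∂(μ.bind κ) = ∫ x, markovOp κ f x ∂μ := by
  rw [Measure.comp_eq_comp_const_apply] at hf ⊢
  rw [Kernel.integral_comp hf, Kernel.const_apply]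
  rfl

theorem integrable_markovOp {μ : Measure S} {f : S → ℝ} (hf : Integrable f (μ.bind κ)) :
    Integrable (markovOp κ f) μ := by
  rw [Measure.comp_eq_comp_const_apply] at hf
  have := hf.integral_comp
  rwa [Kernel.const_apply] at this

theorem abs_markovOp_le [IsMarkovKernel κ] {f : S → ℝ} {B : ℝ} (hB : ∀ z, |f z| ≤ B) (z : S) :
    |markovOp κ f z| ≤ B := by
  simpa [markovOp] using norm_integral_le_of_norm_le_const (μ := κ z) (f := f) (Eventually.of_forall hB)

theorem abs_iterate_markovOp_le [IsMarkovKernel κ] {f : S → ℝ} {B : ℝ} (hB : ∀ z, |f z| ≤ B)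
    (n : ℕ) (z : S) : |(markovOp κ)^[n] f z| ≤ B := by
  induction n generalizing f with
  | zero => exact hB z
  | succ n ih =>
    rw [Function.iterate_succ, Function.comp_apply]
    exact ih fun z => abs_markovOp_le hB z

theorem abs_sqOp_le [IsMarkovKernel κ] {f : S → ℝ} {B : ℝ} (hB : ∀ z, |f z| ≤ B) (z : S) : |sqOp κ f z| ≤ B := by
  have hB0 : 0 ≤ B := (abs_nonneg _).trans (hB z)
  rw [sqOp, abs_of_nonneg (Real.sqrt_nonneg _)]
  refine Real.sqrt_le_iff.2 ⟨hB0, (le_abs_self _).trans (abs_markovOp_le (fun y => ?_) z)⟩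
  rw [abs_pow]
  exact pow_le_pow_left₀ (abs_nonneg _) (hB y) 2

end MarkovOp

theorem ext_of_lipschitz_bounded {S : Type*} [MetricSpace S] [MeasurableSpace S]
    [BorelSpace S] {μ μ' : Measure S} [IsProbabilityMeasure μ] [IsProbabilityMeasure μ']
    (h : ∀ (f : S → ℝ) (K : ℝ≥0) (B : ℝ), LipschitzWith K f → (∀ z, |f z| ≤ B) →
      ∫ z, f z ∂μ = ∫ z, f z ∂μ') : μ = μ' := by
  set M : ProbabilityMeasure S := ⟨μ, inferInstance⟩ with hM
  set M' : ProbabilityMeasure S := ⟨μ', inferInstance⟩ with hM'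
  have ht : Tendsto (fun _ : ℕ => M) atTop (𝓝 M') := by
    refine tendsto_iff_forall_lipschitz_integral_tendsto.2 fun f hf hL => ?_
    obtain ⟨C, hC⟩ := hf
    obtain ⟨L, hL⟩ := hL
    obtain ⟨z₀⟩ : Nonempty S := nonempty_of_isProbabilityMeasure μ
    have e : ∫ z, f z ∂μ = ∫ z, f z ∂μ' := h f L (|f z₀| + C) hL fun z => by
      have h1 := hC z z₀
      rw [Real.dist_eq] at h1
      have h2 := abs_sub_abs_le_abs_sub (f z) (f z₀)
      linarith
    have e' : ∫ z, f z ∂(M : Measure S) = ∫ z, f z ∂(M' : Measure S) := e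
    rw [e']
    exact tendsto_const_nhds
  have := tendsto_nhds_unique ht tendsto_const_nhds
  exact congrArg Subtype.val this.symm

/-! ### The log-Sobolev inequality for an invariant measure -/

section Invariant

variable {S W : Type*} [PseudoMetricSpace S] [MeasurableSpace S] [BorelSpace S] [MeasurableSpace W]
  {κ : Kernel S S} {ν : Measure W} {T : S → W → S} {ρ C : ℝ}

theorem integrable_of_lipschitz_of_bounded {f : S → ℝ} {K : ℝ≥0} (hf : LipschitzWith K f) {B : ℝ}
    (hB : ∀ z, |f z| ≤ B) (μ : Measure S) [IsFiniteMeasure μ] : Integrable f μ :=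
  Integrable.of_bound hf.continuous.measurable.aestronglyMeasurable B (Eventually.of_forall hB)

theorem exists_abs_sq_mul_log_le {S : Type*} {f : S → ℝ} {B : ℝ} (hB : ∀ z, |f z| ≤ B) :
    ∃ D, ∀ z, ‖f z ^ 2 * Real.log (f z ^ 2)‖ ≤ D := by
  obtain ⟨D, hD⟩ := (isCompact_Icc (a := 0) (b := B ^ 2)).exists_bound_of_continuousOn
    (Real.continuous_mul_log.continuousOn)
  exact ⟨D, fun z => hD _ ⟨sq_nonneg _,
    sq_le_sq' (neg_le_of_abs_le (hB z)) (le_of_abs_le (hB z))⟩⟩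

theorem integrable_sq_mul_log {f : S → ℝ} {K : ℝ≥0} (hf : LipschitzWith K f) {B : ℝ}
    (hB : ∀ z, |f z| ≤ B) (μ : Measure S) [IsFiniteMeasure μ] :
    Integrable (fun z => f z ^ 2 * Real.log (f z ^ 2)) μ := by
  obtain ⟨D, hD⟩ := exists_abs_sq_mul_log_le hB
  exact Integrable.of_bound
    (Real.continuous_mul_log.comp (hf.continuous.pow 2)).measurable.aestronglyMeasurable D
    (Eventually.of_forall hD)

namespace IsContractiveKernel

section Operator

variable [IsMarkovKernel κ]

theorem integrable_apply (h : IsContractiveKernel κ ν T ρ C) {φ : S → ℝ} {K : ℝ≥0}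
    (hφ : LipschitzWith K φ) (z : S) : Integrable φ (κ z) :=
  (h.logSobolev z).integrable_of_lipschitz h.const_nonneg hφ

theorem lipschitz_markovOp [IsProbabilityMeasure ν] (h : IsContractiveKernel κ ν T ρ C) {φ : S → ℝ}
    {K : ℝ≥0} (hφ : LipschitzWith K φ) : LipschitzWith (ρ.toNNReal * K) (markovOp κ φ) := by
  have hm : Measurable φ := hφ.continuous.measurable
  have hi : ∀ z, Integrable (fun w => φ (T z w)) ν := fun z => by
    have := h.integrable_apply hφ z
    rw [h.apply_eq_map] at this
    exact this.comp_measurable (h.measurable z)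
  refine LipschitzWith.of_dist_le_mul fun z z' => ?_
  rw [h.markovOp_eq hm, h.markovOp_eq hm, dist_eq_norm, ← integral_sub (hi z) (hi z'),
    NNReal.coe_mul, Real.coe_toNNReal _ h.nonneg]
  refine (norm_integral_le_of_norm_le_const (C := ρ * K * dist z z')
    (Eventually.of_forall fun w => ?_)).trans (by simp)
  rw [← dist_eq_norm]
  refine (hφ.dist_le_mul _ _).trans
    ((mul_le_mul_of_nonneg_left (h.dist_le w z z') K.coe_nonneg).trans (le_of_eq ?_))
  ring

theorem lipschitz_iterate_markovOp [IsProbabilityMeasure ν] (h : IsContractiveKernel κ ν T ρ C)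
    {φ : S → ℝ} {K : ℝ≥0} (hφ : LipschitzWith K φ) (n : ℕ) :
    LipschitzWith (ρ.toNNReal ^ n * K) ((markovOp κ)^[n] φ) := by
  induction n generalizing φ K with
  | zero => simpa using hφ
  | succ n ih =>
    rw [Function.iterate_succ, Function.comp_apply, pow_succ, mul_assoc]
    exact ih (h.lipschitz_markovOp hφ)

end Operator

section LogSobolev

variable [IsMarkovKernel κ] [IsProbabilityMeasure ν]

variable {π : Measure S} [IsProbabilityMeasure π]

/-- The entropy of `f ^ 2` lost in one step of a stationary chain. -/
theorem entropy_sub_sqOp_le (h : IsContractiveKernel κ ν T ρ C) (hπ : κ.Invariant π) {f : S → ℝ}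
    {K : ℝ≥0} (hf : LipschitzWith K f) {B : ℝ} (hB : ∀ z, |f z| ≤ B) :
    ∫ z, f z ^ 2 * Real.log (f z ^ 2) ∂π - ∫ z, sqOp κ f z ^ 2 * Real.log (sqOp κ f z ^ 2) ∂π
      ≤ C * ∫ z, gradLength f z ^ 2 ∂π := by
  have hi1 : Integrable (fun z => f z ^ 2 * Real.log (f z ^ 2)) (π.bind κ) := by
    rw [hπ.def]; exact integrable_sq_mul_log hf hB π
  have hi2 : Integrable (fun z => gradLength f z ^ 2) (π.bind κ) := by
    rw [hπ.def]; exact integrable_gradLength_sq hf π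
  have hi3 := integrable_sq_mul_log (h.lipschitz_sqOp hf hB) (abs_sqOp_le (κ := κ) hB) π
  have e1 := integral_bind_kernel hi1
  have e2 := integral_bind_kernel hi2
  rw [hπ.def] at e1 e2
  rw [e1, e2, ← integral_sub (integrable_markovOp hi1) hi3, ← integral_const_mul]
  refine integral_mono ((integrable_markovOp hi1).sub hi3) ((integrable_markovOp hi2).const_mul _)
    fun z => ?_
  have := h.logSobolev z f ⟨K, hf⟩ ⟨B, hB⟩
  simp only [sq_sqOp]
  exact this

omit [IsMarkovKernel κ] in
theorem integral_gradLength_sqOp_le (h : IsContractiveKernel κ ν T ρ C) (hπ : κ.Invariant π)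
    {f : S → ℝ} {K : ℝ≥0} (hf : LipschitzWith K f) {B : ℝ} (hB : ∀ z, |f z| ≤ B) :
    ∫ z, gradLength (sqOp κ f) z ^ 2 ∂π ≤ ρ ^ 2 * ∫ z, gradLength f z ^ 2 ∂π := by
  have hi2 : Integrable (fun z => gradLength f z ^ 2) (π.bind κ) := by
    rw [hπ.def]; exact integrable_gradLength_sq hf π
  have e2 := integral_bind_kernel hi2
  rw [hπ.def] at e2
  rw [e2, ← integral_const_mul]
  exact integral_mono (integrable_gradLength_sq (h.lipschitz_sqOp hf hB) π)
    ((integrable_markovOp hi2).const_mul _) fun z => h.gradLength_sqOp_le hf hB z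

theorem entropy_sub_iterate_sqOp_le (h : IsContractiveKernel κ ν T ρ C) (hπ : κ.Invariant π) {B : ℝ}
    (n : ℕ) {f : S → ℝ} {K : ℝ≥0} (hf : LipschitzWith K f) (hB : ∀ z, |f z| ≤ B) :
    ∫ z, f z ^ 2 * Real.log (f z ^ 2) ∂π
        - ∫ z, (sqOp κ)^[n] f z ^ 2 * Real.log ((sqOp κ)^[n] f z ^ 2) ∂π
      ≤ C / (1 - ρ ^ 2) * ∫ z, gradLength f z ^ 2 ∂π := by
  have hρ : 0 < 1 - ρ ^ 2 := by nlinarith [h.nonneg, h.lt_one]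
  have hI : ∀ f : S → ℝ, 0 ≤ ∫ z, gradLength f z ^ 2 ∂π := fun f =>
    integral_nonneg fun _ => sq_nonneg _
  have hC : 0 ≤ C / (1 - ρ ^ 2) := div_nonneg h.const_nonneg hρ.le
  induction n generalizing f K with
  | zero =>
    rw [Function.iterate_zero, id_eq, sub_self]
    exact mul_nonneg hC (hI f)
  | succ n ih =>
    have h1 := ih (h.lipschitz_sqOp hf hB) (abs_sqOp_le (κ := κ) hB)
    have h2 := h.entropy_sub_sqOp_le hπ hf hB
    have h3 := mul_le_mul_of_nonneg_left (h.integral_gradLength_sqOp_le hπ hf hB) hC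
    have e : C / (1 - ρ ^ 2) * (ρ ^ 2 * ∫ z, gradLength f z ^ 2 ∂π) + C * ∫ z, gradLength f z ^ 2 ∂π
        = C / (1 - ρ ^ 2) * ∫ z, gradLength f z ^ 2 ∂π := by
      field_simp
      ring
    rw [Function.iterate_succ, Function.comp_apply]
    linarith

theorem lipschitz_iterate_sqOp (h : IsContractiveKernel κ ν T ρ C) {B : ℝ}
    (n : ℕ) {f : S → ℝ} {K : ℝ≥0} (hf : LipschitzWith K f) (hB : ∀ z, |f z| ≤ B) :
    LipschitzWith (ρ.toNNReal ^ n * K) ((sqOp κ)^[n] f) ∧ ∀ z, |(sqOp κ)^[n] f z| ≤ B := by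
  induction n generalizing f K with
  | zero => simpa using ⟨hf, hB⟩
  | succ n ih =>
    rw [Function.iterate_succ, Function.comp_apply, pow_succ, mul_assoc]
    exact ih (h.lipschitz_sqOp hf hB) (abs_sqOp_le (κ := κ) hB)

theorem integral_iterate_sqOp_sq (h : IsContractiveKernel κ ν T ρ C) (hπ : κ.Invariant π) {B : ℝ}
    (n : ℕ) {f : S → ℝ} {K : ℝ≥0} (hf : LipschitzWith K f) (hB : ∀ z, |f z| ≤ B) :
    ∫ z, (sqOp κ)^[n] f z ^ 2 ∂π = ∫ z, f z ^ 2 ∂π := by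
  induction n generalizing f K with
  | zero => rfl
  | succ n ih =>
    rw [Function.iterate_succ, Function.comp_apply,
      ih (h.lipschitz_sqOp hf hB) (abs_sqOp_le (κ := κ) hB)]
    simp only [sq_sqOp]
    rw [← integral_bind_kernel, hπ.def]
    rw [hπ.def]
    exact Integrable.of_bound (hf.continuous.measurable.pow_const 2).aestronglyMeasurable (B ^ 2)
      (Eventually.of_forall fun z => by
        rw [norm_pow]
        exact pow_le_pow_left₀ (norm_nonneg _) (hB z) 2)

/-- The iterates flatten, since their Lipschitz constants tend to zero, and they keep the mean of their
square. -/
theorem tendsto_iterate_sqOp_sq (h : IsContractiveKernel κ ν T ρ C) (hπ : κ.Invariant π) {B : ℝ}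
    {f : S → ℝ} {K : ℝ≥0} (hf : LipschitzWith K f) (hB : ∀ z, |f z| ≤ B) (z : S) :
    Tendsto (fun n => (sqOp κ)^[n] f z ^ 2) atTop (𝓝 (∫ y, f y ^ 2 ∂π)) := by
  have hg := fun n => h.lipschitz_iterate_sqOp n hf hB
  have hB0 : 0 ≤ B := (abs_nonneg _).trans (hB z)
  have hsqB : ∀ n y, |(sqOp κ)^[n] f y ^ 2| ≤ B ^ 2 := fun n y => by
    rw [abs_pow]
    exact pow_le_pow_left₀ (abs_nonneg _) ((hg n).2 y) 2
  have hi : ∀ n, Integrable (fun y => (sqOp κ)^[n] f y ^ 2) π := fun n =>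
    Integrable.of_bound ((hg n).1.continuous.measurable.pow_const 2).aestronglyMeasurable (B ^ 2)
      (Eventually.of_forall (hsqB n))
  have hlim : Tendsto (fun n => ∫ y, ((sqOp κ)^[n] f z ^ 2 - (sqOp κ)^[n] f y ^ 2) ∂π) atTop
      (𝓝 (∫ _, 0 ∂π)) := by
    refine tendsto_integral_of_dominated_convergence (fun _ => B ^ 2 + B ^ 2)
      (fun n => ((integrable_const _).sub (hi n)).1) (integrable_const _)
      (fun n => Eventually.of_forall fun y => ?_) (Eventually.of_forall fun y => ?_)
    · exact (abs_sub _ _).trans (add_le_add (hsqB n z) (hsqB n y))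
    · have hz : Tendsto (fun n => ρ.toNNReal ^ n * (K * dist z y * (2 * B)) : ℕ → ℝ) atTop (𝓝 0) := by
        simpa using (tendsto_pow_atTop_nhds_zero_of_lt_one (ρ.toNNReal).coe_nonneg
          (by exact_mod_cast h.toNNReal_lt_one)).mul_const (K * dist z y * (2 * B))
      refine squeeze_zero_norm (fun n => ?_) hz
      have h1 := (hg n).1.dist_le_mul z y
      rw [Real.dist_eq] at h1
      push_cast at h1
      have h2 : |(sqOp κ)^[n] f z + (sqOp κ)^[n] f y| ≤ 2 * B :=
        (abs_add_le _ _).trans (by linarith [(hg n).2 z, (hg n).2 y])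
      rw [sq_sub_sq, norm_mul, mul_comm, Real.norm_eq_abs, Real.norm_eq_abs]
      calc _ ≤ (ρ.toNNReal ^ n * K * dist z y) * (2 * B) :=
            mul_le_mul h1 h2 (abs_nonneg _) (by positivity)
        _ = _ := by ring
  have e : ∀ n, ∫ y, ((sqOp κ)^[n] f z ^ 2 - (sqOp κ)^[n] f y ^ 2) ∂π
      = (sqOp κ)^[n] f z ^ 2 - ∫ y, f y ^ 2 ∂π := fun n => by
    rw [integral_sub (integrable_const _) (hi n), h.integral_iterate_sqOp_sq hπ n hf hB]
    simp
  simp only [e, integral_zero] at hlim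
  exact tendsto_sub_nhds_zero_iff.1 hlim

/-- The invariant measure of a contractive kernel inherits a log-Sobolev inequality: each step loses
at most `C ∫ |∇ f| ^ 2` of entropy, and the gradient contracts by the factor `ρ` at each step. -/
theorem logSobolev_of_invariant (h : IsContractiveKernel κ ν T ρ C) (hπ : κ.Invariant π) :
    LogSobolev π (C / (1 - ρ ^ 2)) := by
  rintro f ⟨K, hf⟩ ⟨B, hB⟩
  obtain ⟨D, hD⟩ := (isCompact_Icc (a := 0) (b := B ^ 2)).exists_bound_of_continuousOn
    (Real.continuous_mul_log.continuousOn)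
  have hg := fun n => h.lipschitz_iterate_sqOp n hf hB
  have hlim : Tendsto (fun n => ∫ z, (sqOp κ)^[n] f z ^ 2 * Real.log ((sqOp κ)^[n] f z ^ 2) ∂π)
      atTop (𝓝 (∫ _, (∫ y, f y ^ 2 ∂π) * Real.log (∫ y, f y ^ 2 ∂π) ∂π)) := by
    refine tendsto_integral_of_dominated_convergence (fun _ => D)
      (fun n => (integrable_sq_mul_log (hg n).1 (hg n).2 π).1) (integrable_const _)
      (fun n => Eventually.of_forall fun z => hD _ ⟨sq_nonneg _, ?_⟩)
      (Eventually.of_forall fun z => (Real.continuous_mul_log.tendsto _).comp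
        (h.tendsto_iterate_sqOp_sq hπ hf hB z))
    exact sq_le_sq' (neg_le_of_abs_le ((hg n).2 z)) (le_of_abs_le ((hg n).2 z))
  simp only [integral_const, probReal_univ, smul_eq_mul, one_mul] at hlim
  exact le_of_tendsto (tendsto_const_nhds.sub hlim)
    (Eventually.of_forall fun n => h.entropy_sub_iterate_sqOp_le hπ n hf hB)

end LogSobolev

section ExistsUnique

variable [IsMarkovKernel κ] [IsProbabilityMeasure ν]

theorem integral_iterate_markovOp_of_invariant (h : IsContractiveKernel κ ν T ρ C) {π : Measure S}
    [IsProbabilityMeasure π] (hπ : κ.Invariant π) (n : ℕ) {f : S → ℝ} {K : ℝ≥0}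
    (hf : LipschitzWith K f) (hi : Integrable f π) :
    Integrable ((markovOp κ)^[n] f) π ∧ ∫ z, (markovOp κ)^[n] f z ∂π = ∫ z, f z ∂π := by
  induction n generalizing f K with
  | zero => exact ⟨hi, rfl⟩
  | succ n ih =>
    have hi' : Integrable f (π.bind κ) := by rwa [hπ.def]
    have e := integral_bind_kernel hi'
    rw [hπ.def] at e
    rw [Function.iterate_succ, Function.comp_apply, e]
    exact ih (h.lipschitz_markovOp hf) (integrable_markovOp hi')

end ExistsUnique

end IsContractiveKernel

end Invariant

/-! ### Existence and uniqueness of the invariant measure -/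

section ExistsUnique

variable {S W : Type*} [MetricSpace S] [MeasurableSpace S] [BorelSpace S]
  [MeasurableSpace W] {κ : Kernel S S} {ν : Measure W} {T : S → W → S} {ρ C : ℝ}
  [IsMarkovKernel κ] [IsProbabilityMeasure ν]

namespace IsContractiveKernel

/-- The iterates of the Markov operator flatten every bounded Lipschitz function, while its means under
both invariant measures are preserved. -/
theorem invariant_unique [SecondCountableTopology S] (h : IsContractiveKernel κ ν T ρ C)
    {π π' : Measure S} [IsProbabilityMeasure π] [IsProbabilityMeasure π'] (hπ : κ.Invariant π)
    (hπ' : κ.Invariant π') : π = π' := by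
  refine ext_of_lipschitz_bounded fun f K B hf hB => ?_
  have hg := fun n => h.lipschitz_iterate_markovOp hf n
  have hgB := fun n z => abs_iterate_markovOp_le (κ := κ) hB n z
  have hi := integrable_of_lipschitz_of_bounded hf hB π
  have hi' := integrable_of_lipschitz_of_bounded hf hB π'
  have hm := fun n => (hg n).continuous.measurable
  have hlim : Tendsto (fun n => ∫ p, ((markovOp κ)^[n] f p.1 - (markovOp κ)^[n] f p.2) ∂(π.prod π'))
      atTop (𝓝 (∫ _, 0 ∂(π.prod π'))) := by
    refine tendsto_integral_of_dominated_convergence (fun _ => B + B)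
      (fun n => (((hm n).comp measurable_fst).sub ((hm n).comp measurable_snd)).aestronglyMeasurable)
      (integrable_const _) (fun n => Eventually.of_forall fun p => ?_)
      (Eventually.of_forall fun p => ?_)
    · exact (abs_sub _ _).trans (add_le_add (hgB n _) (hgB n _))
    · have hz : Tendsto (fun n => ρ.toNNReal ^ n * (K * dist p.1 p.2) : ℕ → ℝ) atTop (𝓝 0) := by
        simpa using (tendsto_pow_atTop_nhds_zero_of_lt_one (ρ.toNNReal).coe_nonneg
          (by exact_mod_cast h.toNNReal_lt_one)).mul_const (K * dist p.1 p.2)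
      refine squeeze_zero_norm (fun n => ?_) hz
      have h1 := (hg n).dist_le_mul p.1 p.2
      rw [dist_eq_norm] at h1
      push_cast at h1
      rwa [← mul_assoc]
  have e : ∀ n, ∫ p, ((markovOp κ)^[n] f p.1 - (markovOp κ)^[n] f p.2) ∂(π.prod π')
      = ∫ z, f z ∂π - ∫ z, f z ∂π' := fun n => by
    have h1 := h.integral_iterate_markovOp_of_invariant hπ n hf hi
    have h2 := h.integral_iterate_markovOp_of_invariant hπ' n hf hi'
    rw [integral_sub (h1.1.comp_fst π') (h2.1.comp_snd π), ← h1.2, ← h2.2]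
    congr 1
    · rw [integral_fun_fst]; simp
    · rw [integral_fun_snd]; simp
  simp only [e, integral_zero] at hlim
  exact sub_eq_zero.1 (tendsto_nhds_unique tendsto_const_nhds hlim)

/-- Existence of an invariant probability measure: the laws of the chain started from a point are
tight, and any weak cluster point is invariant since consecutive laws merge. -/
theorem exists_invariant [ProperSpace S] [Nonempty S] (h : IsContractiveKernel κ ν T ρ C) :
    ∃ π : Measure S, IsProbabilityMeasure π ∧ κ.Invariant π := by
  obtain ⟨z₀⟩ := ‹Nonempty S›
  set μ : ℕ → Measure S := fun n => (fun m : Measure S => m.bind κ)^[n] (Measure.dirac z₀) with hμ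
  have hμs : ∀ n, μ (n + 1) = (μ n).bind κ := fun n => by
    simp only [hμ, Function.iterate_succ_apply']
  have hprob : ∀ n, IsProbabilityMeasure (μ n) := fun n => by
    induction n with
    | zero => exact Measure.dirac.isProbabilityMeasure
    | succ n ih => rw [hμs]; infer_instance
  -- first moments along the chain
  have hdist : LipschitzWith 1 fun z => dist z z₀ := LipschitzWith.dist_left z₀
  set m₁ := ∫ y, dist y z₀ ∂(κ z₀) with hm₁
  have hm₁0 : 0 ≤ m₁ := integral_nonneg fun _ => dist_nonneg
  have hρ : 0 < 1 - ρ := by linarith [h.lt_one]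
  have hPd : ∀ z, markovOp κ (fun z => dist z z₀) z ≤ ρ * dist z z₀ + m₁ := fun z => by
    have h1 := (h.lipschitz_markovOp hdist).dist_le_mul z z₀
    rw [Real.dist_eq, NNReal.coe_mul, Real.coe_toNNReal _ h.nonneg, NNReal.coe_one, mul_one] at h1
    have h2 := (le_abs_self _).trans h1
    have h3 : markovOp κ (fun z => dist z z₀) z₀ = m₁ := rfl
    linarith
  have hmeasd : Measurable fun z => dist z z₀ := hdist.continuous.measurable
  have hmom : ∀ n, ∫⁻ z, ENNReal.ofReal (dist z z₀) ∂(μ n) ≤ ENNReal.ofReal (m₁ / (1 - ρ)) := by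
    intro n
    induction n with
    | zero => simp [hμ]
    | succ n ih =>
      rw [hμs, Measure.lintegral_bind κ.measurable.aemeasurable hmeasd.ennreal_ofReal.aemeasurable]
      calc ∫⁻ z, ∫⁻ y, ENNReal.ofReal (dist y z₀) ∂(κ z) ∂(μ n)
          = ∫⁻ z, ENNReal.ofReal (markovOp κ (fun y => dist y z₀) z) ∂(μ n) :=
            lintegral_congr fun z => (ofReal_integral_eq_lintegral_ofReal
              (h.integrable_apply hdist z) (Eventually.of_forall fun _ => dist_nonneg)).symm
        _ ≤ ∫⁻ z, (ENNReal.ofReal ρ * ENNReal.ofReal (dist z z₀) + ENNReal.ofReal m₁) ∂(μ n) :=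
            lintegral_mono fun z => by
              rw [← ENNReal.ofReal_mul h.nonneg,
                ← ENNReal.ofReal_add (mul_nonneg h.nonneg dist_nonneg) hm₁0]
              exact ENNReal.ofReal_le_ofReal (hPd z)
        _ = ENNReal.ofReal ρ * ∫⁻ z, ENNReal.ofReal (dist z z₀) ∂(μ n) + ENNReal.ofReal m₁ := by
            rw [lintegral_add_right _ measurable_const,
              lintegral_const_mul _ hmeasd.ennreal_ofReal]
            simp
        _ ≤ ENNReal.ofReal ρ * ENNReal.ofReal (m₁ / (1 - ρ)) + ENNReal.ofReal m₁ := by gcongr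
        _ = ENNReal.ofReal (m₁ / (1 - ρ)) := by
            rw [← ENNReal.ofReal_mul h.nonneg,
              ← ENNReal.ofReal_add (mul_nonneg h.nonneg (by positivity)) hm₁0]
            congr 1
            field_simp
            ring
  have htight : IsTightMeasureSet (Set.range μ) := by
    refine isTightMeasureSet_of_tendsto_measure_compl_closedBall (x := z₀) ?_
    have hlim : Tendsto (fun r : ℝ => ENNReal.ofReal (m₁ / (1 - ρ) / r)) atTop (𝓝 0) := by
      rw [← ENNReal.ofReal_zero]
      exact (ENNReal.continuous_ofReal.tendsto _).comp (tendsto_id.const_div_atTop _)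
    refine tendsto_of_tendsto_of_tendsto_of_le_of_le' tendsto_const_nhds hlim
      (Eventually.of_forall fun _ => bot_le) ?_
    filter_upwards [eventually_gt_atTop 0] with r hr
    refine iSup₂_le ?_
    rintro _ ⟨n, rfl⟩
    have h1 : μ n (Metric.closedBall z₀ r)ᶜ ≤ μ n {z | ENNReal.ofReal r ≤ ENNReal.ofReal (dist z z₀)} := by
      refine measure_mono fun z hz => ?_
      simp only [Set.mem_compl_iff, Metric.mem_closedBall, not_le] at hz
      exact ENNReal.ofReal_le_ofReal hz.le
    have h2 := meas_ge_le_lintegral_div (μ := μ n) hmeasd.ennreal_ofReal.aemeasurable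
      (ε := ENNReal.ofReal r) (by simpa using hr) ENNReal.ofReal_ne_top
    refine h1.trans (h2.trans ?_)
    rw [ENNReal.ofReal_div_of_pos hr]
    gcongr
    exact hmom n
  -- a limit of the laws along an ultrafilter finer than `atTop`
  set M : ℕ → ProbabilityMeasure S := fun n => ⟨μ n, hprob n⟩ with hM
  have hcomp : IsCompact (closure (Set.range M)) := by
    refine isCompact_closure_of_isTightMeasureSet (htight.subset ?_)
    rintro _ ⟨_, ⟨n, rfl⟩, rfl⟩
    exact ⟨n, rfl⟩
  obtain ⟨π, -, hπ⟩ := hcomp.ultrafilter_le_nhds' ((Ultrafilter.of (atTop : Filter ℕ)).map M)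
    (Ultrafilter.mem_map.2 (univ_mem' fun n => subset_closure ⟨n, rfl⟩))
  have hle : ((Ultrafilter.of (atTop : Filter ℕ) : Ultrafilter ℕ) : Filter ℕ) ≤ atTop :=
    Ultrafilter.of_le _
  set 𝒰 : Filter ℕ := ((Ultrafilter.of (atTop : Filter ℕ) : Ultrafilter ℕ) : Filter ℕ) with h𝒰
  have hconv : Tendsto M 𝒰 (𝓝 π) := hπ
  rw [ProbabilityMeasure.tendsto_iff_forall_integral_tendsto] at hconv
  have hconv' : ∀ (f : S → ℝ) (K : ℝ≥0) (B : ℝ), LipschitzWith K f → (∀ z, |f z| ≤ B) →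
      Tendsto (fun n => ∫ z, f z ∂(μ n)) 𝒰 (𝓝 (∫ z, f z ∂(π : Measure S))) := fun f K B hf hB =>
    hconv (BoundedContinuousFunction.ofNormedAddCommGroup f hf.continuous B hB)
  refine ⟨π, inferInstance, ?_⟩
  have : IsProbabilityMeasure ((π : Measure S).bind κ) := inferInstance
  refine ext_of_lipschitz_bounded fun f K B hf hB => ?_
  rw [integral_bind_kernel (integrable_of_lipschitz_of_bounded hf hB _)]
  have h1 := hconv' _ _ B (h.lipschitz_markovOp hf) (abs_markovOp_le hB)
  have h2 := hconv' _ _ B hf hB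
  have e1 : ∀ n, ∫ z, markovOp κ f z ∂(μ n) = ∫ z, f z ∂(μ (n + 1)) := fun n => by
    rw [hμs, integral_bind_kernel (integrable_of_lipschitz_of_bounded hf hB _)]
  have e2 : ∀ n {f : S → ℝ} {K : ℝ≥0}, LipschitzWith K f → (∀ z, |f z| ≤ B) →
      ∫ z, f z ∂(μ n) = (markovOp κ)^[n] f z₀ := fun n => by
    induction n with
    | zero =>
      intro f K hf _
      rw [Function.iterate_zero, id_eq]
      exact integral_dirac' _ _ hf.continuous.measurable.stronglyMeasurable
    | succ n ih =>
      intro f K hf hB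
      rw [hμs, integral_bind_kernel (integrable_of_lipschitz_of_bounded hf hB _),
        ih (h.lipschitz_markovOp hf) (abs_markovOp_le hB)]
      rfl
  -- `μ n` and `μ (n + 1)` merge: they are the laws after `n` steps from `z₀` and from `κ z₀`
  have h3 : Tendsto (fun n => ∫ z, markovOp κ f z ∂(μ n) - ∫ z, f z ∂(μ n)) atTop (𝓝 0) := by
    have hz : Tendsto (fun n => ρ.toNNReal ^ n * (K * m₁) : ℕ → ℝ) atTop (𝓝 0) := by
      simpa using (tendsto_pow_atTop_nhds_zero_of_lt_one (ρ.toNNReal).coe_nonneg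
        (by exact_mod_cast h.toNNReal_lt_one)).mul_const (K * m₁)
    refine squeeze_zero_norm (fun n => ?_) hz
    rw [e1, e2 _ hf hB, e2 _ hf hB, Function.iterate_succ_apply']
    have hn := h.lipschitz_iterate_markovOp hf n
    have e3 : markovOp κ ((markovOp κ)^[n] f) z₀ - (markovOp κ)^[n] f z₀
        = ∫ y, ((markovOp κ)^[n] f y - (markovOp κ)^[n] f z₀) ∂(κ z₀) := by
      rw [integral_sub (h.integrable_apply hn z₀) (integrable_const _)]
      simp [markovOp]
    rw [e3, ← mul_assoc, hm₁, ← integral_const_mul]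
    refine norm_integral_le_of_norm_le ((h.integrable_apply hdist z₀).const_mul _)
      (Eventually.of_forall fun y => ?_)
    have := hn.dist_le_mul y z₀
    rw [dist_eq_norm] at this
    exact_mod_cast this
  exact sub_eq_zero.1 (tendsto_nhds_unique (h1.sub h2) (h3.mono_left hle))

end IsContractiveKernel

end ExistsUnique

/-! ### The Markov property -/

section MarkovChain

variable {S Ω : Type*} [MeasurableSpace S] [MeasurableSpace Ω] {κ : Kernel S S}
  {μ₀ : Measure S} {Pr : Measure Ω} {Z : ℕ → Ω → S}

/-- The past of the process `Z` up to time `k`. -/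
abbrev pastSigma (Z : ℕ → Ω → S) (k : ℕ) : MeasurableSpace Ω :=
  ⨆ j ≤ k, MeasurableSpace.comap (Z j) inferInstance

omit [MeasurableSpace Ω] in
theorem measurable_pastSigma {j k : ℕ} (hjk : j ≤ k) : Measurable[pastSigma Z k] (Z j) := by
  refine Measurable.mono (comap_measurable (Z j)) ?_ le_rfl
  exact le_iSup₂_of_le j hjk le_rfl

namespace IsMarkovChain

theorem pastSigma_le (h : IsMarkovChain κ μ₀ Pr Z) (k : ℕ) : pastSigma Z k ≤ ‹MeasurableSpace Ω› :=
  iSup₂_le fun j _ => (h.measurable j).comap_le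

variable [IsMarkovKernel κ] [IsProbabilityMeasure Pr]

/-- The transition property holds for measures: restricted to an event of the past, the law of
`Z (k + 1)` is the image under `κ` of the law of `Z k`. -/
theorem map_restrict_succ (h : IsMarkovChain κ μ₀ Pr Z) (k : ℕ) {A : Set Ω}
    (hA : MeasurableSet[pastSigma Z k] A) :
    (Pr.restrict A).map (Z (k + 1)) = ((Pr.restrict A).map (Z k)).bind κ := by
  have hle := h.pastSigma_le k
  ext B hB
  have hZB : MeasurableSet (Z (k + 1) ⁻¹' B) := h.measurable (k + 1) hB
  have hκB : Measurable fun z => (κ z).real B := (κ.measurable_coe hB).ennreal_toReal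
  rw [Measure.map_apply (h.measurable _) hB, Measure.bind_apply hB κ.measurable.aemeasurable,
    lintegral_map (κ.measurable_coe hB) (h.measurable k)]
  have hint : Integrable ((Z (k + 1) ⁻¹' B).indicator fun _ => (1 : ℝ)) Pr :=
    (integrable_const 1).indicator hZB
  have h1 : ∫ ω in A, (κ (Z k ω)).real B ∂Pr
      = ∫ ω in A, (Z (k + 1) ⁻¹' B).indicator (fun _ => (1 : ℝ)) ω ∂Pr := by
    rw [← setIntegral_condExp hle hint hA]
    exact setIntegral_congr_ae (hle A hA) ((h.transition k B hB).symm.mono fun ω hω _ => hω)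
  rw [integral_indicator_const _ hZB, smul_eq_mul, mul_one] at h1
  have hbd : Integrable (fun ω => (κ (Z k ω)).real B) (Pr.restrict A) :=
    Integrable.of_bound (hκB.comp (h.measurable k)).aestronglyMeasurable 1
      (Eventually.of_forall fun ω => by
        rw [Real.norm_of_nonneg measureReal_nonneg]
        exact measureReal_le_one)
  have h2 := congrArg ENNReal.ofReal h1
  rw [ofReal_integral_eq_lintegral_ofReal hbd (Eventually.of_forall fun _ => measureReal_nonneg),
    ofReal_measureReal] at h2
  rw [← h2]
  exact lintegral_congr fun ω => ofReal_measureReal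

/-- The Markov property: the conditional expectation of `f (Z (k + 1))` given the past, tested
against a function `Y` of the past. -/
theorem lintegral_mul_succ (h : IsMarkovChain κ μ₀ Pr Z) (k : ℕ) {Y : Ω → ℝ≥0∞}
    (hY : Measurable[pastSigma Z k] Y) {f : S → ℝ≥0∞} (hf : Measurable f) :
    ∫⁻ ω, Y ω * f (Z (k + 1) ω) ∂Pr = ∫⁻ ω, Y ω * ∫⁻ y, f y ∂(κ (Z k ω)) ∂Pr := by
  have hle := h.pastSigma_le k
  have hg : Measurable fun z => ∫⁻ y, f y ∂(κ z) := hf.lintegral_kernel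
  have hf1 : Measurable fun ω => f (Z (k + 1) ω) := hf.comp (h.measurable _)
  have hg1 : Measurable fun ω => ∫⁻ y, f y ∂(κ (Z k ω)) := hg.comp (h.measurable _)
  have htrim : (Pr.withDensity fun ω => f (Z (k + 1) ω)).trim hle
      = (Pr.withDensity fun ω => ∫⁻ y, f y ∂(κ (Z k ω))).trim hle := by
    refine @Measure.ext _ (pastSigma Z k) _ _ fun A hA => ?_
    rw [trim_measurableSet_eq hle hA, trim_measurableSet_eq hle hA,
      withDensity_apply _ (hle A hA), withDensity_apply _ (hle A hA),
      ← lintegral_map hf (h.measurable (k + 1)), h.map_restrict_succ k hA,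
      Measure.lintegral_bind κ.measurable.aemeasurable hf.aemeasurable,
      lintegral_map hg (h.measurable k)]
  have hY' : Measurable Y := hY.mono hle le_rfl
  have h1 := lintegral_withDensity_eq_lintegral_mul Pr hf1 hY'
  have h2 := lintegral_withDensity_eq_lintegral_mul Pr hg1 hY'
  simp only [Pi.mul_apply] at h1 h2
  simp only [mul_comm (Y _)]
  rw [← h1, ← h2, ← lintegral_trim hle hY, htrim, lintegral_trim hle hY]

end IsMarkovChain

end MarkovChain

/-! ### The Wasserstein distance -/

section Wasserstein

variable {S : Type*} [PseudoMetricSpace S] [MeasurableSpace S] [BorelSpace S]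

/-- The easy half of the Kantorovich duality. -/
theorem integral_sub_le_wasserstein1 {μ π : Measure S} (hW : wasserstein1 μ π ≠ ⊤) {f : S → ℝ}
    {K : ℝ≥0} (hf : LipschitzWith K f) (hμ : Integrable f μ) (hπ : Integrable f π) :
    ∫ z, f z ∂μ - ∫ z, f z ∂π ≤ K * (wasserstein1 μ π).toReal := by
  have hm : Measurable f := hf.continuous.measurable
  have key : ∀ ε : ℝ, 0 < ε →
      ∫ z, f z ∂μ - ∫ z, f z ∂π ≤ K * ((wasserstein1 μ π).toReal + ε) := by
    intro ε hε
    have hlt : wasserstein1 μ π < ENNReal.ofReal ((wasserstein1 μ π).toReal + ε) := by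
      rw [ENNReal.lt_ofReal_iff_toReal_lt hW]
      linarith
    nth_rewrite 1 [wasserstein1] at hlt
    simp only [iInf_lt_iff] at hlt
    obtain ⟨ξ, ⟨h1, h2⟩, hξ⟩ := hlt
    have hi1 : Integrable (fun p : S × S => f p.1) ξ := by
      rw [← h1] at hμ
      exact hμ.comp_measurable measurable_fst
    have hi2 : Integrable (fun p : S × S => f p.2) ξ := by
      rw [← h2] at hπ
      exact hπ.comp_measurable measurable_snd
    rw [← h1, ← h2, integral_map measurable_fst.aemeasurable hm.aestronglyMeasurable,
      integral_map measurable_snd.aemeasurable hm.aestronglyMeasurable, ← integral_sub hi1 hi2]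
    have hc : 0 ≤ K * ((wasserstein1 (ξ.map Prod.fst) (ξ.map Prod.snd)).toReal + ε) := by positivity
    refine (le_abs_self _).trans ?_
    rw [← Real.norm_eq_abs, ← ENNReal.ofReal_le_ofReal_iff hc, ofReal_norm]
    refine (enorm_integral_le_lintegral_enorm _).trans ?_
    calc ∫⁻ p, ‖f p.1 - f p.2‖ₑ ∂ξ ≤ ∫⁻ p, K * edist p.1 p.2 ∂ξ := lintegral_mono fun p => by
          rw [← edist_eq_enorm_sub]
          exact hf p.1 p.2
      _ = K * ∫⁻ p, edist p.1 p.2 ∂ξ := lintegral_const_mul' _ _ ENNReal.coe_ne_top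
      _ ≤ K * ENNReal.ofReal ((wasserstein1 (ξ.map Prod.fst) (ξ.map Prod.snd)).toReal + ε) := by
          rw [h1, h2]
          gcongr
      _ = _ := by rw [ENNReal.ofReal_mul K.coe_nonneg, ENNReal.ofReal_coe_nnreal]
  have ht : Tendsto (fun ε : ℝ => K * ((wasserstein1 μ π).toReal + ε)) (𝓝[>] 0)
      (𝓝 (K * ((wasserstein1 μ π).toReal + 0))) :=
    ((continuous_const.mul (continuous_const.add continuous_id)).tendsto 0).mono_left
      nhdsWithin_le_nhds
  rw [add_zero] at ht
  exact ge_of_tendsto ht (by filter_upwards [self_mem_nhdsWithin] with ε hε using key ε hε)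

omit [BorelSpace S] in
/-- The product coupling has finite cost as soon as both measures have a first moment. -/
theorem wasserstein1_ne_top [SecondCountableTopology S] {μ π : Measure S} [IsProbabilityMeasure μ]
    [IsProbabilityMeasure π] (z₀ : S) (hμ : Integrable (fun z => dist z z₀) μ)
    (hπ : Integrable (fun z => dist z z₀) π) : wasserstein1 μ π ≠ ⊤ := by
  have hle : wasserstein1 μ π ≤ ∫⁻ p, edist p.1 p.2 ∂(μ.prod π) :=
    iInf₂_le (μ.prod π) ⟨by simp [Measure.map_fst_prod], by simp [Measure.map_snd_prod]⟩
  refine ne_top_of_le_ne_top ?_ hle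
  have hi : Integrable (fun p : S × S => dist p.1 z₀ + dist p.2 z₀) (μ.prod π) :=
    (hμ.comp_fst π).add (hπ.comp_snd μ)
  refine ne_top_of_le_ne_top hi.lintegral_lt_top.ne (lintegral_mono fun p => ?_)
  rw [edist_dist]
  exact ENNReal.ofReal_le_ofReal (dist_triangle_right _ _ _)

/-- A `K`-Lipschitz map increases `𝓦₁` at most by the factor `K`. -/
theorem wasserstein1_map_le {S' : Type*} [PseudoMetricSpace S'] [MeasurableSpace S'] [BorelSpace S']
    (μ π : Measure S) {K : ℝ≥0} {A : S → S'} (hA : LipschitzWith K A)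
    (hK : K ≠ 0) [SecondCountableTopology S'] :
    wasserstein1 (μ.map A) (π.map A) ≤ K * wasserstein1 μ π := by
  have hm : Measurable A := hA.continuous.measurable
  have hK' : (K : ℝ≥0∞) ≠ 0 := by simpa using hK
  rw [wasserstein1, wasserstein1]
  simp only [ENNReal.mul_iInf_of_ne hK' ENNReal.coe_ne_top]
  refine le_iInf₂ fun ξ hξ => ?_
  have hm2 : Measurable (Prod.map A A) := hm.prodMap hm
  have hc : (ξ.map (Prod.map A A)).map Prod.fst = μ.map A ∧
      (ξ.map (Prod.map A A)).map Prod.snd = π.map A := by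
    constructor
    · rw [← hξ.1, Measure.map_map measurable_fst hm2, Measure.map_map hm measurable_fst]
      rfl
    · rw [← hξ.2, Measure.map_map measurable_snd hm2, Measure.map_map hm measurable_snd]
      rfl
  refine (iInf₂_le (ξ.map (Prod.map A A)) hc).trans ?_
  rw [lintegral_map (measurable_fst.edist measurable_snd) hm2,
    ← lintegral_const_mul' _ _ ENNReal.coe_ne_top]
  exact lintegral_mono fun p => hA p.1 p.2

end Wasserstein

/-! ### Concentration of ergodic averages -/

section Concentration

variable {S W Ω : Type*} [PseudoMetricSpace S] [MeasurableSpace S] [BorelSpace S]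
  [MeasurableSpace W] [MeasurableSpace Ω] {κ : Kernel S S} {ν : Measure W} {T : S → W → S}
  {ρ C C' : ℝ} {μ₀ π : Measure S} {Pr : Measure Ω} {Z : ℕ → Ω → S}
  [IsMarkovKernel κ] [IsProbabilityMeasure ν] [IsProbabilityMeasure μ₀] [IsProbabilityMeasure π]
  [IsProbabilityMeasure Pr]

namespace IsContractiveKernel

/-- Herbst's exponential bound, in terms of the lower Lebesgue integral. -/
theorem _root_.LogSobolev.lintegral_exp_le {μ : Measure S} [IsProbabilityMeasure μ] (hC : 0 ≤ C)
    (h : LogSobolev μ C) {g : S → ℝ} {K : ℝ≥0} (hg : LipschitzWith K g) :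
    ∫⁻ z, ENNReal.ofReal (Real.exp (g z)) ∂μ
      ≤ ENNReal.ofReal (Real.exp (∫ z, g z ∂μ + C * K ^ 2 / 4)) := by
  have h1 := h.integrable_exp_and_integral_exp_le hC hg
  rw [← ofReal_integral_eq_lintegral_ofReal h1.1 (Eventually.of_forall fun _ => (Real.exp_pos _).le)]
  exact ENNReal.ofReal_le_ofReal h1.2

theorem integrable_of_invariant (h : IsContractiveKernel κ ν T ρ C) (hπ : κ.Invariant π) {f : S → ℝ}
    {K : ℝ≥0} (hf : LipschitzWith K f) : Integrable f π := by
  refine (h.logSobolev_of_invariant hπ).integrable_of_lipschitz (div_nonneg h.const_nonneg ?_) hf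
  nlinarith [h.nonneg, h.lt_one]

/-- The Laplace transform of `φ (Z 1) + ⋯ + φ (Z j)`, plus a function of the last state: the last
step is integrated first, and turns `φ + g`, by Herbst's bound for the kernel, into a function of
the previous state whose Lipschitz constant has contracted. -/
theorem lintegral_exp_sum_le (h : IsContractiveKernel κ ν T ρ C) (hπ : κ.Invariant π)
    (hZ : IsMarkovChain κ μ₀ Pr Z) (hC' : 0 ≤ C') (hμ₀ : LogSobolev μ₀ C')
    (hW : wasserstein1 μ₀ π ≠ ⊤)
    {φ : S → ℝ} {ℓ M : ℝ≥0} (hφ : LipschitzWith ℓ φ) (hM : ℓ + ρ.toNNReal * M ≤ M) (j : ℕ)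
    {g : S → ℝ} (hg : LipschitzWith (ρ.toNNReal * M) g) :
    ∫⁻ ω, ENNReal.ofReal (Real.exp (∑ k ∈ Finset.Icc 1 j, φ (Z k ω) + g (Z j ω))) ∂Pr
      ≤ ENNReal.ofReal (Real.exp (j * ∫ z, φ z ∂π + ∫ z, g z ∂π + M * (wasserstein1 μ₀ π).toReal
          + (j * C + C') * M ^ 2 / 4)) := by
  induction j generalizing g with
  | zero =>
    have hgM : LipschitzWith M g := hg.weaken (le_add_self.trans hM)
    have hm : Measurable fun z => ENNReal.ofReal (Real.exp (g z)) :=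
      (Real.measurable_exp.comp hgM.continuous.measurable).ennreal_ofReal
    have h1 := hμ₀.lintegral_exp_le hC' hgM
    rw [← hZ.initial, lintegral_map hm (hZ.measurable 0), hZ.initial] at h1
    have h2 := integral_sub_le_wasserstein1 hW hgM (hμ₀.integrable_of_lipschitz hC' hgM) (h.integrable_of_invariant hπ hgM)
    simp only [zero_lt_one, Finset.Icc_eq_empty_of_lt, Finset.sum_empty, zero_add]
    refine h1.trans (ENNReal.ofReal_le_ofReal (Real.exp_le_exp.2 ?_))
    push_cast
    linarith
  | succ j ih =>
    have hgM : LipschitzWith M (fun z => φ z + g z) := (hφ.add hg).weaken hM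
    have hPg := h.lipschitz_markovOp hgM
    have hm : Measurable fun z => ENNReal.ofReal (Real.exp (φ z + g z)) :=
      (Real.measurable_exp.comp hgM.continuous.measurable).ennreal_ofReal
    have hmφ : Measurable φ := hφ.continuous.measurable
    have hY : Measurable[pastSigma Z j]
        fun ω => ENNReal.ofReal (Real.exp (∑ k ∈ Finset.Icc 1 j, φ (Z k ω))) := by
      refine (Real.measurable_exp.comp (Finset.measurable_sum _ fun k hk => ?_)).ennreal_ofReal
      exact hmφ.comp (measurable_pastSigma (Finset.mem_Icc.1 hk).2)
    have hi' : Integrable (fun z => φ z + g z) (π.bind κ) := by rw [hπ.def]; exact h.integrable_of_invariant hπ hgM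
    have hinv := integral_bind_kernel hi'
    rw [hπ.def, integral_add (h.integrable_of_invariant hπ hφ)
      (h.integrable_of_invariant hπ hg)] at hinv
    calc ∫⁻ ω, ENNReal.ofReal (Real.exp (∑ k ∈ Finset.Icc 1 (j + 1), φ (Z k ω) + g (Z (j + 1) ω)))
            ∂Pr
        = ∫⁻ ω, ENNReal.ofReal (Real.exp (∑ k ∈ Finset.Icc 1 j, φ (Z k ω)))
            * ENNReal.ofReal (Real.exp (φ (Z (j + 1) ω) + g (Z (j + 1) ω))) ∂Pr :=
          lintegral_congr fun ω => by
            rw [← ENNReal.ofReal_mul (Real.exp_pos _).le, ← Real.exp_add,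
              Finset.sum_Icc_succ_top (by omega), add_assoc]
      _ = ∫⁻ ω, ENNReal.ofReal (Real.exp (∑ k ∈ Finset.Icc 1 j, φ (Z k ω)))
            * ∫⁻ y, ENNReal.ofReal (Real.exp (φ y + g y)) ∂(κ (Z j ω)) ∂Pr :=
          hZ.lintegral_mul_succ j hY hm
      _ ≤ ∫⁻ ω, ENNReal.ofReal (Real.exp (C * M ^ 2 / 4)) * ENNReal.ofReal (Real.exp
            (∑ k ∈ Finset.Icc 1 j, φ (Z k ω) + markovOp κ (fun z => φ z + g z) (Z j ω))) ∂Pr :=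
          lintegral_mono fun ω => by
            refine (mul_le_mul_right ((h.logSobolev (Z j ω)).lintegral_exp_le h.const_nonneg hgM)
              _).trans (le_of_eq ?_)
            rw [← ENNReal.ofReal_mul (Real.exp_pos _).le, ← Real.exp_add,
              ← ENNReal.ofReal_mul (Real.exp_pos _).le, ← Real.exp_add]
            congr 2
            simp only [markovOp]
            ring
      _ ≤ _ := by
          rw [lintegral_const_mul' _ _ ENNReal.ofReal_ne_top]
          refine (mul_le_mul_right (ih hPg) _).trans (le_of_eq ?_)
          rw [← ENNReal.ofReal_mul (Real.exp_pos _).le, ← Real.exp_add, ← hinv]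
          congr 2
          push_cast
          ring

/-- One-sided concentration of the ergodic averages around the stationary mean, up to the bias due
to the initial law. -/
theorem measure_ge_sum_le (h : IsContractiveKernel κ ν T ρ C) (hπ : κ.Invariant π)
    (hZ : IsMarkovChain κ μ₀ Pr Z) (hC' : 0 ≤ C') (hμ₀ : LogSobolev μ₀ C')
    (hW : wasserstein1 μ₀ π ≠ ⊤)
    {φ : S → ℝ} {K : ℝ≥0} (hφ : LipschitzWith K φ) (n : ℕ) {t : ℝ} (ht : 0 ≤ t) :
    Pr.real {ω | t + K / (1 - ρ) * (wasserstein1 μ₀ π).toReal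
        ≤ ∑ k ∈ Finset.Icc 1 n, φ (Z k ω) - n * ∫ z, φ z ∂π}
      ≤ Real.exp (-(t ^ 2 / ((K / (1 - ρ)) ^ 2 * (n * C + C')))) := by
  have hρ : 0 < 1 - ρ := by linarith [h.lt_one]
  set b : ℝ := K / (1 - ρ) with hb
  have hb0 : 0 ≤ b := by positivity
  set D : ℝ := b ^ 2 * (n * C + C') with hD
  have hD0 : 0 ≤ D := mul_nonneg (sq_nonneg _) (add_nonneg (mul_nonneg n.cast_nonneg h.const_nonneg) hC')
  -- the optimal parameter in the Chernoff bound; it is `0`, and the bound trivial, if `D = 0`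
  set s : ℝ := 2 * t / D with hs
  have hs0 : 0 ≤ s := by positivity
  set w := (wasserstein1 μ₀ π).toReal with hw
  have hsφ : LipschitzWith (s.toNNReal * K) fun z => s * φ z :=
    LipschitzWith.of_dist_le_mul fun x y => by
      rw [Real.dist_eq, ← mul_sub, abs_mul, abs_of_nonneg hs0, NNReal.coe_mul,
        Real.coe_toNNReal _ hs0, mul_assoc]
      exact mul_le_mul_of_nonneg_left (hφ.dist_le_mul x y) hs0
  -- `s * b` is the sum of the geometric series `s * K * (1 + ρ + ρ ^ 2 + ⋯)`
  have hM : s.toNNReal * K + ρ.toNNReal * (s * b).toNNReal ≤ (s * b).toNNReal := by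
    rw [← NNReal.coe_le_coe]
    push_cast
    rw [Real.coe_toNNReal _ hs0, Real.coe_toNNReal _ h.nonneg,
      Real.coe_toNNReal _ (mul_nonneg hs0 hb0), hb]
    refine le_of_eq ?_
    field_simp
    ring
  have h1 := h.lintegral_exp_sum_le hπ hZ hC' hμ₀ hW hsφ hM n (g := fun _ => 0)
    ((LipschitzWith.const 0).weaken zero_le)
  rw [Real.coe_toNNReal _ (mul_nonneg hs0 hb0)] at h1
  simp only [add_zero, integral_zero, integral_const_mul, ← Finset.mul_sum] at h1
  have hmS : Measurable fun ω => ∑ k ∈ Finset.Icc 1 n, φ (Z k ω) :=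
    Finset.measurable_sum _ fun k _ => hφ.continuous.measurable.comp (hZ.measurable k)
  set c : ℝ := Real.exp (s * (t + b * w + n * ∫ z, φ z ∂π)) with hc
  have hc0 : 0 < c := Real.exp_pos _
  have h2 := meas_ge_le_lintegral_div (μ := Pr)
    (Real.measurable_exp.comp (hmS.const_mul s)).ennreal_ofReal.aemeasurable
    (ε := ENNReal.ofReal c) (by simpa using hc0) ENNReal.ofReal_ne_top
  have h3 : Pr {ω | t + b * w ≤ ∑ k ∈ Finset.Icc 1 n, φ (Z k ω) - n * ∫ z, φ z ∂π}
      ≤ ENNReal.ofReal (Real.exp (-(t ^ 2 / D))) := by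
    refine (measure_mono fun ω hω => ?_).trans (h2.trans ((ENNReal.div_le_div_right h1 _).trans ?_))
    · refine ENNReal.ofReal_le_ofReal (Real.exp_le_exp.2 (mul_le_mul_of_nonneg_left ?_ hs0))
      have : t + b * w ≤ ∑ k ∈ Finset.Icc 1 n, φ (Z k ω) - n * ∫ z, φ z ∂π := hω
      linarith
    · rw [← ENNReal.ofReal_div_of_pos hc0, hc, ← Real.exp_sub]
      refine ENNReal.ofReal_le_ofReal (Real.exp_le_exp.2 (le_of_eq ?_))
      have e : s ^ 2 * D / 4 - s * t = -(t ^ 2 / D) := by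
        rcases eq_or_ne D 0 with h0 | h0
        · simp [hs, h0]
        · rw [hs]
          field_simp
          ring
      rw [← e, hD]
      ring
  exact ENNReal.toReal_le_of_le_ofReal (Real.exp_pos _).le h3

/-- Two-sided concentration of the ergodic averages of a contractive kernel. -/
theorem measure_ge_abs_average_le (h : IsContractiveKernel κ ν T ρ C) (hπ : κ.Invariant π)
    (hZ : IsMarkovChain κ μ₀ Pr Z) (hC' : 0 ≤ C') (hμ₀ : LogSobolev μ₀ C')
    (hW : wasserstein1 μ₀ π ≠ ⊤)
    {φ : S → ℝ} {K : ℝ≥0} (hφ : LipschitzWith K φ) {n : ℕ} (hn : 1 ≤ n) {u : ℝ} (hu : 0 ≤ u) :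
    Pr.real {ω | u + K / ((1 - ρ) * n) * (wasserstein1 μ₀ π).toReal
        ≤ |1 / (n : ℝ) * ∑ k ∈ Finset.Icc 1 n, φ (Z k ω) - ∫ z, φ z ∂π|}
      ≤ 2 * Real.exp (-((n * u) ^ 2 / ((K / (1 - ρ)) ^ 2 * (n * C + C')))) := by
  have hn0 : (0 : ℝ) < n := by exact_mod_cast hn
  have h1 := h.measure_ge_sum_le hπ hZ hC' hμ₀ hW hφ n (mul_nonneg hn0.le hu)
  have h2 := h.measure_ge_sum_le hπ hZ hC' hμ₀ hW hφ.neg n (mul_nonneg hn0.le hu)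
  rw [two_mul]
  refine (measureReal_mono (fun ω hω => ?_) (measure_ne_top _ _)).trans
    ((measureReal_union_le _ _).trans (add_le_add h1 h2))
  have hω' : u + K / ((1 - ρ) * n) * (wasserstein1 μ₀ π).toReal
      ≤ |1 / (n : ℝ) * ∑ k ∈ Finset.Icc 1 n, φ (Z k ω) - ∫ z, φ z ∂π| := hω
  have e : (n : ℝ) * (u + K / ((1 - ρ) * n) * (wasserstein1 μ₀ π).toReal)
      = n * u + K / (1 - ρ) * (wasserstein1 μ₀ π).toReal := by
    have hρ : 1 - ρ ≠ 0 := by linarith [h.lt_one]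
    field_simp
  have e' : (n : ℝ) * (1 / (n : ℝ) * ∑ k ∈ Finset.Icc 1 n, φ (Z k ω) - ∫ z, φ z ∂π)
      = ∑ k ∈ Finset.Icc 1 n, φ (Z k ω) - n * ∫ z, φ z ∂π := by
    field_simp
  rcases le_abs'.1 hω' with h3 | h3
  · right
    have h4 := mul_le_mul_of_nonneg_left h3 hn0.le
    rw [e'] at h4
    simp only [Set.mem_ofPred_eq, Pi.neg_apply, Finset.sum_neg_distrib, integral_neg, ← e]
    linarith
  · left
    have h4 := mul_le_mul_of_nonneg_left h3 hn0.le
    rw [e', e] at h4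
    exact h4

end IsContractiveKernel

end Concentration

/-! ### Kernels under a change of variables -/

section Conjugation

variable {S S' Ω : Type*} [MeasurableSpace S] [MeasurableSpace S'] [MeasurableSpace Ω]

/-- The kernel `κ` read through the change of variables `e`. -/
noncomputable def conjKernel (κ : Kernel S S) (e : S ≃ᵐ S') : Kernel S' S' :=
  (κ.comap e.symm e.symm.measurable).map e

variable {κ : Kernel S S} {e : S ≃ᵐ S'}

theorem conjKernel_apply (z : S') : conjKernel κ e z = (κ (e.symm z)).map e := by
  rw [conjKernel, Kernel.map_apply _ e.measurable, Kernel.comap_apply]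

instance [IsMarkovKernel κ] : IsMarkovKernel (conjKernel κ e) :=
  Kernel.IsMarkovKernel.map _ e.measurable

theorem map_bind_conjKernel (μ : Measure S) : (μ.map e).bind (conjKernel κ e) = (μ.bind κ).map e := by
  ext B hB
  rw [Measure.bind_apply hB (Kernel.measurable _).aemeasurable,
    lintegral_map (Kernel.measurable_coe _ hB) e.measurable, Measure.map_apply e.measurable hB,
    Measure.bind_apply (e.measurable hB) (Kernel.measurable _).aemeasurable]
  refine lintegral_congr fun z => ?_
  rw [conjKernel_apply, e.symm_apply_apply, Measure.map_apply e.measurable hB]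

theorem invariant_conjKernel_map_iff {π : Measure S} :
    (conjKernel κ e).Invariant (π.map e) ↔ κ.Invariant π := by
  rw [Kernel.Invariant, Kernel.Invariant, map_bind_conjKernel]
  exact e.map_measurableEquiv_injective.eq_iff

theorem IsMarkovChain.conj {μ₀ : Measure S} {Pr : Measure Ω} {Z : ℕ → Ω → S}
    (h : IsMarkovChain κ μ₀ Pr Z) :
    IsMarkovChain (conjKernel κ e) (μ₀.map e) Pr fun k ω => e (Z k ω) where
  measurable k := e.measurable.comp (h.measurable k)
  initial := by
    rw [← h.initial, Measure.map_map e.measurable (h.measurable 0)]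
    rfl
  transition k B hB := by
    have hσ : ∀ j, MeasurableSpace.comap (fun ω => e (Z j ω)) inferInstance
        = MeasurableSpace.comap (Z j) inferInstance := fun j => by
      have h1 := MeasurableSpace.comap_comp (m := ‹MeasurableSpace S'›) (f := e) (g := Z j)
      rw [e.measurableEmbedding.comap_eq] at h1
      exact h1.symm
    simp only [hσ]
    refine (h.transition k (e ⁻¹' B) (e.measurable hB)).trans (Eventually.of_forall fun ω => ?_)
    simp only [conjKernel_apply, e.symm_apply_apply, Measure.real, Measure.map_apply e.measurable hB]

end Conjugation

/-! ### Kernels that contract after a bi-Lipschitz change of variables -/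

section

variable {S S' W : Type*} [PseudoMetricSpace S] [MeasurableSpace S] [BorelSpace S]
  [SecondCountableTopology S]
  [MetricSpace S'] [MeasurableSpace S'] [BorelSpace S'] [SecondCountableTopology S'] [ProperSpace S']
  [Nonempty S'] [MeasurableSpace W] {κ : Kernel S S} {e : S ≃ᵐ S'} {ν : Measure W} {T : S' → W → S'}
  {ρ C : ℝ} [IsMarkovKernel κ] [IsProbabilityMeasure ν]

/-- A Markov kernel which is contractive after a bi-Lipschitz change of variables has a unique
invariant probability measure; it satisfies a log-Sobolev inequality, and the ergodic averages of
the chain concentrate around it. -/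
theorem IsContractiveKernel.exists_invariant_of_conj
    (h : IsContractiveKernel (conjKernel κ e) ν T ρ C) {a b : ℝ≥0} (ha : a ≠ 0)
    (he : LipschitzWith a e) (he' : LipschitzWith b e.symm) :
    ∃ π : Measure S, IsProbabilityMeasure π ∧ κ.Invariant π ∧
      (∀ π' : Measure S, IsProbabilityMeasure π' → κ.Invariant π' → π' = π) ∧
      LogSobolev π (C / (1 - ρ ^ 2) * b ^ 2) ∧
      (∀ (φ : S → ℝ) (K : ℝ≥0), LipschitzWith K φ → Integrable φ π) ∧
      ∀ (μ₀ : Measure S) (C' : ℝ), IsProbabilityMeasure μ₀ → 0 ≤ C' → LogSobolev μ₀ C' →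
        wasserstein1 μ₀ π ≠ ⊤ ∧
        ∀ {Ω : Type*} [MeasurableSpace Ω] (Pr : Measure Ω) [IsProbabilityMeasure Pr]
          (Z : ℕ → Ω → S), IsMarkovChain κ μ₀ Pr Z →
        ∀ φ : S → ℝ, LipschitzWith 1 φ → ∀ n : ℕ, 1 ≤ n → ∀ u : ℝ, 0 ≤ u →
          Pr.real {ω | u + a * b / ((1 - ρ) * n) * (wasserstein1 μ₀ π).toReal
              ≤ |1 / (n : ℝ) * ∑ k ∈ Finset.Icc 1 n, φ (Z k ω) - ∫ z, φ z ∂π|}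
            ≤ 2 * Real.exp (-((n * u) ^ 2 / ((b / (1 - ρ)) ^ 2 * (n * C + C' * a ^ 2)))) := by
  have hρ : 0 < 1 - ρ := by linarith [h.lt_one]
  have hρ2 : 0 < 1 - ρ ^ 2 := by nlinarith [h.nonneg, h.lt_one]
  have hD : 0 ≤ C / (1 - ρ ^ 2) := div_nonneg h.const_nonneg hρ2.le
  obtain ⟨π', hπ'p, hπ'⟩ := h.exists_invariant
  obtain ⟨π, rfl⟩ : ∃ π : Measure S, π' = π.map e := ⟨π'.map e.symm, by simp⟩
  have hπ := invariant_conjKernel_map_iff.1 hπ'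
  have hπp : IsProbabilityMeasure π := by
    rw [← e.map_symm_map (μ := π)]
    exact Measure.isProbabilityMeasure_map e.symm.measurable.aemeasurable
  have hLS : LogSobolev π (C / (1 - ρ ^ 2) * b ^ 2) := by
    have := (h.logSobolev_of_invariant hπ').map hD he'
    rwa [e.map_symm_map] at this
  have hint : ∀ (φ : S → ℝ) (K : ℝ≥0), LipschitzWith K φ → Integrable φ π := fun φ K hφ =>
    hLS.integrable_of_lipschitz (by positivity) hφ
  refine ⟨π, hπp, hπ, fun π' hp hi => ?_, hLS, hint, fun μ₀ C' hp hC' hμ₀ => ?_⟩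
  · have hp' : IsProbabilityMeasure (π'.map e) := Measure.isProbabilityMeasure_map e.measurable.aemeasurable
    exact e.map_measurableEquiv_injective
      (h.invariant_unique (invariant_conjKernel_map_iff.2 hi) hπ')
  · obtain ⟨z₀⟩ := nonempty_of_isProbabilityMeasure π
    have hd : LipschitzWith 1 fun z : S => dist z z₀ := LipschitzWith.dist_left z₀
    have hW : wasserstein1 μ₀ π ≠ ⊤ :=
      wasserstein1_ne_top z₀ (hμ₀.integrable_of_lipschitz hC' hd) (hint _ _ hd)
    refine ⟨hW, fun Pr _ Z hZ φ hφ n hn u hu => ?_⟩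
    have hp' : IsProbabilityMeasure (μ₀.map e) :=
      Measure.isProbabilityMeasure_map e.measurable.aemeasurable
    have hWle := wasserstein1_map_le μ₀ π he ha
    have hW' : wasserstein1 (μ₀.map e) (π.map e) ≠ ⊤ :=
      ne_top_of_le_ne_top (ENNReal.mul_ne_top ENNReal.coe_ne_top hW) hWle
    have hWr := ENNReal.toReal_mono (ENNReal.mul_ne_top ENNReal.coe_ne_top hW) hWle
    rw [ENNReal.toReal_mul, ENNReal.coe_toReal] at hWr
    have hφ' : LipschitzWith b fun z => φ (e.symm z) := by
      simpa [Function.comp_def] using hφ.comp he'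
    have key := h.measure_ge_abs_average_le hπ' hZ.conj (mul_nonneg hC' (sq_nonneg (a : ℝ)))
      (hμ₀.map hC' he) hW' hφ' hn hu
    have hint' : ∫ z, φ (e.symm z) ∂(π.map e) = ∫ z, φ z ∂π := by
      rw [e.measurableEmbedding.integral_map]
      simp only [e.symm_apply_apply]
    simp only [e.symm_apply_apply, hint'] at key
    refine (measureReal_mono (fun ω hω => ?_) (measure_ne_top _ _)).trans key
    refine (add_le_add_right ?_ u).trans hω
    have e1 : (a : ℝ) * b / ((1 - ρ) * n) * (wasserstein1 μ₀ π).toReal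
        = b / ((1 - ρ) * n) * (a * (wasserstein1 μ₀ π).toReal) := by ring
    rw [e1]
    gcongr

end

/-! ### Cocoercivity of the gradient of a convex function -/

section Cocoercivity

variable {E : Type*} [NormedAddCommGroup E] [InnerProductSpace ℝ E] [CompleteSpace E] {U : E → ℝ}

theorem hasDerivAt_comp_line (hU : Differentiable ℝ U) (x v : E) (t : ℝ) :
    HasDerivAt (fun t : ℝ => U (x + t • v)) (inner ℝ (gradient U (x + t • v)) v) t := by
  have h1 : HasFDerivAt U _ (x + t • v) := (hU (x + t • v)).hasGradientAt.hasFDerivAt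
  have h2 : HasDerivAt (fun t : ℝ => x + t • v) v t := by
    simpa using ((hasDerivAt_id t).smul_const v).const_add x
  simpa [Function.comp_def] using h1.comp_hasDerivAt t h2

/-- The first order characterisation of convexity, from monotonicity of the gradient. -/
theorem add_inner_gradient_le_of_monotone (hU : Differentiable ℝ U)
    (hmono : ∀ x y, 0 ≤ inner ℝ (x - y) (gradient U x - gradient U y)) (x v : E) :
    U x + inner ℝ (gradient U x) v ≤ U (x + v) := by
  obtain ⟨c, hc, h⟩ := exists_hasDerivAt_eq_slope (fun t : ℝ => U (x + t • v))
    (fun t => inner ℝ (gradient U (x + t • v)) v) zero_lt_one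
    (fun t _ => (hasDerivAt_comp_line hU x v t).continuousAt.continuousWithinAt)
    (fun t _ => hasDerivAt_comp_line hU x v t)
  simp only [zero_smul, add_zero, one_smul, sub_zero, div_one] at h
  have h1 := hmono (x + c • v) x
  rw [add_sub_cancel_left, real_inner_smul_left, real_inner_comm, inner_sub_left] at h1
  have h2 := nonneg_of_mul_nonneg_right h1 hc.1
  linarith

/-- The descent lemma. -/
theorem le_add_inner_gradient_add_of_lipschitz (hU : Differentiable ℝ U) {L : ℝ}
    (hLip : ∀ x y, ‖gradient U x - gradient U y‖ ≤ L * ‖x - y‖) (x v : E) :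
    U (x + v) ≤ U x + inner ℝ (gradient U x) v + L / 2 * ‖v‖ ^ 2 := by
  have hd : ∀ t : ℝ, HasDerivAt
      (fun t : ℝ => U (x + t • v) - t * inner ℝ (gradient U x) v - t ^ 2 * (L / 2 * ‖v‖ ^ 2))
      (inner ℝ (gradient U (x + t • v)) v - inner ℝ (gradient U x) v - t * (L * ‖v‖ ^ 2)) t := by
    intro t
    refine HasDerivAt.congr_deriv (((hasDerivAt_comp_line hU x v t).sub
      ((hasDerivAt_id t).mul_const (inner ℝ (gradient U x) v))).sub
      ((hasDerivAt_pow 2 t).mul_const (L / 2 * ‖v‖ ^ 2))) ?_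
    push_cast
    ring
  obtain ⟨c, hc, h⟩ := exists_hasDerivAt_eq_slope _ _ zero_lt_one
    (fun t _ => (hd t).continuousAt.continuousWithinAt) (fun t _ => hd t)
  simp only [zero_smul, add_zero, one_smul, sub_zero, div_one, one_mul, one_pow, zero_mul, ne_eq,
    OfNat.ofNat_ne_zero, not_false_eq_true, zero_pow] at h
  have h1 := real_inner_le_norm (gradient U (x + c • v) - gradient U x) v
  have h2 := hLip (x + c • v) x
  rw [add_sub_cancel_left, norm_smul, Real.norm_of_nonneg hc.1.le] at h2
  have h3 := mul_le_mul_of_nonneg_right h2 (norm_nonneg v)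
  rw [inner_sub_left] at h1
  nlinarith

/-- Cocoercivity of a monotone Lipschitz gradient (Baillon–Haddad): a gradient step of length `1/L`
from `y`, for the convex function `U - ⟪∇ U x, ·⟫` which is minimal at `x`. -/
theorem norm_sq_gradient_sub_le_mul_inner (hU : Differentiable ℝ U) {L : ℝ} (hL : 0 < L)
    (hLip : ∀ x y, ‖gradient U x - gradient U y‖ ≤ L * ‖x - y‖)
    (hmono : ∀ x y, 0 ≤ inner ℝ (x - y) (gradient U x - gradient U y)) (x y : E) :
    ‖gradient U x - gradient U y‖ ^ 2 ≤ L * inner ℝ (x - y) (gradient U x - gradient U y) := by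
  have key : ∀ x y : E, U x + inner ℝ (gradient U x) (y - x)
      + ‖gradient U y - gradient U x‖ ^ 2 / (2 * L) ≤ U y := by
    intro x y
    set p := gradient U y - gradient U x with hp
    have h1 := le_add_inner_gradient_add_of_lipschitz hU hLip y (-(L⁻¹ • p))
    have h2 := add_inner_gradient_le_of_monotone hU hmono x (y + -(L⁻¹ • p) - x)
    rw [add_sub_cancel] at h2
    have e : inner ℝ (gradient U y) (-(L⁻¹ • p))
        = inner ℝ (gradient U x) (y + -(L⁻¹ • p) - x) - inner ℝ (gradient U x) (y - x)
          - L⁻¹ * ‖p‖ ^ 2 := by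
      have : gradient U y = gradient U x + p := by rw [hp]; abel
      rw [this]
      simp only [inner_sub_right, inner_add_right, inner_add_left, inner_neg_right,
        real_inner_smul_right, real_inner_self_eq_norm_sq]
      ring
    rw [e, norm_neg, norm_smul, mul_pow, norm_inv, Real.norm_of_nonneg hL.le] at h1
    have e2 : L / 2 * (L⁻¹ ^ 2 * ‖p‖ ^ 2) = L⁻¹ * ‖p‖ ^ 2 - ‖p‖ ^ 2 / (2 * L) := by
      field_simp
      ring
    linarith
  have h1 := key x y
  have h2 := key y x
  rw [norm_sub_rev] at h1
  have e : inner ℝ (x - y) (gradient U x - gradient U y)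
      = -(inner ℝ (gradient U x) (y - x) + inner ℝ (gradient U y) (x - y)) := by
    rw [real_inner_comm, inner_sub_left, ← neg_sub x y, inner_neg_right]
    ring
  have h3 : ‖gradient U x - gradient U y‖ ^ 2 / (2 * L) + ‖gradient U x - gradient U y‖ ^ 2 / (2 * L)
      ≤ inner ℝ (x - y) (gradient U x - gradient U y) := by
    rw [e]; linarith
  have e3 : ‖gradient U x - gradient U y‖ ^ 2
      = L * (‖gradient U x - gradient U y‖ ^ 2 / (2 * L)
        + ‖gradient U x - gradient U y‖ ^ 2 / (2 * L)) := by
    field_simp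
    ring
  rw [e3]
  exact mul_le_mul_of_nonneg_left h3 hL.le

end Cocoercivity

/-! ### Scalar form of the contraction of the OBABO step -/

section ObaboEstimates

theorem exp_neg_le_quadratic {s : ℝ} (hs : 0 ≤ s) : Real.exp (-s) ≤ 1 - s + s ^ 2 / 2 := by
  have h1 := Real.quadratic_le_exp_of_nonneg hs
  have h2 : 0 < 1 + s + s ^ 2 / 2 := by positivity
  have h3 : Real.exp (-s) ≤ (1 + s + s ^ 2 / 2)⁻¹ := by
    rw [Real.exp_neg]
    exact inv_anti₀ h2 h1
  refine h3.trans ?_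
  rw [inv_le_iff_one_le_mul₀ h2]
  nlinarith [sq_nonneg (s ^ 2)]

/-- The contraction estimate as an inequality between the squared norms and inner products
`xx = ‖x‖ ^ 2`, `xv = ⟪x, v⟫`, … of the differences of the positions, velocities and forces of two
coupled chains at the beginning of the step.The coefficient `b` is the one left over in
`obabo_contraction_of_friction_one` after the force at the end of the step has been removed. -/
theorem obabo_contraction_aux {l μ h η b xx vv pp xv xp vp : ℝ} (hμ : 0 < μ) (hμl : μ ≤ l)
    (hl : l ≤ 1 / 4) (hh : 0 < h) (hhμ : 33 * h ≤ μ) (hη : 1 - h / 2 ≤ η)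
    (hη' : η ≤ 1 - h / 2 + h ^ 2 / 8) (hb : b = 1 - h * η * (29 / 50 * μ))
    (hxx : 0 ≤ xx) (hvv : 0 ≤ vv)
    (hxv : ∀ s : ℝ, 0 ≤ xx + 2 * s * xv + s ^ 2 * vv)
    (hvp : ∀ s : ℝ, 0 ≤ vv + 2 * s * vp + s ^ 2 * pp)
    (hxp : μ * xx ≤ xp) (hpp : pp ≤ l * xp) (hpp0 : 0 ≤ pp) :
    l * b * (xx + h ^ 2 * η ^ 2 * vv + h ^ 4 / 4 * pp + 2 * h * η * xv - h ^ 2 * xp - h ^ 3 * η * vp)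
      + 2 * l * (η ^ 2 * xv - h * η / 2 * xp + h * η ^ 3 * vv - h ^ 2 * η ^ 2 * vp
        + h ^ 3 * η / 4 * pp)
      + (1 + 3 / 5 * h * η) * (η ^ 4 * vv - h * η ^ 3 * vp + h ^ 2 * η ^ 2 / 4 * pp)
      ≤ (1 - μ * h / 2) * (l * xx + 2 * l * xv + vv) := by
  have hl0 : 0 < l := hμ.trans_le hμl
  have hh1 : h ≤ 1 / 132 := by linarith
  have hh2 : h ^ 2 ≤ h / 132 := by
    rw [sq, div_eq_mul_one_div]
    gcongr
  have hη1 : η ≤ 1 := by linarith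
  have hη0 : 0 < η := by linarith
  have hμ1 : μ ≤ 1 / 4 := hμl.trans hl
  have hhη : h * η ≤ h := mul_le_of_le_one_right hh.le hη1
  have hhη0 : 0 < h * η := mul_pos hh hη0
  have hb1 : b ≤ 1 := by rw [hb]; linarith [mul_pos hhη0 hμ]
  have hb0 : 9 / 10 ≤ b := by
    have : h * η * (29 / 50 * μ) ≤ h * (29 / 50 * (1 / 4)) := by gcongr
    rw [hb]; linarith
  have hη2 : η ^ 2 ≤ 1 - h + h ^ 2 / 2 := by
    have h1 : η ^ 2 ≤ (1 - h / 2 + h ^ 2 / 8) ^ 2 := pow_le_pow_left₀ hη0.le hη' 2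
    have h2 : h * h ^ 3 ≤ 1 * h ^ 3 := by gcongr; linarith
    linarith only [h1, h2, pow_pos hh 3]
  have hη4 : η ^ 4 ≤ 1 - 2 * h + 2 * h ^ 2 := by
    have h1 : η ^ 4 ≤ (1 - h + h ^ 2 / 2) ^ 2 := by
      have := pow_le_pow_left₀ (sq_nonneg η) hη2 2
      rwa [← pow_mul] at this
    have h2 : h * h ^ 3 ≤ 1 * h ^ 3 := by gcongr; linarith
    linarith only [h1, h2, pow_pos hh 3]
  have p2 : η ^ 2 ≤ 1 := pow_le_one₀ hη0.le hη1
  have p3 : η ^ 3 ≤ 1 := pow_le_one₀ hη0.le hη1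
  have p4 : η ^ 4 ≤ 1 := pow_le_one₀ hη0.le hη1
  -- the coefficients of the difference of both sides
  have cxx : h * (7 / 100 * (l * μ)) ≤ l * (1 - μ * h / 2) - l * b := by
    have e : l * (1 - μ * h / 2) - l * b = h * ((29 / 50 * η - 1 / 2) * (l * μ)) := by
      rw [hb]; ring
    rw [e]
    gcongr
    linarith
  have cxv : |2 * l * (1 - μ * h / 2) - l * b * (2 * h * η) - 2 * l * η ^ 2|
      ≤ h * (102 / 100 * (l * μ)) := by
    have e : 2 * l * (1 - μ * h / 2) - l * b * (2 * h * η) - 2 * l * η ^ 2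
        = l * (2 * (1 - η ^ 2 - h * η) - μ * h + 58 / 50 * μ * (h * η) ^ 2) := by rw [hb]; ring
    have h1 : (h * η) ^ 2 ≤ h / 132 := (pow_le_pow_left₀ hhη0.le hhη 2).trans hh2
    have h2 : -(h ^ 4 / 64) ≤ 1 - η ^ 2 - h * η := by
      have : (η + h / 2) ^ 2 ≤ (1 + h ^ 2 / 8) ^ 2 :=
        pow_le_pow_left₀ (by positivity) (by linarith) 2
      linarith
    have h3 : 1 - η ^ 2 - h * η ≤ h ^ 2 / 4 := by
      have : 1 ^ 2 ≤ (η + h / 2) ^ 2 := pow_le_pow_left₀ zero_le_one (by linarith) 2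
      linarith
    have h8 : h ^ 2 ≤ h * μ / 33 := by
      have := mul_le_mul_of_nonneg_left hhμ hh.le
      linarith
    have h4 : h ^ 4 ≤ h * μ / 132 := by
      have : h ^ 4 ≤ h ^ 2 * (1 / 132) := by
        rw [show h ^ 4 = h ^ 2 * h ^ 2 by ring]
        gcongr
        linarith
      linarith [mul_pos hh hμ]
    have h5 : 0 ≤ μ * (h * η) ^ 2 := by positivity
    have h6 : μ * (h * η) ^ 2 ≤ μ * (h / 132) := by gcongr
    rw [e, abs_mul, abs_of_pos hl0]
    have h7 : |2 * (1 - η ^ 2 - h * η) - μ * h + 58 / 50 * μ * (h * η) ^ 2| ≤ h * (102 / 100 * μ) := by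
      have h9 := mul_pos hh hμ
      rw [abs_le]
      constructor <;> linarith only [h2, h3, h4, h5, h6, h8, h9, hh]
    calc _ ≤ l * (h * (102 / 100 * μ)) := mul_le_mul_of_nonneg_left h7 hl0.le
      _ = _ := by ring
  have cxp : h * l ≤ l * b * h ^ 2 + l * (h * η) := by
    have h1 : 1 / 2 * h ≤ b * h := by gcongr; linarith
    have h2 : 1 ≤ b * h + η := by linarith
    calc h * l = h * l * 1 := (mul_one _).symm
      _ ≤ h * l * (b * h + η) := mul_le_mul_of_nonneg_left h2 (mul_pos hh hl0).le
      _ = _ := by ring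
  have cvv : h * (74 / 100) ≤ (1 - μ * h / 2) - l * b * (h ^ 2 * η ^ 2) - 2 * l * (h * η ^ 3)
      - (1 + 3 / 5 * h * η) * η ^ 4 := by
    have h1 : l * b * (h ^ 2 * η ^ 2) ≤ 1 / 4 * 1 * (h ^ 2 * 1) := by gcongr
    have h2 : 2 * l * (h * η ^ 3) ≤ 2 * (1 / 4) * (h * 1) := by gcongr
    have h3 : (h * η) * η ^ 4 ≤ h * 1 := by gcongr
    have h4 : μ * h ≤ 1 / 4 * h := by gcongr
    have e : (1 + 3 / 5 * h * η) * η ^ 4 = η ^ 4 + 3 / 5 * ((h * η) * η ^ 4) := by ring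
    rw [e]
    linarith only [h1, h2, h3, h4, hη4, hh2, hh]
  have cvp0 : 0 ≤ l * b * (h ^ 3 * η) + 2 * l * (h ^ 2 * η ^ 2) + (1 + 3 / 5 * h * η) * (h * η ^ 3) := by
    positivity
  have cvp : l * b * (h ^ 3 * η) + 2 * l * (h ^ 2 * η ^ 2) + (1 + 3 / 5 * h * η) * (h * η ^ 3)
      ≤ h * (102 / 100) := by
    have h1 : l * b * (h ^ 3 * η) ≤ 1 / 4 * 1 * (1 * h ^ 2 * 1) := by
      rw [show h ^ 3 = h * h ^ 2 by ring]
      gcongr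
      linarith only [hh1]
    have h2 : 2 * l * (h ^ 2 * η ^ 2) ≤ 2 * (1 / 4) * (h ^ 2 * 1) := by gcongr
    have h3 : (1 + 3 / 5 * h * η) * (h * η ^ 3) ≤ (1 + 3 / 5 * (1 / 132) * 1) * (h * 1) := by gcongr
    linarith only [h1, h2, h3, hh2, hh]
  have cpp : l * b * (h ^ 4 / 4) + 2 * l * (h ^ 3 * η / 4) + (1 + 3 / 5 * h * η) * (h ^ 2 * η ^ 2 / 4)
      ≤ h * (3 / 1000) := by
    have h0 : h ^ 4 ≤ h ^ 2 := pow_le_pow_of_le_one hh.le (by linarith) (by norm_num)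
    have h1 : l * b * (h ^ 4 / 4) ≤ 1 / 4 * 1 * (h ^ 2 / 4) := by gcongr
    have h2 : 2 * l * (h ^ 3 * η / 4) ≤ 2 * (1 / 4) * (h * h ^ 2 * 1 / 4) := by
      rw [show h ^ 3 = h * h ^ 2 by ring]; gcongr
    have h3 : (1 + 3 / 5 * h * η) * (h ^ 2 * η ^ 2 / 4) ≤ (1 + 3 / 5 * (1 / 132) * 1) * (h ^ 2 * 1 / 4) := by
      gcongr
    have h4 : h * h ^ 2 ≤ 1 / 132 * h ^ 2 := by gcongr
    linarith only [h1, h2, h3, h4, hh2, hh]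
  -- Young's inequality for the two indefinite terms
  have yxv : 102 / 100 * |xv| ≤ 60 / 100 * xx + 44 / 100 * vv := by
    rcases abs_cases xv with ⟨h1, -⟩ | ⟨h1, -⟩ <;> rw [h1]
    · linarith only [hxv (-(17 / 20)), hvv, hxx]
    · linarith only [hxv (17 / 20), hvv, hxx]
  have yvp : 102 / 100 * |vp| ≤ 60 / 100 * vv + 44 / 100 * pp := by
    rcases abs_cases vp with ⟨h1, -⟩ | ⟨h1, -⟩ <;> rw [h1]
    · linarith only [hvp (-(17 / 20)), hvv, hpp0]
    · linarith only [hvp (17 / 20), hvv, hpp0]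
  have hxp0 : 0 ≤ xp := (mul_nonneg hμ.le hxx).trans hxp
  have txx := mul_le_mul_of_nonneg_right cxx hxx
  have txv : -(h * (102 / 100 * (l * μ)) * |xv|)
      ≤ (2 * l * (1 - μ * h / 2) - l * b * (2 * h * η) - 2 * l * η ^ 2) * xv := by
    refine (neg_le_neg (mul_le_mul_of_nonneg_right cxv (abs_nonneg xv))).trans ?_
    rw [← abs_mul]
    exact neg_abs_le _
  have txp := mul_le_mul_of_nonneg_right cxp hxp0
  have tvv := mul_le_mul_of_nonneg_right cvv hvv
  have tvp : -(h * (102 / 100) * |vp|)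
      ≤ (l * b * (h ^ 3 * η) + 2 * l * (h ^ 2 * η ^ 2) + (1 + 3 / 5 * h * η) * (h * η ^ 3)) * vp := by
    refine (neg_le_neg (mul_le_mul_of_nonneg_right cvp (abs_nonneg vp))).trans ?_
    rw [← abs_of_nonneg cvp0, ← abs_mul, abs_of_nonneg cvp0]
    exact neg_abs_le _
  have tpp := mul_le_mul_of_nonneg_right cpp hpp0
  have final : 0 ≤ h * (7 / 100 * (l * μ)) * xx - h * (102 / 100 * (l * μ)) * |xv| + h * l * xp
      + h * (74 / 100) * vv - h * (102 / 100) * |vp| - h * (3 / 1000) * pp := by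
    have hlμ : l * μ ≤ 1 / 4 * (1 / 4) := by gcongr
    have f1 := mul_le_mul_of_nonneg_left yxv (mul_pos hl0 hμ).le
    have f2 : l * μ * vv ≤ 1 / 4 * (1 / 4) * vv := by gcongr
    have f3 : l * (μ * xx) ≤ l * xp := by gcongr
    have : 0 ≤ 7 / 100 * (l * μ) * xx - 102 / 100 * (l * μ) * |xv| + l * xp
      + 74 / 100 * vv - 102 / 100 * |vp| - 3 / 1000 * pp := by
      have f4 : 0 ≤ l * (μ * xx) := by positivity
      linarith only [f1, f2, f3, f4, yvp, hpp, hvv]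
    linarith only [mul_nonneg hh.le this]
  linarith only [final, txx, txv, txp, tvv, tvp, tpp]

end ObaboEstimates

/-! ### The OBABO step in units where the friction is one -/

section ObaboVectorEstimates

variable {F : Type*} [NormedAddCommGroup F] [InnerProductSpace ℝ F]

theorem norm_add_smul_sq (x y : F) (s : ℝ) :
    ‖x + s • y‖ ^ 2 = ‖x‖ ^ 2 + 2 * s * inner ℝ x y + s ^ 2 * ‖y‖ ^ 2 := by
  rw [norm_add_sq_real, real_inner_smul_right, norm_smul, mul_pow, Real.norm_eq_abs, sq_abs]
  ring

/-- One step of two synchronously coupled OBABO chains, in units where the friction is `1`: the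
differences `x, v` of positions and velocities become `X, V`, where `p, q` are the differences of the
forces before and after the move. Young's inequality removes the force `q` at the new position, at the
price of the factor `1 + 3 / 5 * h * η` in `obabo_contraction_aux`; of the gain `-l * h * η * ⟪X, q⟫`,
cocoercivity spends the fraction `21 / 50` on `‖q‖ ^ 2`, and strong convexity turns the rest into the
factor `b`. -/
theorem obabo_contraction_of_friction_one {l μ h η : ℝ} (hμ : 0 < μ) (hμl : μ ≤ l)
    (hl : l ≤ 1 / 4) (hh : 0 < h) (hhμ : 33 * h ≤ μ) (hη : 1 - h / 2 ≤ η)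
    (hη' : η ≤ 1 - h / 2 + h ^ 2 / 8) {x v p q X V : F}
    (hX : X = x + (h * η) • v - (h ^ 2 / 2) • p) (hV : V = η ^ 2 • v - (h * η / 2) • (p + q))
    (hxp : μ * ‖x‖ ^ 2 ≤ inner ℝ x p) (hpp : ‖p‖ ^ 2 ≤ l * inner ℝ x p)
    (hXq : μ * ‖X‖ ^ 2 ≤ inner ℝ X q) (hqq : ‖q‖ ^ 2 ≤ l * inner ℝ X q) :
    l * ‖X‖ ^ 2 + 2 * l * inner ℝ X V + ‖V‖ ^ 2
      ≤ (1 - μ * h / 2) * (l * ‖x‖ ^ 2 + 2 * l * inner ℝ x v + ‖v‖ ^ 2) := by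
  have hl0 : 0 < l := hμ.trans_le hμl
  have hη0 : 0 < η := by linarith
  have hη1 : η ≤ 1 := by nlinarith
  set V' : F := η ^ 2 • v - (h * η / 2) • p with hV'
  have hVV : V = V' + (-(h * η / 2)) • q := by rw [hV, hV']; module
  have e1 : ‖V‖ ^ 2 = ‖V'‖ ^ 2 - h * η * inner ℝ V' q + h ^ 2 * η ^ 2 / 4 * ‖q‖ ^ 2 := by
    rw [hVV, norm_add_smul_sq]; ring
  have e2 : inner ℝ X V = inner ℝ X V' - h * η / 2 * inner ℝ X q := by
    rw [hVV, inner_add_right, real_inner_smul_right]; ring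
  have eXX : ‖X‖ ^ 2 = ‖x‖ ^ 2 + h ^ 2 * η ^ 2 * ‖v‖ ^ 2 + h ^ 4 / 4 * ‖p‖ ^ 2
      + 2 * h * η * inner ℝ x v - h ^ 2 * inner ℝ x p - h ^ 3 * η * inner ℝ v p := by
    rw [hX]
    simp only [← real_inner_self_eq_norm_sq, inner_add_left, inner_sub_left, inner_add_right,
      inner_sub_right, real_inner_smul_left, real_inner_smul_right, real_inner_comm x v,
      real_inner_comm x p, real_inner_comm v p]
    ring
  have eXV : inner ℝ X V' = η ^ 2 * inner ℝ x v - h * η / 2 * inner ℝ x p + h * η ^ 3 * ‖v‖ ^ 2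
      - h ^ 2 * η ^ 2 * inner ℝ v p + h ^ 3 * η / 4 * ‖p‖ ^ 2 := by
    rw [hX, hV']
    simp only [← real_inner_self_eq_norm_sq, inner_add_left, inner_sub_left,
      inner_sub_right, real_inner_smul_left, real_inner_smul_right, real_inner_comm v p]
    ring
  have eVV : ‖V'‖ ^ 2 = η ^ 4 * ‖v‖ ^ 2 - h * η ^ 3 * inner ℝ v p + h ^ 2 * η ^ 2 / 4 * ‖p‖ ^ 2 := by
    rw [hV']
    simp only [← real_inner_self_eq_norm_sq, inner_sub_left,
      inner_sub_right, real_inner_smul_left, real_inner_smul_right, real_inner_comm v p]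
    ring
  have haux := obabo_contraction_aux hμ hμl hl hh hhμ hη hη' rfl (sq_nonneg ‖x‖) (sq_nonneg ‖v‖)
    (fun s => by rw [← norm_add_smul_sq]; positivity)
    (fun s => by rw [← norm_add_smul_sq]; positivity) hxp hpp (sq_nonneg ‖p‖)
  rw [← eXX, ← eXV, ← eVV] at haux
  -- Young's inequality `|⟪V', q⟫| ≤ 3 / 5 ‖V'‖ ^ 2 + 5 / 12 ‖q‖ ^ 2`
  have hY : 0 ≤ 3 / 5 * ‖V'‖ ^ 2 + inner ℝ V' q + 5 / 12 * ‖q‖ ^ 2 := by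
    have : 0 ≤ ‖V' + (5 / 6 : ℝ) • q‖ ^ 2 := sq_nonneg _
    rw [norm_add_smul_sq] at this
    linarith
  have hXq0 : 0 ≤ inner ℝ X q := (mul_nonneg hμ.le (sq_nonneg _)).trans hXq
  have hhη : 0 < h * η := mul_pos hh hη0
  have hhη1 : h * η ≤ 1 / 132 := (mul_le_of_le_one_right hh.le hη1).trans (by linarith)
  have hq : (5 / 12 + h * η / 4) * ‖q‖ ^ 2 ≤ 21 / 50 * (l * inner ℝ X q) := by
    have : 5 / 12 + h * η / 4 ≤ 21 / 50 := by linarith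
    gcongr
  have hb : l * (29 / 50 * (μ * ‖X‖ ^ 2)) ≤ l * (29 / 50 * inner ℝ X q) := by gcongr
  have key : 0 ≤ h * η * (3 / 5 * ‖V'‖ ^ 2 + inner ℝ V' q + 5 / 12 * ‖q‖ ^ 2
      + (21 / 50 * (l * inner ℝ X q) - (5 / 12 + h * η / 4) * ‖q‖ ^ 2)
      + (l * (29 / 50 * inner ℝ X q) - l * (29 / 50 * (μ * ‖X‖ ^ 2)))) :=
    mul_nonneg hhη.le (by linarith only [hY, hq, hb])
  rw [e1, e2]
  linarith only [haux, key]

theorem norm_add_sq_le_of_pos (x y : F) {ε : ℝ} (hε : 0 < ε) :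
    ‖x + y‖ ^ 2 ≤ (1 + ε) * ‖x‖ ^ 2 + (1 + ε⁻¹) * ‖y‖ ^ 2 := by
  have h : 0 ≤ ε * ‖x + (-ε⁻¹) • y‖ ^ 2 := by positivity
  rw [norm_add_smul_sq] at h
  have e : ε * (‖x‖ ^ 2 + 2 * -ε⁻¹ * inner ℝ x y + (-ε⁻¹) ^ 2 * ‖y‖ ^ 2)
      = ε * ‖x‖ ^ 2 - 2 * inner ℝ x y + ε⁻¹ * ‖y‖ ^ 2 := by
    field_simp
    ring
  rw [e] at h
  rw [norm_add_sq_real]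
  linarith

/-- The influence on the new state of a change `(g, g')` of the Gaussian noise, in units where the
friction is `1`. -/
theorem obabo_noise_of_friction_one {l h η s : ℝ} (hl0 : 0 < l) (hl : l ≤ 1 / 4) (hh : 0 < h)
    (hh1 : h ≤ 1 / 132) (hη0 : 0 ≤ η) (hη1 : η ≤ 1) (hs : s ^ 2 ≤ h) {g g' q X V : F}
    (hX : X = (h * s) • g) (hV : V = s • (η • g + g') - (h * η / 2) • q) (hq : ‖q‖ ≤ l * ‖X‖) :
    l * ‖X‖ ^ 2 + 2 * l * inner ℝ X V + ‖V‖ ^ 2 ≤ 9 / 4 * h * (‖g‖ ^ 2 + ‖g'‖ ^ 2) := by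
  have hg : ‖η • g + g'‖ ^ 2 ≤ 2 * (‖g‖ ^ 2 + ‖g'‖ ^ 2) := by
    have h1 := norm_add_sq_le_of_pos (η • g) g' one_pos
    rw [norm_smul, mul_pow, Real.norm_eq_abs, sq_abs] at h1
    have h2 : η ^ 2 * ‖g‖ ^ 2 ≤ 1 * ‖g‖ ^ 2 := by gcongr; exact pow_le_one₀ hη0 hη1
    norm_num at h1
    linarith
  have hXX : ‖X‖ ^ 2 ≤ h ^ 3 * (‖g‖ ^ 2 + ‖g'‖ ^ 2) := by
    rw [hX, norm_smul, mul_pow, Real.norm_eq_abs, sq_abs, mul_pow]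
    calc h ^ 2 * s ^ 2 * ‖g‖ ^ 2 ≤ h ^ 2 * h * (‖g‖ ^ 2 + ‖g'‖ ^ 2) := by
          gcongr
          linarith [sq_nonneg ‖g'‖]
      _ = _ := by ring
  have hqq : ‖q‖ ^ 2 ≤ l ^ 2 * ‖X‖ ^ 2 := by
    rw [← mul_pow]; exact pow_le_pow_left₀ (norm_nonneg _) hq 2
  set n := ‖g‖ ^ 2 + ‖g'‖ ^ 2 with hn
  have hn0 : 0 ≤ n := by positivity
  have hVV : ‖V‖ ^ 2 ≤ 26 / 25 * (2 * h * n) + 26 * (h ^ 2 / 4 * ‖X‖ ^ 2) := by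
    have h1 := norm_add_sq_le_of_pos (s • (η • g + g')) ((-(h * η / 2)) • q)
      (ε := 1 / 25) (by norm_num)
    have e : s • (η • g + g') + (-(h * η / 2)) • q = V := by rw [hV]; module
    rw [e, norm_smul, norm_smul, mul_pow, mul_pow, Real.norm_eq_abs, Real.norm_eq_abs, sq_abs,
      sq_abs] at h1
    have h2 : s ^ 2 * ‖η • g + g'‖ ^ 2 ≤ h * (2 * n) := by gcongr
    have h3 : (-(h * η / 2)) ^ 2 * ‖q‖ ^ 2 ≤ h ^ 2 / 4 * (1 * ‖X‖ ^ 2) := by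
      refine mul_le_mul ?_ (hqq.trans ?_) (sq_nonneg _) (by positivity)
      · have : η ^ 2 ≤ 1 := pow_le_one₀ hη0 hη1
        have : h ^ 2 * η ^ 2 ≤ h ^ 2 * 1 := by gcongr
        linarith
      · gcongr
        exact pow_le_one₀ hl0.le (by linarith)
    norm_num at h1
    linarith
  have hXV : 2 * l * inner ℝ X V ≤ 25 * l ^ 2 * ‖X‖ ^ 2 + 1 / 25 * ‖V‖ ^ 2 := by
    have h1 : 0 ≤ ‖V + (-(25 * l)) • X‖ ^ 2 := sq_nonneg _
    rw [norm_add_smul_sq, real_inner_comm] at h1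
    linarith
  have hl2 : l ^ 2 ≤ (1 / 4) ^ 2 := pow_le_pow_left₀ hl0.le hl 2
  have t1 : l * ‖X‖ ^ 2 ≤ 1 / 4 * ‖X‖ ^ 2 := by gcongr
  have t2 : l ^ 2 * ‖X‖ ^ 2 ≤ (1 / 4) ^ 2 * ‖X‖ ^ 2 := by gcongr
  have hh2 : h ^ 2 ≤ (1 / 132) ^ 2 := pow_le_pow_left₀ hh.le hh1 2
  have t3 : h ^ 2 * ‖X‖ ^ 2 ≤ (1 / 132) ^ 2 * ‖X‖ ^ 2 := by gcongr
  have t4 : ‖X‖ ^ 2 ≤ (1 / 132) ^ 2 * (h * n) := by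
    refine hXX.trans ?_
    rw [show h ^ 3 * n = h ^ 2 * (h * n) by ring]
    gcongr
  have hhn : 0 ≤ h * n := by positivity
  linarith only [hXV, hVV, t1, t2, t3, t4, hhn]

end ObaboVectorEstimates

/-! ### The modified norm on the phase space -/

section ObaboNorm

variable {d : ℕ}

/-- The square of the Euclidean norm on the phase space, modified by a cross term, for which the
OBABO chain is a contraction. -/
noncomputable def obaboNormSq (L γ : ℝ) (z : PhaseSpace d) : ℝ :=
  L * ‖z.fst‖ ^ 2 + 2 * (L / γ) * inner ℝ z.fst z.snd + ‖z.snd‖ ^ 2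

theorem phaseSpace_norm_sq (z : PhaseSpace d) : ‖z‖ ^ 2 = ‖z.fst‖ ^ 2 + ‖z.snd‖ ^ 2 :=
  WithLp.prod_norm_sq_eq_of_L2 z

theorem phaseSpace_ext {z z' : PhaseSpace d} (h1 : z.fst = z'.fst) (h2 : z.snd = z'.snd) : z = z' :=
  WithLp.ofLp_injective 2 (Prod.ext h1 h2)

variable {L γ : ℝ}

theorem four_mul_le_sq (hL : 0 < L) (hγ : 2 * √L ≤ γ) : 4 * L ≤ γ ^ 2 := by
  have := pow_le_pow_left₀ (by positivity) hγ 2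
  rw [mul_pow, Real.sq_sqrt hL.le] at this
  linarith

/-- The cross term is at most half of the diagonal part, by `2 √L ≤ γ`. -/
theorem abs_cross_term_le (hL : 0 < L) (hγ : 2 * √L ≤ γ) (z : PhaseSpace d) :
    |2 * (L / γ) * inner ℝ z.fst z.snd| ≤ (L * ‖z.fst‖ ^ 2 + ‖z.snd‖ ^ 2) / 2 := by
  have hsq : 0 < √L := Real.sqrt_pos.2 hL
  have hγ0 : 0 < γ := lt_of_lt_of_le (by positivity) hγ
  have h1 : 2 * (L / γ) ≤ √L := by
    rw [← mul_div_assoc, div_le_iff₀ hγ0]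
    nlinarith [Real.sq_sqrt hL.le]
  have h2 := abs_real_inner_le_norm z.fst z.snd
  have h3 : 0 ≤ (√L * ‖z.fst‖ - ‖z.snd‖) ^ 2 := sq_nonneg _
  rw [sub_sq, mul_pow, Real.sq_sqrt hL.le] at h3
  rw [abs_mul, abs_of_pos (by positivity)]
  calc 2 * (L / γ) * |inner ℝ z.fst z.snd| ≤ √L * (‖z.fst‖ * ‖z.snd‖) := by gcongr
    _ ≤ _ := by linarith

theorem obaboNormSq_le (hL : 0 < L) (hγ : 2 * √L ≤ γ) (z : PhaseSpace d) :
    obaboNormSq L γ z ≤ 3 / 2 * max L 1 * ‖z‖ ^ 2 := by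
  have h1 := (le_abs_self _).trans (abs_cross_term_le hL hγ z)
  have h2 : L * ‖z.fst‖ ^ 2 ≤ max L 1 * ‖z.fst‖ ^ 2 := by gcongr; exact le_max_left _ _
  have h3 : 1 * ‖z.snd‖ ^ 2 ≤ max L 1 * ‖z.snd‖ ^ 2 := by gcongr; exact le_max_right _ _
  rw [phaseSpace_norm_sq, obaboNormSq]
  linarith

theorem norm_sq_le_obaboNormSq (hL : 0 < L) (hγ : 2 * √L ≤ γ) (z : PhaseSpace d) :
    ‖z‖ ^ 2 ≤ 2 * max 1 (1 / L) * obaboNormSq L γ z := by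
  have h1 := (neg_le_abs _).trans (abs_cross_term_le hL hγ z)
  have h2 : (L * ‖z.fst‖ ^ 2 + ‖z.snd‖ ^ 2) / 2 ≤ obaboNormSq L γ z := by
    rw [obaboNormSq]; linarith
  have h3 : 1 / L * (L * ‖z.fst‖ ^ 2) ≤ max 1 (1 / L) * (L * ‖z.fst‖ ^ 2) := by
    gcongr; exact le_max_right _ _
  have h4 : 1 * ‖z.snd‖ ^ 2 ≤ max 1 (1 / L) * ‖z.snd‖ ^ 2 := by gcongr; exact le_max_left _ _
  rw [← mul_assoc, one_div_mul_cancel hL.ne', one_mul] at h3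
  have h5 : max 1 (1 / L) * ((L * ‖z.fst‖ ^ 2 + ‖z.snd‖ ^ 2) / 2) ≤ max 1 (1 / L) * obaboNormSq L γ z := by
    gcongr
  rw [phaseSpace_norm_sq]
  linarith

/-- The linear change of variables `(x, v) ↦ (a x, v + c x)` of the phase space. -/
noncomputable def shearEquiv {a : ℝ} (ha : a ≠ 0) (c : ℝ) : PhaseSpace d ≃ₗ[ℝ] PhaseSpace d where
  toFun z := WithLp.toLp 2 (a • z.fst, z.snd + c • z.fst)
  invFun z := WithLp.toLp 2 (a⁻¹ • z.fst, z.snd - (c * a⁻¹) • z.fst)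
  map_add' z z' := by
    refine phaseSpace_ext (smul_add a z.fst z'.fst) ?_
    change z.snd + z'.snd + c • (z.fst + z'.fst) = z.snd + c • z.fst + (z'.snd + c • z'.fst)
    rw [smul_add, add_add_add_comm]
  map_smul' r z := by
    refine phaseSpace_ext (smul_comm a r z.fst) ?_
    change r • z.snd + c • (r • z.fst) = r • (z.snd + c • z.fst)
    rw [smul_add, smul_comm]
  left_inv z := by
    refine phaseSpace_ext (inv_smul_smul₀ ha z.fst) ?_
    change z.snd + c • z.fst - (c * a⁻¹) • (a • z.fst) = z.snd
    rw [mul_smul, inv_smul_smul₀ ha, add_sub_cancel_right]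
  right_inv z := by
    refine phaseSpace_ext (smul_inv_smul₀ ha z.fst) ?_
    change z.snd - (c * a⁻¹) • z.fst + c • (a⁻¹ • z.fst) = z.snd
    rw [mul_smul, sub_add_cancel]

theorem norm_sq_shearEquiv {a : ℝ} (ha : a ≠ 0) (c : ℝ) (z : PhaseSpace d) :
    ‖shearEquiv ha c z‖ ^ 2 = a ^ 2 * ‖z.fst‖ ^ 2
      + (‖z.snd‖ ^ 2 + 2 * c * inner ℝ z.fst z.snd + c ^ 2 * ‖z.fst‖ ^ 2) := by
  rw [phaseSpace_norm_sq]
  change ‖a • z.fst‖ ^ 2 + ‖z.snd + c • z.fst‖ ^ 2 = _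
  rw [norm_add_smul_sq, norm_smul, mul_pow, Real.norm_eq_abs, sq_abs, real_inner_comm]

/-- The modified norm is Euclidean: it is the pull-back of the norm by a linear equivalence. -/
theorem exists_equiv_norm_sq_eq_obaboNormSq (hL : 0 < L) (hγ : 2 * √L ≤ γ) :
    ∃ e : PhaseSpace d ≃ₗ[ℝ] PhaseSpace d, ∀ z, ‖e z‖ ^ 2 = obaboNormSq L γ z := by
  have hγ0 : 0 < γ := lt_of_lt_of_le (by positivity) hγ
  have hpos : 0 < L - (L / γ) ^ 2 := by
    have h1 := four_mul_le_sq hL hγ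
    have h2 : (L / γ) ^ 2 ≤ L / 4 := by
      rw [div_pow, div_le_div_iff₀ (by positivity) (by norm_num)]
      nlinarith
    linarith
  refine ⟨shearEquiv (Real.sqrt_pos.2 hpos).ne' (L / γ), fun z => ?_⟩
  rw [norm_sq_shearEquiv, Real.sq_sqrt hpos.le, obaboNormSq]
  ring

end ObaboNorm

/-! ### Contraction and noise dependence of the OBABO step -/

section ObaboStep

variable {d : ℕ} {U : EuclideanSpace ℝ (Fin d) → ℝ} {L m γ δ : ℝ}

theorem obaboStep_fst (z : PhaseSpace d) (w : EuclideanSpace ℝ (Fin d) × EuclideanSpace ℝ (Fin d)) :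
    (obaboStep U γ δ z w).fst = z.fst + δ • (Real.exp (-(δ * γ / 2)) • z.snd
      + √(1 - Real.exp (-(δ * γ / 2)) ^ 2) • w.1) - (δ ^ 2 / 2) • gradient U z.fst :=
  rfl

theorem obaboStep_snd (z : PhaseSpace d) (w : EuclideanSpace ℝ (Fin d) × EuclideanSpace ℝ (Fin d)) :
    (obaboStep U γ δ z w).snd = Real.exp (-(δ * γ / 2)) ^ 2 • z.snd
      - (δ * Real.exp (-(δ * γ / 2)) / 2) •
        (gradient U z.fst + gradient U (obaboStep U γ δ z w).fst)
      + √(1 - Real.exp (-(δ * γ / 2)) ^ 2) • (Real.exp (-(δ * γ / 2)) • w.1 + w.2) :=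
  rfl

/-- Measuring positions in units of `1 / γ` makes the friction equal to `1`. -/
theorem obaboNormSq_eq_scaled (hγ : 0 < γ) (z : PhaseSpace d) :
    obaboNormSq L γ z = L / γ ^ 2 * ‖γ • z.fst‖ ^ 2 + 2 * (L / γ ^ 2) * inner ℝ (γ • z.fst) z.snd
      + ‖z.snd‖ ^ 2 := by
  rw [obaboNormSq, norm_smul, real_inner_smul_left, mul_pow, Real.norm_eq_abs, sq_abs]
  field_simp

/-- Synchronous coupling contracts the modified norm: two steps with the same noise. -/
theorem obaboNormSq_obaboStep_sub_le (hU : Differentiable ℝ U) (hL : 0 < L)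
    (hLip : ∀ x y, ‖gradient U x - gradient U y‖ ≤ L * ‖x - y‖) (hm : 0 < m) (hmL : m ≤ L)
    (hConv : ∀ x y, m * ‖x - y‖ ^ 2 ≤ inner ℝ (x - y) (gradient U x - gradient U y))
    (hγ : 2 * √L ≤ γ) (hδ : 0 < δ) (hδ' : δ ≤ m / (33 * γ ^ 3)) (z z' : PhaseSpace d)
    (w : EuclideanSpace ℝ (Fin d) × EuclideanSpace ℝ (Fin d)) :
    obaboNormSq L γ (obaboStep U γ δ z w - obaboStep U γ δ z' w)
      ≤ (1 - m * δ / (2 * γ)) * obaboNormSq L γ (z - z') := by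
  have hγ0 : 0 < γ := lt_of_lt_of_le (by positivity) hγ
  have h4 := four_mul_le_sq hL hγ
  have hco := norm_sq_gradient_sub_le_mul_inner hU hL hLip fun x y =>
    (mul_nonneg hm.le (sq_nonneg _)).trans (hConv x y)
  have e1 : m / γ ^ 2 * (δ * γ) / 2 = m * δ / (2 * γ) := by field_simp
  have scale1 : ∀ x p : EuclideanSpace ℝ (Fin d), m * ‖x‖ ^ 2 ≤ inner ℝ x p →
      m / γ ^ 2 * ‖γ • x‖ ^ 2 ≤ inner ℝ (γ • x) (γ⁻¹ • p) := fun x p h => by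
    rw [norm_smul, mul_pow, Real.norm_eq_abs, sq_abs, real_inner_smul_left, real_inner_smul_right,
      mul_inv_cancel_left₀ hγ0.ne', ← mul_assoc, div_mul_cancel₀ _ (by positivity)]
    exact h
  have scale2 : ∀ x p : EuclideanSpace ℝ (Fin d), ‖p‖ ^ 2 ≤ L * inner ℝ x p →
      ‖γ⁻¹ • p‖ ^ 2 ≤ L / γ ^ 2 * inner ℝ (γ • x) (γ⁻¹ • p) := fun x p h => by
    rw [norm_smul, mul_pow, Real.norm_eq_abs, sq_abs, real_inner_smul_left, real_inner_smul_right,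
      mul_inv_cancel_left₀ hγ0.ne', inv_pow, div_mul_eq_mul_div, inv_mul_eq_div]
    gcongr
  have hs : 0 ≤ δ * γ / 2 := by positivity
  have hη := Real.add_one_le_exp (-(δ * γ / 2))
  have hη' := exp_neg_le_quadratic hs
  rw [obaboNormSq_eq_scaled hγ0, obaboNormSq_eq_scaled hγ0, ← e1]
  set X := (obaboStep U γ δ z w).fst with hX
  set X' := (obaboStep U γ δ z' w).fst with hX'
  refine obabo_contraction_of_friction_one (h := δ * γ) (η := Real.exp (-(δ * γ / 2)))
    (p := γ⁻¹ • (gradient U z.fst - gradient U z'.fst)) (q := γ⁻¹ • (gradient U X - gradient U X'))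
    (by positivity) (by gcongr) ?_ (by positivity) ?_ (by linarith) (by linarith) ?_ ?_
    (scale1 _ _ (hConv _ _)) (scale2 _ _ (hco _ _)) (scale1 _ _ (hConv _ _)) (scale2 _ _ (hco _ _))
  · rw [div_le_iff₀ (by positivity)]; linarith
  · rw [le_div_iff₀ (by positivity)] at hδ' ⊢
    linarith
  · rw [WithLp.sub_fst, WithLp.sub_fst, WithLp.sub_snd, obaboStep_fst, obaboStep_fst]
    match_scalars <;> field_simp
    ring
  · rw [WithLp.sub_snd, WithLp.sub_snd, obaboStep_snd, obaboStep_snd]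
    match_scalars <;> field_simp <;> ring

/-- The OBABO step is Lipschitz in the noise, with constant of order `√(δ γ)`. -/
theorem obaboNormSq_obaboStep_sub_noise_le (hL : 0 < L)
    (hLip : ∀ x y, ‖gradient U x - gradient U y‖ ≤ L * ‖x - y‖)
    (hγ : 2 * √L ≤ γ) (hδ : 0 < δ) (hδγ : δ * γ ≤ 1 / 132) (z : PhaseSpace d)
    (w w' : EuclideanSpace ℝ (Fin d) × EuclideanSpace ℝ (Fin d)) :
    obaboNormSq L γ (obaboStep U γ δ z w - obaboStep U γ δ z w')
      ≤ 9 / 4 * (δ * γ) * (‖w.1 - w'.1‖ ^ 2 + ‖w.2 - w'.2‖ ^ 2) := by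
  have hγ0 : 0 < γ := lt_of_lt_of_le (by positivity) hγ
  have h4 := four_mul_le_sq hL hγ
  have hη := Real.add_one_le_exp (-(δ * γ / 2))
  have hη1 : Real.exp (-(δ * γ / 2)) ≤ 1 := Real.exp_le_one_iff.2 (by linarith [mul_pos hδ hγ0])
  have hη2 : 1 - Real.exp (-(δ * γ / 2)) ^ 2 ≤ δ * γ := by
    have := Real.add_one_le_exp (-(δ * γ))
    have e : Real.exp (-(δ * γ / 2)) ^ 2 = Real.exp (-(δ * γ)) := by
      rw [← Real.exp_nat_mul]; congr 1; push_cast; ring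
    rw [e]; linarith
  have hη3 : 0 ≤ 1 - Real.exp (-(δ * γ / 2)) ^ 2 := by
    linarith [pow_le_one₀ (n := 2) (Real.exp_pos (-(δ * γ / 2))).le hη1]
  rw [obaboNormSq_eq_scaled hγ0]
  set X := (obaboStep U γ δ z w).fst with hX
  set X' := (obaboStep U γ δ z w').fst with hX'
  refine obabo_noise_of_friction_one (s := √(1 - Real.exp (-(δ * γ / 2)) ^ 2))
    (η := Real.exp (-(δ * γ / 2))) (q := γ⁻¹ • (gradient U X - gradient U X'))
    (by positivity) ?_ (by positivity) hδγ (Real.exp_pos _).le hη1 ?_ ?_ ?_ ?_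
  · rw [div_le_iff₀ (by positivity)]; linarith
  · rw [Real.sq_sqrt hη3]; exact hη2
  · rw [WithLp.sub_fst, obaboStep_fst, obaboStep_fst]
    match_scalars <;> ring
  · rw [WithLp.sub_snd, obaboStep_snd, obaboStep_snd]
    match_scalars <;> field_simp <;> ring
  · rw [norm_smul, norm_smul, norm_inv, Real.norm_of_nonneg hγ0.le, WithLp.sub_fst,
      inv_mul_le_iff₀ hγ0]
    refine (hLip X X').trans (le_of_eq ?_)
    field_simp
    rfl

end ObaboStep

/-! ### The OBABO kernel is contractive -/

section ObaboKernel

variable {d : ℕ} {U : EuclideanSpace ℝ (Fin d) → ℝ} {L m γ δ : ℝ}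

theorem isMarkovKernel_obaboKernel (hU : Measurable (gradient U)) (γ δ : ℝ) :
    IsMarkovKernel (obaboKernel U γ δ) :=
  Kernel.IsMarkovKernel.map _ (measurable_obaboStep hU γ δ)

theorem LinearEquiv.lipschitzWith_of_norm_sq_le {E F : Type*} [NormedAddCommGroup E]
    [NormedSpace ℝ E] [NormedAddCommGroup F] [NormedSpace ℝ F] (e : E ≃ₗ[ℝ] F) {c : ℝ}
    (h : ∀ z, ‖e z‖ ^ 2 ≤ c * ‖z‖ ^ 2) : LipschitzWith (√c).toNNReal e := by
  refine LipschitzWith.of_dist_le_mul fun z z' => ?_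
  rw [dist_eq_norm, dist_eq_norm, ← map_sub, Real.coe_toNNReal _ (Real.sqrt_nonneg _)]
  rw [← Real.sqrt_sq (norm_nonneg (e (z - z'))), ← Real.sqrt_sq (norm_nonneg (z - z')),
    ← Real.sqrt_mul' _ (sq_nonneg _)]
  exact Real.sqrt_le_sqrt (h _)

/-- A linear equivalence of finite-dimensional spaces as a measurable equivalence. -/
noncomputable def LinearEquiv.toMeasurableEquivOfFiniteDimensional {E F : Type*}
    [NormedAddCommGroup E] [NormedSpace ℝ E] [FiniteDimensional ℝ E] [MeasurableSpace E]
    [BorelSpace E] [NormedAddCommGroup F] [NormedSpace ℝ F] [MeasurableSpace F] [BorelSpace F]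
    (e : E ≃ₗ[ℝ] F) : E ≃ᵐ F :=
  e.toContinuousLinearEquiv.toHomeomorph.toMeasurableEquiv

theorem timeStep_mul_friction_le (hL : 0 < L) (hmL : m ≤ L) (hγ : 2 * √L ≤ γ)
    (hδ' : δ ≤ m / (33 * γ ^ 3)) : δ * γ ≤ 1 / 132 := by
  have hγ0 : 0 < γ := lt_of_lt_of_le (by positivity) hγ
  rw [le_div_iff₀ (by positivity)] at hδ'
  have h1 : 33 * (δ * γ) * γ ^ 2 ≤ 1 / 4 * γ ^ 2 := by linarith [four_mul_le_sq hL hγ]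
  linarith [le_of_mul_le_mul_right h1 (by positivity)]

theorem contractionRate_le_one (hL : 0 < L) (hmL : m ≤ L) (hγ : 2 * √L ≤ γ) (hδ : 0 < δ)
    (hδ' : δ ≤ m / (33 * γ ^ 3)) : m * δ / (2 * γ) ≤ 1 := by
  have hγ0 : 0 < γ := lt_of_lt_of_le (by positivity) hγ
  rw [div_le_one (by positivity)]
  have h1 : m * δ ≤ γ ^ 2 / 4 * δ := by
    gcongr
    linarith [four_mul_le_sq hL hγ]
  have h2 : γ * (δ * γ) ≤ γ * (1 / 132) := by
    gcongr
    exact timeStep_mul_friction_le hL hmL hγ hδ'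
  linarith

/-- In the variables `e`, where the modified norm is the Euclidean one, the OBABO kernel is contractive.
The constant is `2`, from the Gaussian log-Sobolev inequality, times the square of the Lipschitz
constant with respect to the noise. -/
theorem isContractiveKernel_obabo (hU : Differentiable ℝ U) (hL : 0 < L)
    (hLip : ∀ x y, ‖gradient U x - gradient U y‖ ≤ L * ‖x - y‖) (hm : 0 < m) (hmL : m ≤ L)
    (hConv : ∀ x y, m * ‖x - y‖ ^ 2 ≤ inner ℝ (x - y) (gradient U x - gradient U y))
    (hγ : 2 * √L ≤ γ) (hδ : 0 < δ) (hδ' : δ ≤ m / (33 * γ ^ 3))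
    {e : PhaseSpace d ≃ₗ[ℝ] PhaseSpace d} (he : ∀ z, ‖e z‖ ^ 2 = obaboNormSq L γ z) :
    IsContractiveKernel (conjKernel (obaboKernel U γ δ) e.toMeasurableEquivOfFiniteDimensional)
      ((stdGaussian (EuclideanSpace ℝ (Fin d))).prod (stdGaussian (EuclideanSpace ℝ (Fin d))))
      (fun z w => e (obaboStep U γ δ (e.symm z) w)) (√(1 - m * δ / (2 * γ)))
      (9 / 2 * (δ * γ)) := by
  have hγ0 : 0 < γ := lt_of_lt_of_le (by positivity) hγ
  have hgm : Measurable (gradient U) := by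
    refine (LipschitzWith.of_dist_le_mul (K := L.toNNReal) fun x y => ?_).continuous.measurable
    rw [dist_eq_norm, dist_eq_norm, Real.coe_toNNReal _ hL.le]
    exact hLip x y
  have hδγ := timeStep_mul_friction_le hL hmL hγ hδ'
  have ht0 : 0 < m * δ / (2 * γ) := by positivity
  have hemeas : Measurable e := e.toMeasurableEquivOfFiniteDimensional.measurable
  have hstep : ∀ z, Measurable (obaboStep U γ δ z) := fun z =>
    (measurable_obaboStep hgm γ δ).comp measurable_prodMk_left
  have happly : ∀ z, conjKernel (obaboKernel U γ δ) e.toMeasurableEquivOfFiniteDimensional z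
      = ((stdGaussian (EuclideanSpace ℝ (Fin d))).prod (stdGaussian (EuclideanSpace ℝ (Fin d)))).map
        (fun w => e (obaboStep U γ δ (e.symm z) w)) := fun z => by
    rw [conjKernel_apply, obaboKernel_apply hgm, Measure.map_map e.toMeasurableEquivOfFiniteDimensional.measurable
      (hstep _)]
    rfl
  refine ⟨fun z => hemeas.comp (hstep _), happly, Real.sqrt_nonneg _, ?_, fun w z z' => ?_, by positivity,
    fun z => ?_⟩
  · rw [Real.sqrt_lt' one_pos]
    linarith
  · have h1 := obaboNormSq_obaboStep_sub_le hU hL hLip hm hmL hConv hγ hδ hδ' (e.symm z) (e.symm z') w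
    rw [← he, ← he, map_sub, map_sub, e.apply_symm_apply, e.apply_symm_apply] at h1
    rw [dist_eq_norm, dist_eq_norm, ← Real.sqrt_sq (norm_nonneg (z - z')),
      ← Real.sqrt_mul' _ (sq_nonneg _)]
    exact Real.le_sqrt_of_sq_le h1
  · have hF : LipschitzWith (√(9 / 4 * (δ * γ))).toNNReal
        fun w : PhaseSpace d => e (obaboStep U γ δ (e.symm z) w.ofLp) := by
      refine LipschitzWith.of_dist_le_mul fun w w' => ?_
      have h1 := obaboNormSq_obaboStep_sub_noise_le hL hLip hγ hδ hδγ (e.symm z) w.ofLp w'.ofLp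
      rw [← he, map_sub] at h1
      rw [dist_eq_norm, dist_eq_norm, Real.coe_toNNReal _ (Real.sqrt_nonneg _),
        ← Real.sqrt_sq (norm_nonneg (w - w')), ← Real.sqrt_mul' _ (sq_nonneg _)]
      refine Real.le_sqrt_of_sq_le (h1.trans (le_of_eq ?_))
      rw [phaseSpace_norm_sq]
      rfl
    have h2 := (logSobolev_stdGaussian (E := PhaseSpace d)).map zero_le_two hF
    rw [← stdGaussian_prod_map_toLp, Measure.map_map hF.continuous.measurable
      (WithLp.measurable_toLp 2 _), Real.coe_toNNReal _ (Real.sqrt_nonneg _),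
      Real.sq_sqrt (by positivity)] at h2
    rw [happly, show 9 / 2 * (δ * γ) = 2 * (9 / 4 * (δ * γ)) by ring]
    exact h2

end ObaboKernel

/-! ### Dimension zero -/

section Subsingleton

variable {S : Type*} [MeasurableSpace S] [Subsingleton S]

theorem eq_of_isProbabilityMeasure_of_subsingleton (μ ν : Measure S) [IsProbabilityMeasure μ]
    [IsProbabilityMeasure ν] : μ = ν := by
  ext s -
  rcases s.eq_empty_or_nonempty with rfl | hs
  · simp
  · rw [Subsingleton.eq_univ_of_nonempty hs, measure_univ, measure_univ]

theorem integral_of_subsingleton (μ : Measure S) [IsProbabilityMeasure μ] (f : S → ℝ) (z : S) :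
    ∫ y, f y ∂μ = f z := by
  have : f = fun _ => f z := funext fun y => congrArg f (Subsingleton.elim y z)
  rw [this]
  simp

end Subsingleton

theorem logSobolev_of_subsingleton {S : Type*} [PseudoMetricSpace S] [MeasurableSpace S]
    [Subsingleton S] (μ : Measure S) [IsProbabilityMeasure μ] {C : ℝ} (hC : 0 ≤ C) :
    LogSobolev μ C := by
  intro φ _ _
  obtain ⟨z⟩ := nonempty_of_isProbabilityMeasure μ
  rw [integral_of_subsingleton μ _ z, integral_of_subsingleton μ _ z, sub_self]
  exact mul_nonneg hC (integral_nonneg fun _ => sq_nonneg _)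

/-! ### Comparison of constants and conclusion -/

section Constants

/-- Links the bounds `3 / 2 * max L 1` and `2 * max 1 (1 / L)` of the squared Lipschitz constants of the
change of variables and of its inverse to `K₁ ^ 2`. -/
theorem max_mul_max_one_div {L : ℝ} (hL : 0 < L) :
    max L 1 * max 1 (1 / L) = (max (√L) (1 / √L)) ^ 2 := by
  have hs : 0 < √L := Real.sqrt_pos.2 hL
  rcases le_total 1 L with h | h
  · have h1 : 1 / L ≤ 1 := by rw [div_le_one hL]; exact h
    have h2 : 1 ≤ √L := Real.one_le_sqrt.2 h
    have h3 : 1 / √L ≤ √L := ((div_le_one hs).2 h2).trans h2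
    rw [max_eq_left h, max_eq_left h1, max_eq_left h3, Real.sq_sqrt hL.le, mul_one]
  · have h1 : 1 ≤ 1 / L := by rw [le_div_iff₀ hL]; linarith
    have h2 : √L ≤ 1 := Real.sqrt_le_one.2 h
    have h3 : √L ≤ 1 / √L := h2.trans ((one_le_div hs).2 h2)
    rw [max_eq_right h, max_eq_right h1, max_eq_right h3, div_pow, Real.sq_sqrt hL.le]
    ring

/-- Comparison of the exponent given by the contraction rate `ρ` with the one written in terms of
`s = κ δ`, where `1 - ρ ^ 2 = 3 s / 2`. -/
theorem concentration_exponent_le {s ρ C C_lS C' a b K n u : ℝ} (hs : 0 < s) (hρ1 : 0 < 1 - ρ)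
    (hρ : 3 / 4 * s ≤ 1 - ρ) (hb : 0 < b) (hC : 0 < C)
    (hCb : C / (3 / 2 * s) * b ^ 2 ≤ C_lS) (hC' : 0 < C') (hK : (a * b) ^ 2 ≤ K ^ 2) (hn : 0 < n) :
    n * u ^ 2 * s / (4 * C_lS + 4 * K ^ 2 * C' / (n * s))
      ≤ (n * u) ^ 2 / ((b / (1 - ρ)) ^ 2 * (n * C + C' * a ^ 2)) := by
  have hCl : 0 < C_lS := lt_of_lt_of_le (by positivity) hCb
  have hr : (1 / (1 - ρ)) ^ 2 ≤ (4 / (3 * s)) ^ 2 := by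
    refine pow_le_pow_left₀ (by positivity) ?_ 2
    rw [div_le_div_iff₀ hρ1 (by positivity)]
    linarith
  have hCb' : C * b ^ 2 ≤ C_lS * (3 / 2 * s) := by
    rwa [div_mul_eq_mul_div, div_le_iff₀ (by positivity)] at hCb
  have hD : (b / (1 - ρ)) ^ 2 * (n * C + C' * a ^ 2)
      ≤ n / s * (4 * C_lS + 4 * K ^ 2 * C' / (n * s)) := by
    calc (b / (1 - ρ)) ^ 2 * (n * C + C' * a ^ 2)
        = (1 / (1 - ρ)) ^ 2 * (n * (C * b ^ 2) + C' * (a * b) ^ 2) := by ring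
      _ ≤ (4 / (3 * s)) ^ 2 * (n * (C_lS * (3 / 2 * s)) + C' * K ^ 2) := by gcongr
      _ = n / s * (8 / 3 * C_lS + 16 / 9 * K ^ 2 * C' / (n * s)) := by
          field_simp
          ring
      _ ≤ n / s * (4 * C_lS + 4 * K ^ 2 * C' / (n * s)) := by
          gcongr <;> norm_num
  have hD0 : 0 < (b / (1 - ρ)) ^ 2 * (n * C + C' * a ^ 2) := by positivity
  calc n * u ^ 2 * s / (4 * C_lS + 4 * K ^ 2 * C' / (n * s))
      = (n * u) ^ 2 / (n / s * (4 * C_lS + 4 * K ^ 2 * C' / (n * s))) := by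
        have : 4 * C_lS + 4 * K ^ 2 * C' / (n * s) ≠ 0 := by positivity
        generalize 4 * C_lS + 4 * K ^ 2 * C' / (n * s) = A at this
        field_simp
    _ ≤ _ := div_le_div_of_nonneg_left (sq_nonneg _) hD0 hD

end Constants

theorem mainTheorem4 (d : ℕ) (U : EuclideanSpace ℝ (Fin d) → ℝ) (L m γ δ : ℝ)
    (hU : ContDiff ℝ 2 U)
    (hL : 0 < L)
    (hLip : ∀ x y, ‖gradient U x - gradient U y‖ ≤ L * ‖x - y‖)
    (hm : 0 < m)
    (hConv : ∀ x y, m * ‖x - y‖ ^ 2 ≤ inner ℝ (x - y) (gradient U x - gradient U y))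
    (hγ : 2 * √L ≤ γ)
    (hδ : 0 < δ)
    (hδ' : δ ≤ m / (33 * γ ^ 3))
    (K₁ κ C_lS : ℝ)
    (hK₁ : K₁ = √3 * max (√L) (1 / √L))
    (hκ : κ = m / (3 * γ))
    (hC_lS : C_lS = 6 / m * K₁ ^ 2 * γ ^ 2 * (1 + δ + δ ^ 2 * L / 2) ^ 2) :
    ∃ π_δ : Measure (PhaseSpace d),
      -- `π_δ` is the unique invariant probability distribution of the OBABO chain
      IsProbabilityMeasure π_δ ∧
      (obaboKernel U γ δ).Invariant π_δ ∧
      (∀ ν : Measure (PhaseSpace d), IsProbabilityMeasure ν →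
        (obaboKernel U γ δ).Invariant ν → ν = π_δ) ∧
      LogSobolev π_δ C_lS ∧
      (∀ φ : PhaseSpace d → ℝ, LipschitzWith 1 φ → Integrable φ π_δ) ∧
      ∀ (μ₀ : Measure (PhaseSpace d)) (C' : ℝ), IsProbabilityMeasure μ₀ → 0 < C' →
        LogSobolev μ₀ C' →
        wasserstein1 μ₀ π_δ ≠ ⊤ ∧
        ∀ {Ω : Type*} [MeasurableSpace Ω] (Pr : Measure Ω) [IsProbabilityMeasure Pr]
          (Z : ℕ → Ω → PhaseSpace d), IsMarkovChain (obaboKernel U γ δ) μ₀ Pr Z →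
        ∀ φ : PhaseSpace d → ℝ, LipschitzWith 1 φ → ∀ n : ℕ, 1 ≤ n → ∀ u : ℝ, 0 ≤ u →
          Pr.real {ω | u + 2 * K₁ / (n * κ * δ) * (wasserstein1 μ₀ π_δ).toReal ≤
              |1 / (n : ℝ) * ∑ k ∈ Finset.Icc 1 n, φ (Z k ω) - ∫ z, φ z ∂π_δ|}
            ≤ 2 * Real.exp (-(n * u ^ 2 * κ * δ /
                (4 * C_lS + 4 * K₁ ^ 2 * C' / (n * κ * δ)))) := by
  have hγ0 : 0 < γ := lt_of_lt_of_le (by positivity) hγ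
  have hκ0 : 0 < κ := by rw [hκ]; positivity
  have hK0 : 0 < K₁ := by rw [hK₁]; have := Real.sqrt_pos.2 hL; positivity
  have hC0 : 0 < C_lS := by rw [hC_lS]; positivity
  have hgm : Measurable (gradient U) := by
    refine (LipschitzWith.of_dist_le_mul (K := L.toNNReal) fun x y => ?_).continuous.measurable
    rw [dist_eq_norm, dist_eq_norm, Real.coe_toNNReal _ hL.le]
    exact hLip x y
  have hMarkov := isMarkovKernel_obaboKernel hgm γ δ
  rcases Nat.eq_zero_or_pos d with rfl | hd
  · -- in dimension `0` the phase space is a point, and `m ≤ L` is not available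
    have hsub : Subsingleton (PhaseSpace 0) :=
      ⟨fun z z' => phaseSpace_ext (Subsingleton.elim _ _) (Subsingleton.elim _ _)⟩
    have hint : ∀ φ : PhaseSpace 0 → ℝ, Integrable φ (Measure.dirac 0) := fun φ =>
      (integrable_const (φ 0)).congr
        (Eventually.of_forall fun z => congrArg φ (Subsingleton.elim 0 z))
    refine ⟨Measure.dirac 0, inferInstance, eq_of_isProbabilityMeasure_of_subsingleton _ _,
      fun ν _ _ => eq_of_isProbabilityMeasure_of_subsingleton _ _,
      logSobolev_of_subsingleton _ hC0.le, fun φ _ => hint φ, fun μ₀ C' hp hC' hμ₀ => ?_⟩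
    obtain rfl := eq_of_isProbabilityMeasure_of_subsingleton μ₀ (Measure.dirac 0)
    refine ⟨wasserstein1_ne_top 0 (hint _) (hint _), fun Pr _ Z hZ φ hφ n hn u hu => ?_⟩
    have hn0 : (0 : ℝ) < n := by exact_mod_cast hn
    have hconst : ∀ ω, |1 / (n : ℝ) * ∑ k ∈ Finset.Icc 1 n, φ (Z k ω)
        - ∫ z, φ z ∂(Measure.dirac 0)| = 0 := fun ω => by
      have h1 : ∀ k, φ (Z k ω) = φ 0 := fun k => congrArg φ (Subsingleton.elim _ _)
      rw [integral_of_subsingleton _ _ 0]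
      simp only [h1, Finset.sum_const, Nat.card_Icc, add_tsub_cancel_right, nsmul_eq_mul]
      rw [one_div_mul_eq_div, mul_div_cancel_left₀ _ hn0.ne', sub_self, abs_zero]
    simp only [hconst]
    rcases hu.eq_or_lt with rfl | hu
    · refine measureReal_le_one.trans ?_
      norm_num
    · have hpos : ¬ u + 2 * K₁ / (n * κ * δ)
          * (wasserstein1 (Measure.dirac (0 : PhaseSpace 0)) (Measure.dirac 0)).toReal ≤ 0 := by
        have : 0 ≤ 2 * K₁ / (n * κ * δ)
          * (wasserstein1 (Measure.dirac (0 : PhaseSpace 0)) (Measure.dirac 0)).toReal := by positivity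
        linarith
      simp only [hpos, Set.ofPred_false, measureReal_empty]
      positivity
  have hmL : m ≤ L := by
    have : Nonempty (Fin d) := ⟨⟨0, hd⟩⟩
    obtain ⟨x, hx⟩ := exists_ne (0 : EuclideanSpace ℝ (Fin d))
    have hx0 : 0 < ‖x - 0‖ ^ 2 := by rw [sub_zero]; have := norm_pos_iff.2 hx; positivity
    have h1 := (hConv x 0).trans (real_inner_le_norm _ _)
    have h2 := mul_le_mul_of_nonneg_left (hLip x 0) (norm_nonneg (x - 0))
    refine le_of_mul_le_mul_right (h1.trans (h2.trans (le_of_eq ?_))) hx0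
    ring
  obtain ⟨e, he⟩ := exists_equiv_norm_sq_eq_obaboNormSq (d := d) hL hγ
  have hcontr := isContractiveKernel_obabo (hU.differentiable (by norm_num)) hL hLip hm hmL hConv hγ
    hδ hδ' he
  -- the Lipschitz constants of the change of variables and of its inverse; `a * b = K₁`
  set a : ℝ≥0 := (√(3 / 2 * max L 1)).toNNReal with ha
  set b : ℝ≥0 := (√(2 * max 1 (1 / L))).toNNReal with hb
  have hL1 : 0 < max L 1 := lt_max_of_lt_left hL
  have hL2 : (1 : ℝ) ≤ max 1 (1 / L) := le_max_left _ _
  have ha2 : (a : ℝ) ^ 2 = 3 / 2 * max L 1 := by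
    rw [ha, Real.coe_toNNReal _ (Real.sqrt_nonneg _), Real.sq_sqrt (by positivity)]
  have hb2 : (b : ℝ) ^ 2 = 2 * max 1 (1 / L) := by
    rw [hb, Real.coe_toNNReal _ (Real.sqrt_nonneg _), Real.sq_sqrt (by positivity)]
  have ha0 : a ≠ 0 := by
    intro h
    rw [h, NNReal.coe_zero] at ha2
    norm_num at ha2
    linarith
  have hb0 : (0 : ℝ) < b := by
    refine lt_of_le_of_ne b.coe_nonneg fun h => ?_
    rw [← h] at hb2
    linarith
  have hab2 : ((a : ℝ) * b) ^ 2 = K₁ ^ 2 := by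
    rw [mul_pow, ha2, hb2, hK₁, mul_pow, Real.sq_sqrt (by norm_num), ← max_mul_max_one_div hL]
    ring
  have hab : (a : ℝ) * b = K₁ := (sq_eq_sq₀ (by positivity) hK0.le).1 hab2
  have hea : LipschitzWith a e.toMeasurableEquivOfFiniteDimensional :=
    e.lipschitzWith_of_norm_sq_le fun z => by rw [he]; exact obaboNormSq_le hL hγ z
  have heb : LipschitzWith b e.toMeasurableEquivOfFiniteDimensional.symm :=
    e.symm.lipschitzWith_of_norm_sq_le fun z => by
      have := norm_sq_le_obaboNormSq hL hγ (e.symm z)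
      rwa [← he, e.apply_symm_apply] at this
  obtain ⟨π, hπ, hinv, huniq, hLS, hint, hconc⟩ := hcontr.exists_invariant_of_conj ha0 hea heb
  set ρ : ℝ := √(1 - m * δ / (2 * γ)) with hρ
  -- `1 - ρ ^ 2 = 3 κ δ / 2`, and `1 - ρ` is at least half of it
  have hs : m * δ / (2 * γ) = 3 / 2 * (κ * δ) := by rw [hκ]; field_simp
  have hρ0 : 0 ≤ ρ := Real.sqrt_nonneg _
  have hρ1 : 0 < 1 - ρ := by linarith [hcontr.lt_one]
  have hρ2 : ρ ^ 2 = 1 - 3 / 2 * (κ * δ) := by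
    rw [← hs, hρ]
    exact Real.sq_sqrt (sub_nonneg.2 (contractionRate_le_one hL hmL hγ hδ hδ'))
  have hρ3 : 3 / 4 * (κ * δ) ≤ 1 - ρ := by nlinarith
  have hκδ : 0 < κ * δ := mul_pos hκ0 hδ
  have hCb : 9 / 2 * (δ * γ) / (3 / 2 * (κ * δ)) * (b : ℝ) ^ 2 ≤ C_lS := by
    have h1 : 1 ≤ max L 1 := le_max_right _ _
    have h2 : 1 ≤ 1 + δ + δ ^ 2 * L / 2 := by
      have : 0 ≤ δ ^ 2 * L / 2 := by positivity
      linarith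
    calc 9 / 2 * (δ * γ) / (3 / 2 * (κ * δ)) * (b : ℝ) ^ 2
        = 6 / m * (3 * (1 * max 1 (1 / L))) * γ ^ 2 * 1 ^ 2 := by
          rw [hb2, hκ]
          field_simp
          ring
      _ ≤ 6 / m * (3 * (max L 1 * max 1 (1 / L))) * γ ^ 2 * (1 + δ + δ ^ 2 * L / 2) ^ 2 := by
          gcongr
      _ = C_lS := by
          rw [hC_lS, hK₁, mul_pow, Real.sq_sqrt (by norm_num), max_mul_max_one_div hL]
  refine ⟨π, hπ, hinv, huniq, hLS.mono ?_, fun φ hφ => hint φ 1 hφ,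
    fun μ₀ C' hp hC' hμ₀ => ?_⟩
  · rw [hρ2, sub_sub_cancel]
    exact hCb
  obtain ⟨hW, hconc⟩ := hconc μ₀ C' hp hC'.le hμ₀
  refine ⟨hW, fun Pr _ Z hZ φ hφ n hn u hu => ?_⟩
  have hn0 : (0 : ℝ) < n := by exact_mod_cast hn
  refine (measureReal_mono (fun ω hω => ?_) (measure_ne_top _ _)).trans
    ((hconc Pr Z hZ φ hφ n hn u hu).trans ?_)
  · refine (add_le_add_right (mul_le_mul_of_nonneg_right ?_ ENNReal.toReal_nonneg) u).trans hω
    rw [hab, div_le_div_iff₀ (by positivity) (by positivity)]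
    have h1 : κ * δ ≤ 2 * (1 - ρ) := by linarith
    have h2 := mul_le_mul_of_nonneg_left h1 (mul_nonneg hK0.le hn0.le)
    linarith
  · have key := concentration_exponent_le (u := u) hκδ hρ1 hρ3 hb0 (by positivity) hCb hC' hab2.le hn0
    have e1 : n * u ^ 2 * κ * δ / (4 * C_lS + 4 * K₁ ^ 2 * C' / (n * κ * δ))
        = n * u ^ 2 * (κ * δ) / (4 * C_lS + 4 * K₁ ^ 2 * C' / (n * (κ * δ))) := by
      rw [mul_assoc _ κ δ, mul_assoc _ κ δ]
    rw [e1]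
    gcongr
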